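/- An $\ell$-group is a topological group whose underlying space is Hausdorff, locally compact, totally disconnected and second countable. Representations are complex; a vector is smooth if it is fixed by an open subgroup, and $\mathcal M(G)$ denotes the abelian category of smooth representations of $G$ (all vectors smooth). Characters are locally constant homomorphisms to $\mathbb C^\times$, and $V^\vee$ is the smooth contragredient (the smooth vectors of the full dual). For $V_1,V_2\in\mathcal M(G)$ and $k\in\mathbb N=\{0,1,2,\dots\}$, let $\mathrm{Hom}_{G,k}(V_1,V_2)$ be the space of $\phi\in\mathrm{Hom}_{\mathbb C}(V_1,V_2)$ with $(g_0-1)(g_1-1)\cdots(g_k-1).\phi=0$ for all $g_0,\dots,g_k\in G$, where $g.\phi=g\circ\phi\circ g^{-1}$, and let $\mathrm{Ext}^i_{G,k}(V_1,V_2)$ be the $i$-th cohomology of $\mathrm{Hom}_{G,k}(P_\bullet,V_2)$ for a projective resolution $P_\bullet\to V_1$ in $\mathcal M(G)$. $\mathrm{Ext}^i_H$ is the usual Ext in $\mathcal M(H)$. (All Ext groups are zero in negative degrees, so let $i\ge 0$.) Let $G^\circ$ be the subgroup generated by all compact subgroups of $G$, $\Lambda_G=G/G^\circ$, $\mathrm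 I_G\subset\mathbb C[\Lambda_G]$ the augmentation ideal, and $\mathrm J_{G,k}=\mathbb C[\Lambda_G]/\mathrm I_G^{k+1}$, a smooth representation of $G$ by left translations; $\bar g$ is the image of $g\in G$ in $\mathrm J_{G,k}$. Let $H$ be a closed subgroup of an $\ell$-group $G$. For $V_0\in\mathcal M(H)$, $\mathrm{ind}_H^GV_0$ is the space of locally constant functions $\phi:G\to V_0$ with $\phi(hg)=h.\phi(g)$ for $h\in H$, $g\in G$ and support compact modulo left translations by $H$, with $G$ acting by right translations. $\mathcal S(G/H)$ is the space of compactly supported locally constant complex functions on $G/H$ with $(g.f)(x)=f(g^{-1}x)$; for a character $\chi$ of $G$, $G/H$ is called $\chi$-admissible if $\mathrm{Hom}_G(\mathcal S(G/H),\chi)\ne0$. Then the following hold. (0) There is a unique character $\delta=\delta_{H\backslash G}$ of $H$ such that $\mathrm{Hom}_G(\mathrm{ind}_H^G\delta^{-1},\mathbb C)\neq0$, and this space is one-dimensional. (1) Fix a generator $\lambda$ of $\mathrm{Hom}_G(\mathrm{ind}_H^G\delta^{-1},\mathbb C)$. For all $k,i\in\mathbb N$ there is a canonical linear isomorphism $$\mathrm{Ext}^i_{G,k}(\mathrm{ind}_H^GV_0,V^\vee)\cong\mathrm{Ext}^i_H\bigl(\delta_{H\backslash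 G}\otimes\mathrm J_{G,k}\otimes V_0,(V|_H)^\vee\bigr),$$ natural in $V_0\in\mathcal M(H)$ and $V\in\mathcal M(G)$. Here canonical means: there is an isomorphism $\mathrm{Hom}_{G,k}(\mathrm{ind}_H^GV_0,V^\vee)\cong\mathrm{Hom}_H(\delta_{H\backslash G}\otimes\mathrm J_{G,k}\otimes V_0,(V|_H)^\vee)$, natural in $V_0$ and $V$, whose inverse sends $\psi$ to $\phi\mapsto\bigl(v\mapsto\lambda\bigl(g\mapsto\langle\psi(1\otimes\bar g\otimes\phi(g)),g.v\rangle\bigr)\bigr)$, and the isomorphism of Ext groups is the one it induces on projective resolutions of $V_0$. (2) For every character $\chi$ of $G$ and all $k,i\in\mathbb N$ there is a linear isomorphism $\mathrm{Ext}^i_{G,k}(\mathcal S(G/H),\chi)\cong\mathrm{Ext}^i_H(\delta_{H\backslash G}\otimes\mathrm J_{G,k},\chi|_H)$. (3) For every character $\chi$ of $G$, $G/H$ is $\chi$-admissible if and only if $\chi|_H=\delta_{H\backslash G}$. -/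

import Mathlib

open CategoryTheory Limits Topology Pointwise MonoidalCategory Opposite

noncomputable section

/-- An `ℓ`-group: a topological group whose underlying space is Hausdorff, locally compact,
totally disconnected and second countable. -/
class IsLGroup (G : Type) [Group G] [TopologicalSpace G] : Prop extends
  IsTopologicalGroup G, T2Space G, LocallyCompactSpace G, TotallyDisconnectedSpace G,
  SecondCountableTopology G

namespace IsLGroup

instance subgroup {G : Type} [Group G] [TopologicalSpace G] [IsLGroup G] (H : Subgroup G)
    [hH : IsClosed (H : Set G)] : IsLGroup H where
  toLocallyCompactSpace := hH.locallyCompactSpace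
  toTotallyDisconnectedSpace := inferInstance
  toSecondCountableTopology := TopologicalSpace.Subtype.secondCountableTopology (H : Set G)
  toT2Space := inferInstance

/-- Compact open subgroups form a basis of neighbourhoods of the identity. -/
theorem exists_compact_openSubgroup {G : Type} [Group G] [TopologicalSpace G] [IsLGroup G]
    {U : Set G} (hU : U ∈ 𝓝 (1 : G)) :
    ∃ K : OpenSubgroup G, IsCompact (K : Set G) ∧ (K : Set G) ⊆ U := by
  obtain ⟨C, hC, hCc, hCU⟩ := exists_mem_nhds_isCompact_mapsTo (f := id) continuous_id
    (x := (1 : G)) (s := U) hU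
  obtain ⟨W, hW, h1W, hWC⟩ :=
    (loc_compact_Haus_tot_disc_of_zero_dim (H := G)).mem_nhds_iff.1 hC
  have hWc : IsCompact W := hCc.of_isClosed_subset hW.1 hWC
  obtain ⟨T, hT, hWT⟩ := compact_open_separated_mul_right hWc hW.2 subset_rfl
  let K : Subgroup G :=
    { carrier := {g | ∀ w, w * g ∈ W ↔ w ∈ W}
      one_mem' := fun w => by simp
      mul_mem' := fun {a b} ha hb w => by rw [← mul_assoc, hb, ha]
      inv_mem' := fun {a} ha w => by rw [← ha (w * a⁻¹)]; simp }
  have hK : IsOpen (K : Set G) := by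
    refine K.isOpen_of_mem_nhds (g := 1) ?_
    filter_upwards [hT, inv_mem_nhds_one G hT] with g hg hg' w
    refine ⟨fun h => ?_, fun h => hWT (Set.mul_mem_mul h hg)⟩
    simpa using hWT (Set.mul_mem_mul h hg')
  have hKW : (K : Set G) ⊆ W := fun g hg => by simpa using (hg 1).2 h1W
  exact ⟨⟨K, hK⟩, hWc.of_isClosed_subset (K.isClosed_of_isOpen hK) hKW,
    fun g hg => hCU (hWC (hKW hg))⟩

end IsLGroup

section SmoothVectors

variable {G : Type} [Group G] [TopologicalSpace G] [IsTopologicalGroup G]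
  {V : Type} [AddCommGroup V] [Module ℂ V]

/-- A vector is smooth if it is fixed by an open subgroup. -/
def Representation.IsSmoothVector (ρ : Representation ℂ G V) (v : V) : Prop :=
  ∃ U : OpenSubgroup G, ∀ g ∈ U, ρ g v = v

theorem Representation.isSmoothVector_iff (ρ : Representation ℂ G V) (v : V) :
    ρ.IsSmoothVector v ↔ ∀ᶠ g in 𝓝 (1 : G), ρ g v = v := by
  constructor
  · rintro ⟨U, hU⟩
    filter_upwards [U.mem_nhds_one] with g hg using hU g hg
  · intro h
    let K : Subgroup G :=
      { carrier := {g | ρ g v = v}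
        one_mem' := by simp
        mul_mem' := fun {a b} ha hb => by
          change ρ (a * b) v = v
          rw [map_mul, Module.End.mul_apply, hb, ha]
        inv_mem' := fun {a} ha => by
          change ρ a⁻¹ v = v
          conv_lhs => rw [← ha]
          simp }
    exact ⟨⟨K, K.isOpen_of_mem_nhds (g := 1) h⟩, fun g hg => hg⟩

theorem Representation.IsSmoothVector.isLocallyConstant {ρ : Representation ℂ G V} {v : V}
    (hv : ρ.IsSmoothVector v) : IsLocallyConstant fun g => ρ g v := by
  rw [IsLocallyConstant.iff_eventually_eq]
  intro g
  have h := (ρ.isSmoothVector_iff v).1 hv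
  have hc : Filter.Tendsto (fun y : G => g⁻¹ * y) (𝓝 g) (𝓝 1) := by
    have : Continuous fun y : G => g⁻¹ * y := by fun_prop
    simpa using this.tendsto g
  filter_upwards [hc.eventually h] with y hy
  conv_rhs => rw [← hy]
  rw [← Module.End.mul_apply, ← map_mul, mul_inv_cancel_left]

/-- The subspace of smooth vectors. -/
def Representation.smoothVectors (ρ : Representation ℂ G V) : Submodule ℂ V where
  carrier := {v | ρ.IsSmoothVector v}
  zero_mem' := ⟨⊤, by simp⟩
  add_mem' {a b} ha hb := by
    rw [Set.mem_ofPred_eq, isSmoothVector_iff] at *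
    filter_upwards [ha, hb] with g h1 h2
    rw [map_add, h1, h2]
  smul_mem' c a ha := by
    rw [Set.mem_ofPred_eq, isSmoothVector_iff] at *
    filter_upwards [ha] with g h1
    rw [map_smul, h1]

theorem Representation.smoothVectors_le_comap (ρ : Representation ℂ G V) (g : G) :
    ρ.smoothVectors ≤ ρ.smoothVectors.comap (ρ g) := by
  intro v hv
  change ρ.IsSmoothVector v at hv
  change ρ.IsSmoothVector (ρ g v)
  rw [isSmoothVector_iff] at *
  have hc : Filter.Tendsto (fun y : G => g⁻¹ * y * g) (𝓝 1) (𝓝 1) := by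
    have : Continuous fun y : G => g⁻¹ * y * g := by fun_prop
    simpa using this.tendsto 1
  filter_upwards [hc.eventually hv] with y hy
  conv_rhs => rw [← hy]
  rw [← Module.End.mul_apply, ← Module.End.mul_apply, ← map_mul, ← map_mul]
  congr 2
  group

end SmoothVectors

section Category

variable (G : Type) [Group G] [TopologicalSpace G]

/-- The property of representations that all vectors are smooth. -/
def isSmoothRep : ObjectProperty (Rep.{0} ℂ G) := fun V => ∀ v : V, V.ρ.IsSmoothVector v

/-- The category of smooth complex representations, with all intertwining linear maps. -/
abbrev SmoothRep := (isSmoothRep G).FullSubcategory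

variable [IsTopologicalGroup G]

instance : (isSmoothRep G).IsClosedUnderSubobjects where
  prop_of_mono {X Y} f _ hY v := by
    obtain ⟨U, hU⟩ := hY (f.hom v)
    refine ⟨U, fun g hg => (Rep.mono_iff_injective f).1 inferInstance ?_⟩
    rw [Rep.hom_comm_apply, hU g hg]

instance : (isSmoothRep G).IsClosedUnderQuotients where
  prop_of_epi {X Y} f _ hX w := by
    obtain ⟨v, rfl⟩ := (Rep.epi_iff_surjective f).1 inferInstance w
    obtain ⟨U, hU⟩ := hX v
    exact ⟨U, fun g hg => by rw [← Rep.hom_comm_apply, hU g hg]⟩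

instance : (isSmoothRep G).ContainsZero where
  exists_zero := ⟨Rep.trivial ℂ G PUnit, (Rep.isZero_iff _ _ _).2
    (inferInstanceAs (Subsingleton PUnit)),   fun _ => ⟨⊤, fun _ _ => rfl⟩⟩

instance : (isSmoothRep G).IsClosedUnderFiniteProducts where
  isClosedUnderLimitsOfShape J _ := by
    refine .mk' ?_
    rintro _ ⟨F, hF⟩
    intro v
    rw [Representation.isSmoothVector_iff]
    have h : ∀ j : J, ∀ᶠ g in 𝓝 (1 : G), (F.obj ⟨j⟩).ρ g ((limit.π F ⟨j⟩).hom v) =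
        (limit.π F ⟨j⟩).hom v := fun j =>
      (Representation.isSmoothVector_iff _ _).1 (hF ⟨j⟩ _)
    filter_upwards [Filter.eventually_all.2 h] with g hg
    have : PreservesLimit F (forget (Rep.{0} ℂ G)) := inferInstanceAs
      (PreservesLimit F (forget₂ (Rep.{0} ℂ G) (ModuleCat.{0} ℂ) ⋙ forget (ModuleCat.{0} ℂ)))
    refine Concrete.isLimit_ext F (limit.isLimit F) _ _ ?_
    rintro ⟨j⟩
    exact (Rep.hom_comm_apply (limit.π F ⟨j⟩) g v).trans (hg j)

instance : (isSmoothRep G).IsMonoidal where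
  prop_unit _ := ⟨⊤, fun _ _ => rfl⟩
  prop_tensor X Y hX hY v := by
    change (X.ρ.tprod Y.ρ).IsSmoothVector v
    change v ∈ (X.ρ.tprod Y.ρ).smoothVectors
    induction v using TensorProduct.induction_on with
    | zero => exact zero_mem _
    | add a b ha hb => exact add_mem ha hb
    | tmul x y =>
      change Representation.IsSmoothVector _ _
      rw [Representation.isSmoothVector_iff]
      filter_upwards [(Representation.isSmoothVector_iff _ _).1 (hX x),
        (Representation.isSmoothVector_iff _ _).1 (hY y)] with g h1 h2
      rw [Representation.tprod_apply, TensorProduct.map_tmul, h1, h2]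


theorem SmoothRep.surjective_of_epi {G : Type} [Group G] [TopologicalSpace G]
    [IsTopologicalGroup G] {X Y : SmoothRep G} (f : X ⟶ Y) [Epi f] :
    Function.Surjective f.hom.hom := by
  have := (isSmoothRep G).preservesEpimorphisms_ι_of_isNormalMonoCategory
  exact (Rep.epi_iff_surjective f.hom).1 (inferInstanceAs (Epi ((isSmoothRep G).ι.map f)))

/-- Taking invariants under a compact subgroup is exact on smooth representations. -/
theorem SmoothRep.exists_lift_fixed {G : Type} [Group G] [TopologicalSpace G]
    [IsTopologicalGroup G] {X Y : SmoothRep G} (f : X ⟶ Y) [Epi f] (K : Subgroup G)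
    (hK : IsCompact (K : Set G)) (y : Y.obj) (hy : ∀ g ∈ K, Y.obj.ρ g y = y) :
    ∃ x : X.obj, f.hom.hom x = y ∧ ∀ g ∈ K, X.obj.ρ g x = x := by
  classical
  obtain ⟨x₀, hx₀⟩ := SmoothRep.surjective_of_epi f y
  have : CompactSpace K := isCompact_iff_compactSpace.1 hK
  have hlc : IsLocallyConstant fun g : K => X.obj.ρ (g : G) x₀ :=
    (X.property x₀).isLocallyConstant.comp_continuous continuous_subtype_val
  let O : Finset X.obj := hlc.range_finite.toFinset
  have hO : ∀ z, z ∈ O ↔ ∃ g : K, X.obj.ρ (g : G) x₀ = z := fun z => by simp [O]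
  have hne : O.Nonempty := ⟨x₀, (hO _).2 ⟨1, by simp⟩⟩
  have hcard : (O.card : ℂ) ≠ 0 := by exact_mod_cast hne.card_pos.ne'
  refine ⟨(O.card : ℂ)⁻¹ • ∑ z ∈ O, z, ?_, fun g hg => ?_⟩
  · rw [map_smul, map_sum, Finset.sum_congr rfl (g := fun _ => y), Finset.sum_const,
      ← Nat.cast_smul_eq_nsmul ℂ, smul_smul, inv_mul_cancel₀ hcard, one_smul]
    intro z hz
    obtain ⟨g, rfl⟩ := (hO z).1 hz
    rw [Rep.hom_comm_apply, hx₀, hy _ g.2]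
  · rw [map_smul, map_sum]
    congr 1
    refine Finset.sum_bij (fun z _ => X.obj.ρ g z) ?_ ?_ ?_ (fun _ _ => rfl)
    · intro z hz
      obtain ⟨h, rfl⟩ := (hO z).1 hz
      exact (hO _).2 ⟨⟨g, hg⟩ * h, by simp⟩
    · intro a _ b _ hab
      exact (X.obj.ρ.apply_bijective g).1 hab
    · intro z hz
      obtain ⟨h, rfl⟩ := (hO z).1 hz
      exact ⟨_, (hO _).2 ⟨⟨g, hg⟩⁻¹ * h, rfl⟩, by simp⟩

instance SmoothRep.enoughProjectives (G : Type) [Group G] [TopologicalSpace G] [IsLGroup G] :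
    EnoughProjectives (SmoothRep G) where
  presentation X := by
    classical
    have hex : ∀ v : X.obj, ∃ K : OpenSubgroup G, IsCompact (K : Set G) ∧
        ∀ g ∈ K, X.obj.ρ g v = v := fun v => by
      obtain ⟨U, hU⟩ := X.property v
      obtain ⟨K, hK, hKU⟩ := IsLGroup.exists_compact_openSubgroup U.mem_nhds_one
      exact ⟨K, hK, fun g hg => hU g (hKU hg)⟩
    choose K hKc hKf using hex
    let S : Type := Σ v : X.obj, G ⧸ (K v).toSubgroup
    have key : ∀ (Y : SmoothRep G) (t : ∀ v : X.obj, Y.obj)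
        (_ : ∀ v, ∀ g ∈ K v, Y.obj.ρ g (t v) = t v), ∃ f : Rep.ofMulAction ℂ G S ⟶ Y.obj,
        ∀ (v : X.obj) (g : G),
          f.hom (MonoidAlgebra.single (⟨v, (g : G ⧸ (K v).toSubgroup)⟩ : S) 1) =
            Y.obj.ρ g (t v) := by
      intro Y t ht
      let F : S → Y.obj := fun s => Quotient.liftOn' s.2 (fun g => Y.obj.ρ g (t s.1)) (by
        intro a b hab
        have := ht s.1 _ (QuotientGroup.leftRel_apply.1 hab)
        conv_lhs => rw [← this]
        rw [← Module.End.mul_apply, ← map_mul, mul_inv_cancel_left])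
      refine ⟨Rep.ofHom ⟨Finsupp.lift Y.obj ℂ S F ∘ₗ
        (MonoidAlgebra.coeffLinearEquiv _).toLinearMap, fun g => ?_⟩, fun v g => ?_⟩
      · ext ⟨v, q⟩
        induction q using Quotient.inductionOn' with
        | h a =>
          simp [F]
          change Y.obj.ρ (g * a) (t v) = _
          rw [map_mul, Module.End.mul_apply]
      · simp [F]
    have hS : isSmoothRep G (Rep.ofMulAction ℂ G S) := by
      intro v
      change v ∈ (Representation.ofMulAction ℂ G S).smoothVectors
      induction v using MonoidAlgebra.induction_linear with
      | zero => exact zero_mem _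
      | add a b ha hb => exact add_mem ha hb
      | single s r =>
        obtain ⟨v, q⟩ := s
        induction q using Quotient.inductionOn' with
        | h a =>
          change Representation.IsSmoothVector _ _
          rw [Representation.isSmoothVector_iff]
          have hc : Filter.Tendsto (fun y : G => a⁻¹ * y⁻¹ * a) (𝓝 1) (𝓝 1) := by
            have : Continuous fun y : G => a⁻¹ * y⁻¹ * a := by fun_prop
            simpa using this.tendsto 1
          filter_upwards [hc.eventually (K v).mem_nhds_one] with g hg
          rw [Representation.ofMulAction_single]
          congr 1
          refine Sigma.ext rfl (heq_of_eq ?_)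
          refine QuotientGroup.eq.2 ?_
          simpa [mul_assoc] using (show a⁻¹ * g⁻¹ * a ∈ K v from hg)
    obtain ⟨π, hπ⟩ := key X id hKf
    let P : SmoothRep G := ⟨Rep.ofMulAction ℂ G S, hS⟩
    have hP : Projective P := by
      constructor
      intro E Y f e he
      have hfix : ∀ v : X.obj, ∀ g ∈ K v,
          Y.obj.ρ g (f.hom.hom (MonoidAlgebra.single (⟨v, ((1 : G) : G ⧸ (K v).toSubgroup)⟩ : S) 1))
            = f.hom.hom (MonoidAlgebra.single (⟨v, ((1 : G) : G ⧸ (K v).toSubgroup)⟩ : S) 1) := by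
        intro v g hg
        rw [← Rep.hom_comm_apply]
        congr 1
        refine (Representation.ofMulAction_single _ _ _).trans ?_
        congr 1
        refine Sigma.ext rfl (heq_of_eq ?_)
        refine QuotientGroup.eq.2 ?_
        simpa using hg
      choose t ht htf using fun v => SmoothRep.exists_lift_fixed e (K v).toSubgroup (hKc v) _
        (hfix v)
      obtain ⟨φ, hφ⟩ := key E t htf
      refine ⟨ObjectProperty.homMk φ, ?_⟩
      refine ObjectProperty.hom_ext _ (Rep.hom_ext ?_)
      ext ⟨v, q⟩
      induction q using Quotient.inductionOn' with
      | h a =>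
        have h1 : (MonoidAlgebra.single (⟨v, (a : G ⧸ (K v).toSubgroup)⟩ : S) (1 : ℂ)) =
            P.obj.ρ a (MonoidAlgebra.single (⟨v, ((1 : G) : G ⧸ (K v).toSubgroup)⟩ : S) 1) := by
          refine Eq.trans ?_ (Representation.ofMulAction_single _ _ _).symm
          congr 1
          exact Sigma.ext rfl (heq_of_eq (congrArg _ (mul_one a).symm))
        change e.hom.hom (φ.hom (MonoidAlgebra.single (⟨v, (a : G ⧸ (K v).toSubgroup)⟩ : S) 1)) =
          f.hom.hom (MonoidAlgebra.single (⟨v, (a : G ⧸ (K v).toSubgroup)⟩ : S) 1)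
        rw [hφ, Rep.hom_comm_apply, ht, ← Rep.hom_comm_apply, h1]
    let p : P ⟶ X := ObjectProperty.homMk π
    have hp : Epi p := by
      have : Epi ((isSmoothRep G).ι.map p) :=
        (Rep.epi_iff_surjective π).2 fun v => ⟨_, (hπ v 1).trans (by simp)⟩
      exact (isSmoothRep G).ι.epi_of_epi_map this
    exact ⟨{ p := P, f := p, projective := hP, epi := hp }⟩

end Category

section Functors

variable {G : Type} [Group G] [TopologicalSpace G]

/-- Locally constant characters, as a subgroup of all homomorphisms to `ℂˣ`. -/
def smoothChar (G : Type) [Group G] [TopologicalSpace G] : Subgroup (G →* ℂˣ) where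
  carrier := {χ | IsLocallyConstant χ}
  one_mem' := IsLocallyConstant.const 1
  mul_mem' ha hb := ha.mul hb
  inv_mem' ha := ha.inv

/-- The restriction of a locally constant character to a subgroup. -/
def smoothChar.res (H : Subgroup G) (χ : smoothChar G) : smoothChar H :=
  ⟨χ.1.comp H.subtype, χ.2.comp_continuous continuous_subtype_val⟩

/-- The one-dimensional representation on `ℂ` attached to a character. -/
def charRepresentation (χ : G →* ℂˣ) : Representation ℂ G ℂ where
  toFun g := (χ g : ℂ) • LinearMap.id
  map_one' := by ext; simp
  map_mul' a b := by ext; simp [mul_comm]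

variable [IsTopologicalGroup G]

/-- A locally constant character as a smooth representation on `ℂ`. -/
def SmoothRep.ofChar (χ : smoothChar G) : SmoothRep G :=
  ⟨Rep.of (charRepresentation χ.1), fun v => by
    rw [Representation.isSmoothVector_iff]
    filter_upwards [χ.2.eventually_eq 1] with g hg
    change (χ.1 g : ℂ) • v = v
    rw [hg, map_one, Units.val_one, one_smul]⟩

/-- Restriction of smooth representations to a subgroup. -/
def SmoothRep.res (H : Subgroup G) : SmoothRep G ⥤ SmoothRep H where
  obj V := ⟨Rep.res H.subtype V.obj, fun v => by
    rw [Representation.isSmoothVector_iff]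
    have hc : Filter.Tendsto (fun h : H => (h : G)) (𝓝 1) (𝓝 1) :=
      continuous_subtype_val.tendsto 1
    exact hc.eventually ((Representation.isSmoothVector_iff _ _).1 (V.property v))⟩
  map f := ObjectProperty.homMk ((Rep.resFunctor H.subtype).map f.hom)

/-- The smooth contragredient of a smooth representation: the smooth vectors in the full dual. -/
def SmoothRep.dual (V : SmoothRep G) : SmoothRep G :=
  ⟨Rep.of (V.obj.ρ.dual.subrepresentation V.obj.ρ.dual.smoothVectors
    V.obj.ρ.dual.smoothVectors_le_comap), fun v => by
      obtain ⟨U, hU⟩ := v.2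
      exact ⟨U, fun g hg => Subtype.ext (hU g hg)⟩⟩

/-- The transpose of a morphism of smooth representations. -/
def SmoothRep.dualMap {V W : SmoothRep G} (f : V ⟶ W) : W.dual ⟶ V.dual :=
  ObjectProperty.homMk (Rep.ofHom
    ⟨(Module.Dual.transpose f.hom.hom.toLinearMap).restrict (fun l hl => by
      obtain ⟨U, hU⟩ := hl
      refine ⟨U, fun g hg => LinearMap.ext fun v => ?_⟩
      have h := LinearMap.congr_fun (hU g hg) (f.hom.hom v)
      change l (f.hom.hom (V.obj.ρ g⁻¹ v)) = l (f.hom.hom v)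
      rw [Rep.hom_comm_apply]
      exact h), fun g => by
        ext l v
        change l.1 (W.obj.ρ g⁻¹ (f.hom.hom v)) = l.1 (f.hom.hom (V.obj.ρ g⁻¹ v))
        rw [Rep.hom_comm_apply]⟩)

/-- The smooth contragredient as a contravariant functor. -/
def SmoothRep.contragredient (G : Type) [Group G] [TopologicalSpace G] [IsTopologicalGroup G] :
    (SmoothRep G)ᵒᵖ ⥤ SmoothRep G where
  obj V := V.unop.dual
  map f := SmoothRep.dualMap f.unop

end Functors

section Schwartz

variable (G : Type) [Group G] [TopologicalSpace G]

/-- The space of Bruhat-Schwartz functions: locally constant functions of compact support. -/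
def schwartz (X : Type) [TopologicalSpace X] : Submodule ℂ (X → ℂ) where
  carrier := {f | IsLocallyConstant f ∧ HasCompactSupport f}
  zero_mem' := ⟨IsLocallyConstant.const 0, HasCompactSupport.zero⟩
  add_mem' ha hb := ⟨ha.1.add hb.1, ha.2.add hb.2⟩
  smul_mem' c _ hf := ⟨hf.1.comp (c • ·), hf.2.smul_left (f := fun _ => c)⟩

/-- Left translation of functions on a `G`-space: `(g f)(x) = f (g⁻¹ x)`. -/
def translation (X : Type) [MulAction G X] : Representation ℂ G (X → ℂ) where
  toFun g := LinearMap.funLeft ℂ ℂ (g⁻¹ • ·)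
  map_one' := by ext; simp
  map_mul' a b := by ext; simp [mul_smul]

theorem schwartz_le_comap (X : Type) [TopologicalSpace X] [MulAction G X] [ContinuousSMul G X]
    (g : G) : schwartz X ≤ (schwartz X).comap (translation G X g) := fun _ hf =>
  ⟨hf.1.comp_continuous (continuous_const_smul g⁻¹),
    hf.2.comp_homeomorph (Homeomorph.smul g⁻¹)⟩

theorem schwartz_smooth [IsTopologicalGroup G] (X : Type) [TopologicalSpace X] [MulAction G X]
    [ContinuousSMul G X] (f : X → ℂ) (hf : f ∈ schwartz X) :
    (translation G X).IsSmoothVector f := by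
  rw [Representation.isSmoothVector_iff]
  have hlc : IsLocallyConstant fun p : G × X => f (p.1 • p.2) :=
    hf.1.comp_continuous continuous_smul
  have key : ∀ᶠ g in 𝓝 (1 : G), ∀ x ∈ tsupport f, f (g • x) = f x := by
    have hK : IsCompact (tsupport f) := hf.2
    refine hK.eventually_forall_of_forall_eventually fun x _ => ?_
    have h1 := hlc.eventually_eq (1, x)
    have h2 : ∀ᶠ p : G × X in 𝓝 (1, x), f p.2 = f x :=
      (continuous_snd.tendsto ((1 : G), x)).eventually (hf.1.eventually_eq x)
    filter_upwards [h1, h2] with p hp1 hp2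
    rw [hp1, hp2, one_smul]
  have hinv : Filter.Tendsto (fun g : G => g⁻¹) (𝓝 1) (𝓝 1) := by
    simpa using (continuous_inv (G := G)).tendsto 1
  filter_upwards [key, hinv.eventually key] with g h1 h2
  funext x
  change f (g⁻¹ • x) = f x
  by_cases hx : x ∈ tsupport f
  · exact h2 x hx
  · by_cases hx' : g⁻¹ • x ∈ tsupport f
    · rw [← h1 _ hx', smul_inv_smul]
    · rw [image_eq_zero_of_notMem_tsupport hx, image_eq_zero_of_notMem_tsupport hx']

/-- The smooth representation of `G` on the Bruhat-Schwartz functions on a `G`-space. -/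
def SmoothRep.schwartz [IsTopologicalGroup G] (X : Type) [TopologicalSpace X] [MulAction G X]
    [ContinuousSMul G X] : SmoothRep G :=
  ⟨Rep.of ((translation G X).subrepresentation (_root_.schwartz X) (schwartz_le_comap G X)),
    fun f => by
      obtain ⟨U, hU⟩ := schwartz_smooth G X f.1 f.2
      exact ⟨U, fun g hg => Subtype.ext (hU g hg)⟩⟩

end Schwartz

section Induction

variable {G : Type} [Group G] [TopologicalSpace G] (H : Subgroup G)

/-- Un-normalized Schwartz induction: locally constant functions `φ : G → W` with
`φ (h g) = h • φ g` whose support is compact modulo left translations by `H`. -/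
def indSpace {W : Type} [AddCommGroup W] [Module ℂ W] (σ : Representation ℂ H W) :
    Submodule ℂ (G → W) where
  carrier := {φ | IsLocallyConstant φ ∧ (∀ (h : H) (g : G), φ (h * g) = σ h (φ g)) ∧
    ∃ C : Set G, IsCompact C ∧ Function.support φ ⊆ (H : Set G) * C}
  zero_mem' := ⟨IsLocallyConstant.const 0, by simp, ∅, isCompact_empty, by simp⟩
  add_mem' := by
    rintro a b ⟨ha, ha', C, hC, haC⟩ ⟨hb, hb', D, hD, hbD⟩
    refine ⟨ha.add hb, fun h g => by simp [ha', hb'], C ∪ D, hC.union hD, ?_⟩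
    rw [Set.mul_union]
    exact (Function.support_add a b).trans (Set.union_subset_union haC hbD)
  smul_mem' := by
    rintro c a ⟨ha, ha', C, hC, haC⟩
    exact ⟨ha.comp (c • ·), fun h g => by simp [ha'], C, hC,
      (Function.support_const_smul_subset c a).trans haC⟩

/-- The action of `G` by right translations on `W`-valued functions on `G`. -/
def rightTranslation (G : Type) [Group G] (W : Type) [AddCommGroup W] [Module ℂ W] :
    Representation ℂ G (G → W) where
  toFun g := LinearMap.funLeft ℂ W (· * g)
  map_one' := by ext; simp
  map_mul' a b := by ext; simp [mul_assoc]

variable [IsTopologicalGroup G]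

theorem indSpace_le_comap {W : Type} [AddCommGroup W] [Module ℂ W] (σ : Representation ℂ H W)
    (g : G) : indSpace H σ ≤ (indSpace H σ).comap (rightTranslation G W g) := by
  rintro φ ⟨h1, h2, C, hC, hφC⟩
  refine ⟨h1.comp_continuous (continuous_mul_const g), fun h x => ?_, C * {g⁻¹},
    hC.mul isCompact_singleton, fun x hx => ?_⟩
  · change φ (h * x * g) = σ h (φ (x * g))
    rw [mul_assoc, h2]
  · have : x * g ∈ (H : Set G) * C := hφC hx
    rw [← mul_assoc]
    exact ⟨x * g, this, g⁻¹, rfl, by simp⟩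

theorem indSpace_smooth {W : Type} [AddCommGroup W] [Module ℂ W] (σ : Representation ℂ H W)
    (φ : G → W) (hφ : φ ∈ indSpace H σ) : (rightTranslation G W).IsSmoothVector φ := by
  obtain ⟨h1, h2, C, hC, hφC⟩ := hφ
  rw [Representation.isSmoothVector_iff]
  have hlc : IsLocallyConstant fun p : G × G => φ (p.2 * p.1) :=
    h1.comp_continuous (by fun_prop)
  have key : ∀ᶠ g in 𝓝 (1 : G), ∀ x ∈ C, φ (x * g) = φ x := by
    refine hC.eventually_forall_of_forall_eventually fun x _ => ?_
    have h3 := hlc.eventually_eq (1, x)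
    have h4 : ∀ᶠ p : G × G in 𝓝 (1, x), φ p.2 = φ x :=
      (continuous_snd.tendsto ((1 : G), x)).eventually (h1.eventually_eq x)
    filter_upwards [h3, h4] with p hp1 hp2
    rw [hp1, hp2, mul_one]
  have hinv : Filter.Tendsto (fun g : G => g⁻¹) (𝓝 1) (𝓝 1) := by
    simpa using (continuous_inv (G := G)).tendsto 1
  have key' : ∀ g : G, (∀ x ∈ C, φ (x * g) = φ x) → ∀ x ∈ (H : Set G) * C, φ (x * g) = φ x := by
    rintro g hg _ ⟨h, hh, c, hc, rfl⟩
    have e1 := h2 ⟨h, hh⟩ (c * g)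
    have e2 := h2 ⟨h, hh⟩ c
    change φ (h * c * g) = φ (h * c)
    rw [mul_assoc]
    exact e1.trans ((congrArg _ (hg c hc)).trans e2.symm)
  filter_upwards [key, hinv.eventually key] with g hg hg'
  funext x
  change φ (x * g) = φ x
  by_cases hx : x ∈ (H : Set G) * C
  · exact key' g hg x hx
  · by_cases hx' : x * g ∈ (H : Set G) * C
    · rw [← key' _ hg' _ hx', mul_inv_cancel_right]
    · rw [Function.notMem_support.1 fun h => hx (hφC h),
        Function.notMem_support.1 fun h => hx' (hφC h)]

/-- Schwartz induction of a smooth representation. -/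
def SmoothRep.indObj (W : SmoothRep H) : SmoothRep G :=
  ⟨Rep.of ((rightTranslation G W.obj).subrepresentation (indSpace H W.obj.ρ)
    (indSpace_le_comap H W.obj.ρ)), fun φ => by
      obtain ⟨U, hU⟩ := indSpace_smooth H W.obj.ρ φ.1 φ.2
      exact ⟨U, fun g hg => Subtype.ext (hU g hg)⟩⟩

/-- Schwartz induction on morphisms: composition with the morphism. -/
def SmoothRep.indMap {W W' : SmoothRep H} (f : W ⟶ W') :
    SmoothRep.indObj H W ⟶ SmoothRep.indObj H W' :=
  ObjectProperty.homMk (Rep.ofHom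
    ⟨(f.hom.hom.toLinearMap.compLeft G).restrict (by
      rintro φ ⟨h1, h2, C, hC, hφC⟩
      refine ⟨h1.comp _, fun h g => ?_, C, hC, fun x hx => hφC fun h0 => hx ?_⟩
      · change f.hom.hom (φ (h * g)) = W'.obj.ρ h (f.hom.hom (φ g))
        rw [h2, Rep.hom_comm_apply]
      · change f.hom.hom (φ x) = 0
        rw [h0, map_zero]), fun _ => rfl⟩)

/-- Schwartz induction as a functor. -/
def SmoothRep.ind : SmoothRep H ⥤ SmoothRep G where
  obj W := SmoothRep.indObj H W
  map f := SmoothRep.indMap H f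

instance : (SmoothRep.ind H).Additive where
  map_add {X Y f g} := by
    refine ObjectProperty.hom_ext _ (Rep.hom_ext ?_)
    ext φ
    exact Subtype.ext (funext fun x => rfl)

end Induction

section GeneralizedHom

/-- The `k`-th space of generalized invariant vectors: those killed by all products
`(g₀ - 1) (g₁ - 1) ⋯ (gₖ - 1)`. -/
def Representation.genInvariants {G : Type} [Group G] {V : Type} [AddCommGroup V] [Module ℂ V]
    (ρ : Representation ℂ G V) (k : ℕ) : Submodule ℂ V where
  carrier := {v | ∀ g : Fin (k + 1) → G, (List.ofFn fun i => ρ (g i) - 1).prod v = 0}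
  zero_mem' g := map_zero _
  add_mem' {a b} ha hb g := by rw [map_add, ha, hb, add_zero]
  smul_mem' c a ha g := by rw [map_smul, ha, smul_zero]

theorem Representation.genInvariants_le_comap {G : Type} [Group G] {V W : Type} [AddCommGroup V]
    [Module ℂ V] [AddCommGroup W] [Module ℂ W] {ρ : Representation ℂ G V}
    {σ : Representation ℂ G W} (T : V →ₗ[ℂ] W) (hT : ∀ g v, T (ρ g v) = σ g (T v)) (k : ℕ) :
    ρ.genInvariants k ≤ (σ.genInvariants k).comap T := by
  intro v hv g
  have key : ∀ (l : List G) (v : V),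
      (l.map fun g => σ g - 1).prod (T v) = T ((l.map fun g => ρ g - 1).prod v) := by
    intro l
    induction l with
    | nil => intro v; simp
    | cons a l ih =>
      intro v
      simp [ih, hT]
  have h := key (List.ofFn g) v
  simp only [List.map_ofFn] at h
  have hv' := hv g
  exact h.trans ((congrArg T hv').trans (map_zero T))

variable (G : Type) [Group G] [TopologicalSpace G] [IsTopologicalGroup G]

/-- The bifunctor `(Y, X) ↦ Hom_{G,k}(X, Y)`, the `k`-th generalized invariants in the
representation `Hom_ℂ(X, Y)`. -/
def SmoothRep.genHom (k : ℕ) : SmoothRep G ⥤ (SmoothRep G)ᵒᵖ ⥤ ModuleCat.{0} ℂ where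
  obj Y :=
    { obj X := ModuleCat.of ℂ ((X.unop.obj.ρ.linHom Y.obj.ρ).genInvariants k)
      map {X X'} f := ModuleCat.ofHom ((LinearMap.lcomp ℂ Y.obj f.unop.hom.hom.toLinearMap).restrict
        (Representation.genInvariants_le_comap _ (fun g T => by
          ext v
          change Y.obj.ρ g (T (X.unop.obj.ρ g⁻¹ (f.unop.hom.hom v))) =
            Y.obj.ρ g (T (f.unop.hom.hom (X'.unop.obj.ρ g⁻¹ v)))
          rw [Rep.hom_comm_apply]) k)) }
  map {Y Y'} f :=
    { app X := ModuleCat.ofHom ((LinearMap.compRight ℂ f.hom.hom.toLinearMap).restrict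
        (Representation.genInvariants_le_comap _ (fun g T => by
          ext v
          change f.hom.hom (Y.obj.ρ g (T (X.unop.obj.ρ g⁻¹ v))) =
            Y'.obj.ρ g (f.hom.hom (T (X.unop.obj.ρ g⁻¹ v)))
          rw [Rep.hom_comm_apply]) k)) }

instance (k : ℕ) (Y : SmoothRep G) : ((SmoothRep.genHom G k).obj Y).Additive where
  map_add {X X' f g} := by
    ext T
    refine Subtype.ext (LinearMap.ext fun v => ?_)
    exact map_add T.1 _ _

end GeneralizedHom

section GeneralizedExt

variable (G : Type) [Group G] [TopologicalSpace G] [IsLGroup G]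

/-- Generalized extensions: `Ext_{G,k}^i` is obtained by deriving `Hom_{G,k}` in its first
argument, i.e. it is the `i`-th cohomology of `Hom_{G,k}(P_•, Y)` for a projective resolution
`P_•` in the category of smooth representations. -/
def SmoothRep.genExt (k i : ℕ) : (SmoothRep G)ᵒᵖ ⥤ SmoothRep G ⥤ ModuleCat.{0} ℂ :=
  Functor.flip
    { obj Y := (((SmoothRep.genHom G k).obj Y).rightOp.leftDerived i).leftOp
      map f := (NatTrans.leftDerived (NatTrans.rightOp ((SmoothRep.genHom G k).map f)) i).leftOp }

/-- The subgroup `G°` generated by all compact subgroups. -/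
def compactGen (G : Type) [Group G] [TopologicalSpace G] : Subgroup G :=
  sSup {K : Subgroup G | IsCompact (K : Set G)}

instance : (compactGen G).Normal where
  conj_mem n hn g := by
    have : compactGen G ≤ (compactGen G).comap (MulAut.conj g).toMonoidHom := by
      refine sSup_le fun K hK x hx => ?_
      have hK' : IsCompact ((K.map (MulAut.conj g).toMonoidHom : Subgroup G) : Set G) := by
        have : Continuous fun x : G => g * x * g⁻¹ := by fun_prop
        exact hK.image this
      exact (le_sSup (s := {K : Subgroup G | IsCompact (K : Set G)}) hK') ⟨x, hx, rfl⟩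
    exact this hn

theorem compactGen_mem_nhds : (compactGen G : Set G) ∈ 𝓝 (1 : G) := by
  obtain ⟨K, hK, -⟩ := IsLGroup.exists_compact_openSubgroup (G := G) Filter.univ_mem
  exact Filter.mem_of_superset K.mem_nhds_one
    (le_sSup (s := {K : Subgroup G | IsCompact (K : Set G)}) hK)

/-- The group `Λ_G = G / G°`. -/
abbrev Lam := G ⧸ compactGen G

/-- The augmentation ideal of `ℂ[Λ_G]`: the elements whose coefficients sum to zero. -/
def augIdeal : Ideal (MonoidAlgebra ℂ (Lam G)) :=
  RingHom.ker (MonoidAlgebra.lift ℂ ℂ (Lam G) 1)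

/-- The space `J_{G,k} = ℂ[Λ_G] / I_G ^ (k + 1)`. -/
abbrev JSpace (k : ℕ) : Type := MonoidAlgebra ℂ (Lam G) ⧸ augIdeal G ^ (k + 1)

/-- The image of `g` in `J_{G,k}`. -/
def JSpace.of (k : ℕ) (g : G) : JSpace G k :=
  Submodule.Quotient.mk (MonoidAlgebra.of ℂ (Lam G) (g : Lam G))

/-- `J_{G,k}` as a smooth representation of `G` through left translations. -/
def SmoothRep.J (k : ℕ) : SmoothRep G :=
  ⟨Rep.of ((Representation.ofModule' (k := ℂ) (G := Lam G) (JSpace G k)).comp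
    (QuotientGroup.mk' (compactGen G))), fun v => by
      rw [Representation.isSmoothVector_iff]
      filter_upwards [compactGen_mem_nhds G] with g hg
      change Representation.ofModule' (k := ℂ) (G := Lam G) (JSpace G k) (g : Lam G) v = v
      rw [(QuotientGroup.eq_one_iff g).2 hg, map_one, Module.End.one_apply]⟩

theorem SmoothRep.J_apply (k : ℕ) (g x : G) :
    (SmoothRep.J G k).obj.ρ g (JSpace.of G k x) = JSpace.of G k (g * x) := by
  change Representation.ofModule' (k := ℂ) (G := Lam G) (JSpace G k) (g : Lam G)
    (Submodule.Quotient.mk _) = _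
  simp only [Representation.ofModule', JSpace.of]
  rw [QuotientGroup.mk_mul, map_mul]
  rfl

end GeneralizedExt

section Shapiro

variable {G : Type} [Group G] [TopologicalSpace G] [IsLGroup G] (H : Subgroup G)

/-- The functor `V₀ ↦ δ ⊗ (J_{G,k}|_H ⊗ V₀)` on smooth representations of `H`. -/
abbrev SmoothRep.twist (δ : smoothChar H) (k : ℕ) : SmoothRep H ⥤ SmoothRep H :=
  tensorLeft ((SmoothRep.res H).obj (SmoothRep.J G k)) ⋙ tensorLeft (SmoothRep.ofChar δ)

instance (δ : smoothChar H) (k : ℕ) : (SmoothRep.twist H δ k).Additive := inferInstance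

/-- The space `Hom_G(ind_H^G δ⁻¹, ℂ)`. -/
abbrev IndFunctional (δ : smoothChar H) : Type :=
  (SmoothRep.ind H).obj (SmoothRep.ofChar δ⁻¹) ⟶ 𝟙_ (SmoothRep G)

/-- `G / H` is `χ`-admissible if `Hom_G(S(G/H), χ) ≠ 0`. -/
def IsAdmissible (χ : smoothChar G) : Prop :=
  Nontrivial (SmoothRep.schwartz G (G ⧸ H) ⟶ SmoothRep.ofChar χ)

variable {H}

/-- The vector `1 ⊗ (x ⊗ w)` of `δ ⊗ (J_{G,k} ⊗ V₀)`. -/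
def twistVec (δ : smoothChar H) {k : ℕ} {V₀ : SmoothRep H} (x : JSpace G k) (w : V₀.obj) :
    ((SmoothRep.twist H δ k).obj V₀).obj :=
  show TensorProduct ℂ ℂ (TensorProduct ℂ (JSpace G k) V₀.obj) from (1 : ℂ) ⊗ₜ[ℂ] (x ⊗ₜ[ℂ] w)

theorem twistVec_zero (δ : smoothChar H) {k : ℕ} {V₀ : SmoothRep H} (x : JSpace G k) :
    twistVec δ (V₀ := V₀) x 0 = 0 := by
  change (1 : ℂ) ⊗ₜ[ℂ] (x ⊗ₜ[ℂ] (0 : V₀.obj)) = 0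
  rw [TensorProduct.tmul_zero, TensorProduct.tmul_zero]

theorem twistVec_mul (δ : smoothChar H) {k : ℕ} {V₀ : SmoothRep H} (h : H) (g : G) (w : V₀.obj) :
    twistVec δ (JSpace.of G k (h * g)) (V₀.obj.ρ h w) =
      ((δ.1 h : ℂ))⁻¹ • ((SmoothRep.twist H δ k).obj V₀).obj.ρ h
        (twistVec δ (JSpace.of G k g) w) := by
  have e : ((SmoothRep.twist H δ k).obj V₀).obj.ρ h (twistVec δ (JSpace.of G k g) w) =
      (δ.1 h : ℂ) • twistVec δ (JSpace.of G k (h * g)) (V₀.obj.ρ h w) := by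
    change ((δ.1 h : ℂ) • (1 : ℂ)) ⊗ₜ[ℂ] ((SmoothRep.J G k).obj.ρ (h : G) (JSpace.of G k g) ⊗ₜ[ℂ]
      V₀.obj.ρ h w) = (δ.1 h : ℂ) • ((1 : ℂ) ⊗ₜ[ℂ] (JSpace.of G k (h * g) ⊗ₜ[ℂ] V₀.obj.ρ h w))
    rw [SmoothRep.J_apply, TensorProduct.smul_tmul']
    rfl
  rw [e, smul_smul, inv_mul_cancel₀ (Units.ne_zero _), one_smul]

/-- For an `H`-map `ψ : δ ⊗ J_{G,k} ⊗ V₀ → (V|_H)^∨`, `φ ∈ ind_H^G V₀` and `v ∈ V`, the function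
`g ↦ ⟨ψ (1 ⊗ ḡ ⊗ φ(g)), g v⟩`, which is an element of `ind_H^G δ⁻¹`. -/
def frobFun {δ : smoothChar H} {k : ℕ} {V₀ : SmoothRep H} {V : SmoothRep G}
    (ψ : (SmoothRep.twist H δ k).obj V₀ ⟶ ((SmoothRep.res H).obj V).dual)
    (φ : indSpace H V₀.obj.ρ) (v : V.obj) : indSpace H (charRepresentation (δ⁻¹).1) :=
  ⟨fun g => (ψ.hom.hom (twistVec δ (JSpace.of G k g) (φ.1 g))).1 (V.obj.ρ g v), by
    obtain ⟨h1, h2, C, hC, hφC⟩ := φ.2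
    have hJ : IsLocallyConstant (JSpace.of G k) := by
      have h := ((SmoothRep.J G k).property (JSpace.of G k 1)).isLocallyConstant
      have h' : (fun g => (SmoothRep.J G k).obj.ρ g (JSpace.of G k 1)) = JSpace.of G k := by
        funext g
        rw [SmoothRep.J_apply, mul_one]
      rwa [h'] at h
    refine ⟨?_, fun h g => ?_, C, hC, fun x hx => hφC fun h0 => hx ?_⟩
    · exact ((hJ.prodMk h1).prodMk (V.property v).isLocallyConstant).comp
        fun p => (ψ.hom.hom (twistVec δ p.1.1 p.1.2)).1 p.2
    · have e : ψ.hom.hom (twistVec δ (JSpace.of G k (h * g)) (V₀.obj.ρ h (φ.1 g))) =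
          ((δ.1 h : ℂ))⁻¹ • ((SmoothRep.res H).obj V).dual.obj.ρ h
            (ψ.hom.hom (twistVec δ (JSpace.of G k g) (φ.1 g))) := by
        rw [twistVec_mul, map_smul, Rep.hom_comm_apply]
      dsimp only
      rw [h2, e]
      change ((δ.1 h : ℂ))⁻¹ • (ψ.hom.hom (twistVec δ (JSpace.of G k g) (φ.1 g))).1
        (V.obj.ρ ((h⁻¹ : H) : G) (V.obj.ρ (h * g) v)) = ((δ⁻¹ : smoothChar H).1 h : ℂ) •
          (ψ.hom.hom (twistVec δ (JSpace.of G k g) (φ.1 g))).1 (V.obj.ρ g v)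
      rw [← Module.End.mul_apply, ← map_mul]
      simp
    · dsimp only
      rw [h0, twistVec_zero, map_zero]
      rfl⟩

variable (H) [IsClosed (H : Set G)]

/-- The bifunctor `(V, V₀) ↦ Hom_{G,k}(ind_H^G V₀, V^∨)`. -/
abbrev frobLeft (k : ℕ) : (SmoothRep G)ᵒᵖ ⥤ (SmoothRep H)ᵒᵖ ⥤ ModuleCat.{0} ℂ :=
  SmoothRep.contragredient G ⋙ SmoothRep.genHom G k ⋙
    (Functor.whiskeringLeft _ _ _).obj (SmoothRep.ind H).op

/-- The bifunctor `(V, V₀) ↦ Hom_H(δ ⊗ J_{G,k} ⊗ V₀, (V|_H)^∨)`. -/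
abbrev frobRight (δ : smoothChar H) (k : ℕ) :
    (SmoothRep G)ᵒᵖ ⥤ (SmoothRep H)ᵒᵖ ⥤ ModuleCat.{0} ℂ :=
  (SmoothRep.res H).op ⋙ SmoothRep.contragredient H ⋙ linearYoneda ℂ (SmoothRep H) ⋙
    (Functor.whiskeringLeft _ _ _).obj (SmoothRep.twist H δ k).op

/-- The bifunctor `(V, V₀) ↦ Ext_{G,k}^i(ind_H^G V₀, V^∨)`. -/
abbrev shapiroLeft (k i : ℕ) : (SmoothRep G)ᵒᵖ ⥤ (SmoothRep H)ᵒᵖ ⥤ ModuleCat.{0} ℂ :=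
  SmoothRep.contragredient G ⋙ (SmoothRep.genExt G k i).flip ⋙
    (Functor.whiskeringLeft _ _ _).obj (SmoothRep.ind H).op

/-- The bifunctor `(V, V₀) ↦ Ext_H^i(δ ⊗ J_{G,k} ⊗ V₀, (V|_H)^∨)`. -/
abbrev shapiroRight (δ : smoothChar H) (k i : ℕ) :
    (SmoothRep G)ᵒᵖ ⥤ (SmoothRep H)ᵒᵖ ⥤ ModuleCat.{0} ℂ :=
  (SmoothRep.res H).op ⋙ SmoothRep.contragredient H ⋙ (Ext ℂ (SmoothRep H) i).flip ⋙
    (Functor.whiskeringLeft _ _ _).obj (SmoothRep.twist H δ k).op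

variable {H}

/-- The natural isomorphism `Θ` is the Frobenius reciprocity given by the functional `Λ`: its
inverse sends `ψ` to the generalized homomorphism
`φ ↦ (v ↦ Λ (g ↦ ⟨ψ (1 ⊗ ḡ ⊗ φ(g)), g v⟩))`. -/
def IsFrobenius {δ : smoothChar H} (Λ : IndFunctional H δ) {k : ℕ}
    (Θ : frobLeft H k ≅ frobRight H δ k) : Prop :=
  ∀ (V : SmoothRep G) (V₀ : SmoothRep H)
    (ψ : (SmoothRep.twist H δ k).obj V₀ ⟶ ((SmoothRep.res H).obj V).dual)
    (φ : indSpace H V₀.obj.ρ) (v : V.obj),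
    (((((Θ.inv.app (op V)).app (op V₀)).hom ψ).1 φ).1 v : ℂ) = Λ.hom.hom (frobFun ψ φ v)

/-- Let `L : B ⥤ C` and `L' : B ⥤ D` be additive functors and let `θ : L' ⋙ F' ⟶ L ⋙ F` be a
natural transformation. A morphism `e` between the values of the `i`-th left derived functors
of `F'` at `L' X` and of `F` at `L X` is induced by `θ` if, for each projective resolution `P`
of `X`, it is given by `H_i (θ_P) : H_i (F' (L' P)) ⟶ H_i (F (L P))`, after comparing `L' P` and
`L P` with projective resolutions `Q` of `L' X` and `R` of `L X`. -/
def IsDerivedFrom {B C D E : Type*} [Category* B] [Category* C] [Category* D] [Category* E]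
    [Abelian B] [Abelian C] [Abelian D] [Abelian E] [HasProjectiveResolutions C]
    [HasProjectiveResolutions D] {L : B ⥤ C} {L' : B ⥤ D} [L.Additive] [L'.Additive]
    {F : C ⥤ E} {F' : D ⥤ E} [F.Additive] [F'.Additive] (θ : L' ⋙ F' ⟶ L ⋙ F) (i : ℕ) (X : B)
    (e : (F'.leftDerived i).obj (L'.obj X) ⟶ (F.leftDerived i).obj (L.obj X)) : Prop :=
  ∀ (P : ProjectiveResolution X) (Q : ProjectiveResolution (L'.obj X))
    (R : ProjectiveResolution (L.obj X))
    (β : (L'.mapHomologicalComplex _).obj P.complex ⟶ Q.complex)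
    (α : (L.mapHomologicalComplex _).obj P.complex ⟶ R.complex),
    β.f 0 ≫ Q.π.f 0 = L'.map (P.π.f 0) → α.f 0 ≫ R.π.f 0 = L.map (P.π.f 0) →
    HomologicalComplex.homologyMap ((F'.mapHomologicalComplex _).map β) i ≫
        (Q.isoLeftDerivedObj F' i).inv ≫ e =
      HomologicalComplex.homologyMap
          ((NatTrans.mapHomologicalComplex θ (ComplexShape.down ℕ)).app P.complex) i ≫
        HomologicalComplex.homologyMap ((F.mapHomologicalComplex _).map α) i ≫
        (R.isoLeftDerivedObj F i).inv

/-- The natural isomorphism `Φ` of extension groups is the one induced by the Frobenius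
reciprocity `Θ` on projective resolutions. -/
def IsInducedBy {δ : smoothChar H} {k : ℕ} (Θ : frobLeft H k ≅ frobRight H δ k) {i : ℕ}
    (Φ : shapiroLeft H k i ≅ shapiroRight H δ k i) : Prop :=
  ∀ (V : SmoothRep G) (V₀ : SmoothRep H),
    IsDerivedFrom (L := SmoothRep.ind H) (L' := SmoothRep.twist H δ k)
      (F := ((SmoothRep.genHom G k).obj V.dual).rightOp)
      (F' := ((linearYoneda ℂ (SmoothRep H)).obj ((SmoothRep.res H).obj V).dual).rightOp)
      (NatTrans.rightOp (Θ.hom.app (op V))) i V₀ ((Φ.hom.app (op V)).app (op V₀)).op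

end Shapiro
end

/-! The theorem rests on a description of the invariant functionals on an induced representation
that needs no measure on the quotient. Every element of `ind W` is a finite sum of translates of
bumps: right `K`-invariant functions supported in `HK`, with `K` compact open. A bump is determined
by its value at `1`, which can be any vector fixed by `H ∩ K`, and `K` may be taken as small as that
value requires (`indSpace_induction`). Passing from `K` to a smaller `K'` changes the value of every
invariant functional by the same rational factor, which depends only on `H`, `K`, `K'`
(`exists_bump_ratio`). So once a nonzero invariant functional `Λ` on `ind δ⁻¹` is given, the
invariant functionals on `ind W` are exactly the maps `φ ↦ Λ (ℓ ∘ φ)` with `ℓ : W → δ⁻¹` an `H`-map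
(`exists_liftFunctional_eq`). For one-dimensional `W` this already gives uniqueness of `δ` and of
`Λ` up to scalars.

Frobenius reciprocity: a compact element acts unipotently on a generalized homomorphism `T`, and
with finite order on its restriction to the orbit of any vector, hence it fixes `T`. So `T` extends
to a `G`-map `J_{G,k} → Hom(X, Y)`, and `Hom_{G,k}(X, V^∨)` becomes the space of invariant forms on
`V ⊗ J_{G,k} ⊗ X`. When `X = ind V₀`, the projection formula, used twice, turns such forms into
invariant functionals on `ind (V ⊗ J_{G,k} ⊗ V₀)`, hence into `H`-maps `V ⊗ J_{G,k} ⊗ V₀ → δ⁻¹`,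
which are the `H`-maps `δ ⊗ J_{G,k} ⊗ V₀ → (V|_H)^∨`.

Passage to Ext: induction and the twist are exact and preserve projectives, so both sides are
computed by one projective resolution of `V₀`. For projectivity, the test functions `S(G)` are
projective by a telescoping sum over a sequence of compact open subgroups; everything induced from
the trivial subgroup is then projective; and a projective `W` is a retract of `W ⊗ S(G)`, which
stays induced from the trivial subgroup under tensoring and, by transitivity, under induction.

Existence of `δ`: write `S(G) = ind_H^G S(H)`. Haar functionals on `G` and `H` have modulus
characters, and `δ` is their quotient on `H`; the functional of `G` then factors through the map
`ind S(H) → ind δ⁻¹` given by the functional of `H`, twisted by `δ`. The statements about `G / H`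
follow because `S(G/H)` is, up to a twist by `χ`, induced from the inverse of `χ|_H`. -/

noncomputable section

/-! ### Bump functions in induced representations -/

section Bumps

variable {G : Type} [Group G] [TopologicalSpace G] {H : Subgroup G}
  {W : Type} [AddCommGroup W] [Module ℂ W] {W' : Type} [AddCommGroup W'] [Module ℂ W']
  {σ : Representation ℂ H W} {σ' : Representation ℂ H W'}

/-- The representation of `G` on `indSpace H σ` by right translations. -/
def indRep [IsTopologicalGroup G] (σ : Representation ℂ H W) : Representation ℂ G (indSpace H σ) :=
  (rightTranslation G W).subrepresentation (indSpace H σ) (indSpace_le_comap H σ)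

theorem indRep_apply [IsTopologicalGroup G] (g : G) (φ : indSpace H σ) (x : G) :
    (indRep σ g φ).1 x = φ.1 (x * g) := rfl

/-- Composition with an intertwining map. -/
def indSpaceMap (f : W →ₗ[ℂ] W') (hf : ∀ h w, f (σ h w) = σ' h (f w)) :
    indSpace H σ →ₗ[ℂ] indSpace H σ' :=
  (f.compLeft G).restrict (by
    rintro φ ⟨h1, h2, C, hC, hφC⟩
    refine ⟨h1.comp _, fun h g => ?_, C, hC, fun x hx => hφC fun h0 => hx ?_⟩
    · change f (φ (h * g)) = σ' h (f (φ g))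
      rw [h2, hf]
    · change f (φ x) = 0
      rw [h0, map_zero])

theorem indSpaceMap_apply (f : W →ₗ[ℂ] W') (hf : ∀ h w, f (σ h w) = σ' h (f w))
    (φ : indSpace H σ) (x : G) : (indSpaceMap f hf φ).1 x = f (φ.1 x) := rfl

theorem isLocallyConstant_of_right_invariant {X : Type*} [IsTopologicalGroup G] (K : OpenSubgroup G)
    {φ : G → X} (h : ∀ y, ∀ k ∈ K, φ (y * k) = φ y) : IsLocallyConstant φ := by
  rw [IsLocallyConstant.iff_eventually_eq]
  intro g
  have hc : Filter.Tendsto (fun y : G => g⁻¹ * y) (𝓝 g) (𝓝 1) := by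
    have : Continuous fun y : G => g⁻¹ * y := by fun_prop
    simpa using this.tendsto g
  filter_upwards [hc.eventually K.mem_nhds_one] with y hy
  have := h g _ hy
  rwa [mul_inv_cancel_left] at this

/-- A function which is right `K`-invariant and supported in `H K`. -/
def IsBump (H : Subgroup G) (K : OpenSubgroup G) {X : Type*} [Zero X] (φ : G → X) : Prop :=
  (∀ y, ∀ k ∈ K, φ (y * k) = φ y) ∧ ∀ y, φ y ≠ 0 → ∃ h ∈ H, ∃ k ∈ K, y = h * k

/-- Left equivariance and right `K`-invariance propagate the value at `1` to all of `HK`, and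
outside `HK` the function is zero. Identities between bumps below are checked at `1` only. -/
theorem IsBump.ext {K : OpenSubgroup G} {φ ψ : indSpace H σ} (hφ : IsBump H K φ.1)
    (hψ : IsBump H K ψ.1) (h1 : φ.1 1 = ψ.1 1) : φ = ψ := by
  refine Subtype.ext (funext fun y => ?_)
  by_cases hy : ∃ h ∈ H, ∃ k ∈ K, y = h * k
  · obtain ⟨h, hh, k, hk, rfl⟩ := hy
    rw [hφ.1 _ _ hk, hψ.1 _ _ hk]
    have e1 := φ.2.2.1 ⟨h, hh⟩ 1
    have e2 := ψ.2.2.1 ⟨h, hh⟩ 1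
    simp only [mul_one] at e1 e2
    rw [e1, e2, h1]
  · rw [not_not.1 fun h => hy (hφ.2 y h), not_not.1 fun h => hy (hψ.2 y h)]

theorem IsBump.fixed {K : OpenSubgroup G} {φ : indSpace H σ} (hφ : IsBump H K φ.1) (h : H)
    (hh : (h : G) ∈ K) : σ h (φ.1 1) = φ.1 1 := by
  rw [← φ.2.2.1, mul_one, ← hφ.1 1 h hh, one_mul]

theorem IsBump.smul {K : OpenSubgroup G} {φ : indSpace H σ} (hφ : IsBump H K φ.1) (z : ℂ) :
    IsBump H K (z • φ).1 := by
  refine ⟨fun y k hk => congrArg (z • ·) (hφ.1 y k hk), fun y hy => hφ.2 y fun h => hy ?_⟩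
  change z • φ.1 y = 0
  rw [h, smul_zero]

theorem IsBump.add {K : OpenSubgroup G} {φ ψ : indSpace H σ} (hφ : IsBump H K φ.1)
    (hψ : IsBump H K ψ.1) : IsBump H K (φ + ψ).1 := by
  refine ⟨fun y k hk => congrArg₂ (· + ·) (hφ.1 y k hk) (hψ.1 y k hk), fun y hy => ?_⟩
  by_cases hy1 : φ.1 y = 0
  · refine hψ.2 y fun hy2 => hy ?_
    change φ.1 y + ψ.1 y = 0
    rw [hy1, hy2, add_zero]
  · exact hφ.2 y hy1

theorem isBump_indSpaceMap (f : W →ₗ[ℂ] W') (hf : ∀ h w, f (σ h w) = σ' h (f w))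
    {K : OpenSubgroup G} {φ : indSpace H σ} (hφ : IsBump H K φ.1) :
    IsBump H K (indSpaceMap f hf φ).1 :=
  ⟨fun y k hk => congrArg f (hφ.1 y k hk), fun y hy => hφ.2 y fun h => hy (by
    rw [indSpaceMap_apply, h, map_zero])⟩

/-- Together with `IsBump.fixed`, this says that bumps at level `K` correspond to vectors fixed by
`H ∩ K`. -/
theorem exists_isBump [IsTopologicalGroup G] {K : OpenSubgroup G} (hK : IsCompact (K : Set G))
    (σ : Representation ℂ H W) (w : W) (hw : ∀ h : H, (h : G) ∈ K → σ h w = w) :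
    ∃ φ : indSpace H σ, IsBump H K φ.1 ∧ φ.1 1 = w := by
  classical
  let f : G → W := fun y =>
    if hy : ∃ h : H, ∃ k ∈ K, y = h * k then σ hy.choose w else 0
  -- Two factorizations of the same point of `HK` have `H`-parts differing by an element of `H ∩ K`,
  -- which fixes `w`.
  have hf : ∀ (h : H), ∀ k ∈ K, f (h * k) = σ h w := by
    intro h k hk
    have hy : ∃ h' : H, ∃ k' ∈ K, (h : G) * k = h' * k' := ⟨h, k, hk, rfl⟩
    obtain ⟨k', hk', e⟩ := hy.choose_spec
    have hf' : f (h * k) = σ hy.choose w := dif_pos hy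
    rw [hf']
    have hm : ((h⁻¹ * hy.choose : H) : G) ∈ K := by
      have : ((h⁻¹ * hy.choose : H) : G) = k * k'⁻¹ := by
        push_cast
        rw [inv_mul_eq_iff_eq_mul, ← mul_assoc, eq_mul_inv_iff_mul_eq]
        exact e.symm
      rw [this]
      exact mul_mem hk (inv_mem hk')
    have := hw _ hm
    rw [map_mul, Module.End.mul_apply] at this
    conv_rhs => rw [← this]
    simp
  have hf0 : ∀ y, f y ≠ 0 → ∃ h : H, ∃ k ∈ K, y = h * k := by
    intro y hy
    by_contra hn
    exact hy (dif_neg hn)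
  have hright : ∀ y, ∀ k ∈ K, f (y * k) = f y := by
    intro y k hk
    by_cases hy : ∃ h : H, ∃ k ∈ K, y = h * k
    · obtain ⟨h, k', hk', rfl⟩ := hy
      rw [mul_assoc, hf _ _ (mul_mem hk' hk), hf _ _ hk']
    · rw [not_not.1 fun h => hy (hf0 y h)]
      by_contra h0
      obtain ⟨h, k', hk', e⟩ := hf0 _ h0
      exact hy ⟨h, k' * k⁻¹, mul_mem hk' (inv_mem hk), by rw [← mul_assoc, ← e]; simp⟩
  refine ⟨⟨f, isLocallyConstant_of_right_invariant K hright, ?_, K, hK, ?_⟩, ⟨hright, ?_⟩, ?_⟩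
  · intro h y
    by_cases hy : ∃ h : H, ∃ k ∈ K, y = h * k
    · obtain ⟨h', k', hk', rfl⟩ := hy
      have := hf (h * h') k' hk'
      rw [hf _ _ hk', ← mul_assoc]
      push_cast at this
      rw [this, map_mul, Module.End.mul_apply]
    · rw [not_not.1 fun h => hy (hf0 y h), map_zero]
      by_contra h0
      obtain ⟨h', k', hk', e⟩ := hf0 _ h0
      exact hy ⟨h⁻¹ * h', k', hk', by push_cast; rw [mul_assoc, ← e]; simp⟩
  · intro y hy
    obtain ⟨h, k, hk, rfl⟩ := hf0 y hy
    exact ⟨h, h.2, k, hk, rfl⟩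
  · intro y hy
    obtain ⟨h, k, hk, rfl⟩ := hf0 y hy
    exact ⟨h, h.2, k, hk, rfl⟩
  · simpa using hf 1 1 (one_mem K)

/-- The conjugate `a K a⁻¹`. -/
def OpenSubgroup.conjBy [IsTopologicalGroup G] (K : OpenSubgroup G) (a : G) : OpenSubgroup G :=
  ⟨K.toSubgroup.comap (MulAut.conj a⁻¹).toMonoidHom, K.isOpen.preimage
    (show Continuous fun x : G => a⁻¹ * x * a⁻¹⁻¹ by fun_prop)⟩

theorem OpenSubgroup.mem_conjBy [IsTopologicalGroup G] {K : OpenSubgroup G} {a g : G} :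
    g ∈ K.conjBy a ↔ a⁻¹ * g * a ∈ K := by
  change a⁻¹ * g * a⁻¹⁻¹ ∈ K ↔ _
  rw [inv_inv]

theorem OpenSubgroup.isCompact_conjBy [IsTopologicalGroup G] {K : OpenSubgroup G}
    (hK : IsCompact (K : Set G)) (a : G) : IsCompact (K.conjBy a : Set G) := by
  have hc : Continuous fun x : G => a * x * a⁻¹ := by fun_prop
  convert hK.image hc using 1
  ext g
  refine (OpenSubgroup.mem_conjBy (K := K) (a := a) (g := g)).trans
    ⟨fun h => ⟨_, h, by group⟩, ?_⟩
  rintro ⟨k, hk, rfl⟩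
  have e : a⁻¹ * (a * k * a⁻¹) * a = k := by group
  change a⁻¹ * (a * k * a⁻¹) * a ∈ K
  rwa [e]

/-- Since `HaKa⁻¹ = H(aKa⁻¹)`, translation by `a` brings a piece supported on one double coset into
the standard position, at the price of conjugating `K`. -/
theorem IsBump.translate [IsTopologicalGroup G] {K : OpenSubgroup G} {φ : indSpace H σ} {a : G}
    (h1 : ∀ y, ∀ k ∈ K, φ.1 (y * k) = φ.1 y)
    (h2 : ∀ y, φ.1 y ≠ 0 → ∃ h ∈ H, ∃ k ∈ K, y = h * a * k) :
    IsBump H (K.conjBy a) (indRep σ a φ).1 := by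
  refine ⟨fun y k hk => ?_, fun y hy => ?_⟩
  · rw [OpenSubgroup.mem_conjBy] at hk
    rw [indRep_apply, indRep_apply, ← h1 (y * a) _ hk]
    group
  · obtain ⟨h, hh, k, hk, e⟩ := h2 _ hy
    refine ⟨h, hh, a * k * a⁻¹, ?_, ?_⟩
    · rw [OpenSubgroup.mem_conjBy]
      convert hk using 1
      group
    · rw [eq_mul_inv_of_mul_eq e]
      group

theorem charRepresentation_inv_apply (δ : smoothChar H) (h : H) (z : ℂ) :
    charRepresentation (δ⁻¹).1 h z = ((δ.1 h : ℂ))⁻¹ * z := by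
  change (((δ.1 h)⁻¹ : ℂˣ) : ℂ) • z = _
  simp

variable [IsLGroup G]

/-- A submodule of an induced representation which is stable under translations and contains all
sufficiently concentrated bump functions is everything. -/
theorem indSpace_induction (N : W → Set G) (hN : ∀ w, N w ∈ 𝓝 (1 : G))
    (p : Submodule ℂ (indSpace H σ)) (hp : ∀ g, ∀ φ ∈ p, indRep σ g φ ∈ p)
    (hb : ∀ K : OpenSubgroup G, IsCompact (K : Set G) → ∀ φ : indSpace H σ, IsBump H K φ.1 →
      (K : Set G) ⊆ N (φ.1 1) → φ ∈ p) (φ : indSpace H σ) : φ ∈ p := by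
  classical
  obtain ⟨hlc, -, C, hC, hφC⟩ := φ.2
  -- The piece of `φ` on `HxK`, translated by `x`, is a bump at level `xKx⁻¹` with value `φ x`. One
  -- `K` has to satisfy the smallness condition for all `x ∈ C`; compactness of `C` and local
  -- constancy of `φ` provide it.
  have e1 : ∀ᶠ k in 𝓝 (1 : G), ∀ x ∈ C, x * k * x⁻¹ ∈ N (φ.1 x) := by
    refine hC.eventually_forall_of_forall_eventually fun x _ => ?_
    have h1 : ∀ᶠ q : G × G in 𝓝 ((1 : G), x), φ.1 q.2 = φ.1 x :=
      (continuous_snd.tendsto ((1 : G), x)).eventually (hlc.eventually_eq x)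
    have hc : Filter.Tendsto (fun q : G × G => q.2 * q.1 * q.2⁻¹) (𝓝 (1, x)) (𝓝 1) := by
      have : Continuous fun q : G × G => q.2 * q.1 * q.2⁻¹ := by fun_prop
      simpa using this.tendsto (1, x)
    filter_upwards [h1, hc.eventually (hN (φ.1 x))] with q h2 h3
    rw [h2]
    exact h3
  have e2 := (Representation.isSmoothVector_iff _ _).1 (indSpace_smooth H σ φ.1 φ.2)
  obtain ⟨K, hK, hKU⟩ := IsLGroup.exists_compact_openSubgroup (e1.and e2)
  -- Induction on a finite set of representatives of double cosets. The alternative `ψ x = 0` makes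
  -- the hypothesis stable under removing a double coset, which may also contain other elements of
  -- `F`.
  have key : ∀ (F : Finset G) (ψ : indSpace H σ), (∀ y, ∀ k ∈ K, ψ.1 (y * k) = ψ.1 y) →
      (∀ y, ψ.1 y ≠ 0 → ∃ h ∈ H, ∃ x ∈ F, ∃ k ∈ K, y = h * x * k) →
      (∀ x ∈ F, ψ.1 x = 0 ∨ ∀ k ∈ K, x * k * x⁻¹ ∈ N (ψ.1 x)) → ψ ∈ p := by
    intro F
    induction F using Finset.induction_on with
    | empty =>
      intro ψ _ h2 _
      convert zero_mem p
      refine Subtype.ext (funext fun y => not_not.1 fun hy => ?_)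
      simpa using h2 y hy
    | insert a F _ ih =>
      intro ψ h1 h2 h3
      -- Split off the restriction of `ψ` to the double coset `HaK`, which is stable under `H` on
      -- the left and `K` on the right.
      let D : Set G := {y | ∃ h ∈ H, ∃ k ∈ K, y = h * a * k}
      have hDr : ∀ y, ∀ k ∈ K, (y * k ∈ D ↔ y ∈ D) := by
        intro y k hk
        constructor
        · rintro ⟨h, hh, k', hk', e⟩
          exact ⟨h, hh, k' * k⁻¹, mul_mem hk' (inv_mem hk), by
            rw [← mul_assoc, ← e, mul_inv_cancel_right]⟩
        · rintro ⟨h, hh, k', hk', rfl⟩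
          exact ⟨h, hh, k' * k, mul_mem hk' hk, by rw [mul_assoc]⟩
      have hDl : ∀ y, ∀ h ∈ H, (h * y ∈ D ↔ y ∈ D) := by
        intro y h hh
        constructor
        · rintro ⟨h', hh', k', hk', e⟩
          exact ⟨h⁻¹ * h', mul_mem (inv_mem hh) hh', k', hk', by
            rw [mul_assoc, mul_assoc, ← mul_assoc h', ← e, inv_mul_cancel_left]⟩
        · rintro ⟨h', hh', k', hk', rfl⟩
          exact ⟨h * h', mul_mem hh hh', k', hk', by simp only [mul_assoc]⟩
      let f : G → W := fun y => if y ∈ D then ψ.1 y else 0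
      have hfr : ∀ y, ∀ k ∈ K, f (y * k) = f y := by
        intro y k hk
        simp only [f, hDr y k hk, h1 y k hk]
      have hfD : ∀ y, f y ≠ 0 → y ∈ D := fun y hy => by
        by_contra hn
        exact hy (if_neg hn)
      let ψ₁ : indSpace H σ := ⟨f, isLocallyConstant_of_right_invariant K hfr, fun h y => by
          simp only [f, hDl y h h.2, ψ.2.2.1]
          split_ifs <;> simp, a • (K : Set G), hK.smul a, fun y hy => by
            obtain ⟨h, hh, k, hk, rfl⟩ := hfD y hy
            exact ⟨h, hh, a * k, ⟨k, hk, rfl⟩, by simp only [mul_assoc]⟩⟩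
      have haD : a ∈ D := ⟨1, one_mem _, 1, one_mem _, by simp⟩
      have hψ₁ : ψ₁ ∈ p := by
        rcases h3 a (Finset.mem_insert_self a F) with h0 | h0
        · convert zero_mem p
          refine Subtype.ext (funext fun y => not_not.1 fun hy => ?_)
          have hyD := hfD y hy
          have hy' : ψ.1 y ≠ 0 := fun h => hy (by simp [ψ₁, f, h])
          obtain ⟨h, hh, k, hk, rfl⟩ := hyD
          apply hy'
          have := ψ.2.2.1 ⟨h, hh⟩ a
          rw [h1 _ _ hk]
          exact this.trans (by rw [h0, map_zero])
        · have hbump : IsBump H (K.conjBy a) (indRep σ a ψ₁).1 := IsBump.translate hfr hfD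
          have hval : (indRep σ a ψ₁).1 1 = ψ.1 a := by
            rw [indRep_apply, one_mul]
            exact if_pos haD
          have hm := hb _ (OpenSubgroup.isCompact_conjBy hK a) _ hbump (by
            rw [hval]
            intro g hg
            have := h0 _ (OpenSubgroup.mem_conjBy.1 hg)
            convert this using 1
            group)
          have := hp a⁻¹ _ hm
          rwa [← Module.End.mul_apply, ← map_mul, inv_mul_cancel, map_one,
            Module.End.one_apply] at this
      have hrest : ψ - ψ₁ ∈ p := by
        have hv : ∀ y, (ψ - ψ₁).1 y = if y ∈ D then 0 else ψ.1 y := by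
          intro y
          change ψ.1 y - (if y ∈ D then ψ.1 y else 0) = _
          split_ifs <;> simp
        refine ih _ (fun y k hk => ?_) (fun y hy => ?_) fun x hx => ?_
        · simp only [hv, hDr y k hk, h1 y k hk]
        · rw [hv] at hy
          have hyD : y ∉ D := fun h => hy (if_pos h)
          rw [if_neg hyD] at hy
          obtain ⟨h, hh, x, hx, k, hk, e⟩ := h2 y hy
          refine ⟨h, hh, x, (Finset.mem_insert.1 hx).resolve_left ?_, k, hk, e⟩
          rintro rfl
          exact hyD ⟨h, hh, k, hk, e⟩
        · rw [hv]
          split_ifs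
          · exact Or.inl rfl
          · exact h3 x (Finset.mem_insert_of_mem hx)
      simpa using add_mem hrest hψ₁
  obtain ⟨F, hFC, hF⟩ := hC.elim_nhds_subcover (fun x => x • (K : Set G)) fun x _ => by
    have : (1 : G) ∈ (K : Set G) := one_mem K
    exact (K.isOpen.smul x).mem_nhds ⟨1, this, by simp⟩
  refine key F φ (fun y k hk => congrFun (hKU hk).2 y) (fun y hy => ?_)
    fun x hx => Or.inr fun k hk => (hKU hk).1 x (hFC x hx)
  obtain ⟨h, hh, c, hc, rfl⟩ := hφC hy
  obtain ⟨x, hx, k, hk, rfl⟩ := Set.mem_iUnion₂.1 (hF hc)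
  exact ⟨h, hh, x, hx, k, hk, by simp [mul_assoc]⟩

end Bumps

/-! ### Invariant functionals on induced representations -/

section Functionals

variable {G : Type} [Group G] [TopologicalSpace G] [IsLGroup G] {H : Subgroup G}
  {W : Type} [AddCommGroup W] [Module ℂ W] {σ : Representation ℂ H W}

/-- Invariance of a linear functional on an induced representation. -/
def IsInvariantFunctional (T : indSpace H σ →ₗ[ℂ] ℂ) : Prop := ∀ g φ, T (indRep σ g φ) = T φ

/-- Summing the translates of a `K'`-bump over `K / K'` gives a multiple of the `K`-bump with the
same value at `1`. What matters is that `n` and `c` do not depend on the representation, the value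
or the functional, so they cancel when two functionals are compared. -/
theorem exists_bump_ratio (H : Subgroup G) {K' K : OpenSubgroup G} (hK : IsCompact (K : Set G))
    (hle : K' ≤ K) : ∃ n c : ℕ, n ≠ 0 ∧ c ≠ 0 ∧
      ∀ {W : Type} [AddCommGroup W] [Module ℂ W] {σ : Representation ℂ H W}
        {φ φ' : indSpace H σ}, IsBump H K φ.1 → IsBump H K' φ'.1 → φ.1 1 = φ'.1 1 →
        ∀ T : indSpace H σ →ₗ[ℂ] ℂ, IsInvariantFunctional T → (n : ℂ) * T φ' = c * T φ := by
  classical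
  have : CompactSpace K.toSubgroup := isCompact_iff_compactSpace.1 hK
  let L : Subgroup K.toSubgroup := K'.toSubgroup.subgroupOf K.toSubgroup
  have hL : IsOpen (L : Set K.toSubgroup) := K'.isOpen.preimage continuous_subtype_val
  have : Finite (K.toSubgroup ⧸ L) := L.quotient_finite_of_isOpen hL
  let _ : Fintype (K.toSubgroup ⧸ L) := Fintype.ofFinite _
  let P : K.toSubgroup ⧸ L → Prop := fun q => ∃ h ∈ H, ∃ k' ∈ K', (q.out : G) = h * k'
  -- Here `n` is the index of `K'` in `K`, and `c` counts the cosets contained in `(H ∩ K)K'`, the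
  -- only ones that contribute at `1`.
  refine ⟨Fintype.card (K.toSubgroup ⧸ L), (Finset.univ.filter P).card, Fintype.card_ne_zero,
    ?_, ?_⟩
  · refine Finset.card_ne_zero_of_mem (a := ((1 : K.toSubgroup) : K.toSubgroup ⧸ L)) ?_
    refine Finset.mem_filter.2 ⟨Finset.mem_univ _, 1, one_mem _, _, ?_, (one_mul _).symm⟩
    have h := QuotientGroup.eq.1 (QuotientGroup.out_eq' ((1 : K.toSubgroup) : K.toSubgroup ⧸ L)).symm
    rw [inv_one, one_mul] at h
    exact h
  · intro W _ _ σ φ φ' hφ hφ' h1 T hT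
    have hout : ∀ (k : K.toSubgroup) (y : G), φ'.1 (y * ((k : K.toSubgroup ⧸ L).out : G)) =
        φ'.1 (y * k) := by
      intro k y
      have h := QuotientGroup.eq.1 (QuotientGroup.out_eq' (k : K.toSubgroup ⧸ L)).symm
      rw [← hφ'.1 (y * k) _ h]
      change _ = φ'.1 (y * k * ((k : G)⁻¹ * _))
      rw [mul_assoc, mul_inv_cancel_left]
    have key : ∑ q : K.toSubgroup ⧸ L, indRep σ (q.out : G) φ' =
        ((Finset.univ.filter P).card : ℂ) • φ := by
      have hval : ∀ y, (∑ q : K.toSubgroup ⧸ L, indRep σ (q.out : G) φ').1 y =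
          ∑ q : K.toSubgroup ⧸ L, φ'.1 (y * q.out) := by
        intro y
        simp only [Submodule.coe_sum, Finset.sum_apply]
        rfl
      refine IsBump.ext (K := K) ⟨fun y k hk => ?_, fun y hy => ?_⟩ (hφ.smul _) ?_
      · rw [hval, hval, ← Equiv.sum_comp (MulAction.toPerm (⟨k, hk⟩ : K.toSubgroup))
          fun q : K.toSubgroup ⧸ L => φ'.1 (y * q.out)]
        refine Finset.sum_congr rfl fun q _ => ?_
        conv_rhs => rw [← QuotientGroup.out_eq' q]
        have := hout (⟨k, hk⟩ * q.out) y
        rw [mul_assoc]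
        exact this.symm
      · rw [hval] at hy
        obtain ⟨q, -, hq⟩ := Finset.exists_ne_zero_of_sum_ne_zero hy
        obtain ⟨h, hh, k, hk, e⟩ := hφ'.2 _ hq
        refine ⟨h, hh, k * (q.out : G)⁻¹, mul_mem (hle hk) (inv_mem q.out.2), ?_⟩
        rw [← mul_assoc, ← e, mul_inv_cancel_right]
      · rw [hval]
        change _ = ((Finset.univ.filter P).card : ℂ) • φ.1 1
        rw [Nat.cast_smul_eq_nsmul, ← Finset.sum_const, Finset.sum_filter]
        refine Finset.sum_congr rfl fun q _ => ?_
        rw [one_mul]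
        split_ifs with hq
        · obtain ⟨h, hh, k', hk', e⟩ := hq
          have hhK : h ∈ K := by
            rw [eq_mul_inv_of_mul_eq e.symm]
            exact mul_mem q.out.2 (inv_mem (hle hk'))
          rw [e, hφ'.1 _ _ hk']
          have := φ'.2.2.1 ⟨h, hh⟩ 1
          rw [mul_one] at this
          exact this.trans (by rw [← h1]; exact hφ.fixed ⟨h, hh⟩ hhK)
        · by_contra h0
          obtain ⟨h, hh, k, hk, e⟩ := hφ'.2 _ h0
          exact hq ⟨h, hh, k, hk, e⟩
    have := congrArg T key
    rw [map_sum, Finset.sum_congr rfl fun q _ => hT _ _, map_smul, Finset.sum_const,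
      Finset.card_univ, nsmul_eq_mul] at this
    exact this

variable {δ : smoothChar H} {Λ : indSpace H (charRepresentation (δ⁻¹).1) →ₗ[ℂ] ℂ}

/-- A nonzero invariant functional does not vanish on nonzero bump functions. -/
theorem bump_functional_ne_zero (hΛ : IsInvariantFunctional Λ) (h0 : Λ ≠ 0) {K : OpenSubgroup G}
    (hK : IsCompact (K : Set G)) {φ : indSpace H (charRepresentation (δ⁻¹).1)}
    (hφ : IsBump H K φ.1) (h1 : φ.1 1 ≠ 0) : Λ φ ≠ 0 := by
  intro hz
  apply h0
  refine LinearMap.ext fun ψ => ?_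
  refine indSpace_induction (fun _ => Set.univ) (fun _ => Filter.univ_mem) (LinearMap.ker Λ)
    (fun g ψ hψ => by rw [LinearMap.mem_ker, hΛ]; exact hψ) ?_ ψ
  intro K₁ hK₁ ψ hψ _
  rw [LinearMap.mem_ker]
  by_cases h2 : ψ.1 1 = 0
  · rw [IsBump.ext (φ := ψ) (ψ := 0) hψ ⟨fun _ _ _ => rfl, fun y hy => (hy rfl).elim⟩ h2, map_zero]
  have hc : IsCompact ((K ⊓ K₁ : OpenSubgroup G) : Set G) :=
    hK.inter_right K₁.isClosed
  -- The existence of `φ` with nonzero value at `1` already forces `δ` to be trivial on `H ∩ K`.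
  have hfix : ∀ h : H, (h : G) ∈ K ⊓ K₁ → charRepresentation (δ⁻¹).1 h (1 : ℂ) = 1 := by
    intro h hh
    have := hφ.fixed h hh.1
    rw [charRepresentation_inv_apply] at this ⊢
    rw [mul_one]
    exact mul_right_cancel₀ h1 (this.trans (one_mul _).symm)
  obtain ⟨θ, hθ, hθ1⟩ := exists_isBump hc (charRepresentation (δ⁻¹).1) 1 hfix
  have hsm1 : ∀ z : ℂ, z = (z • θ).1 1 := fun z => by
    change z = z • θ.1 1
    rw [hθ1, smul_eq_mul, mul_one]
  obtain ⟨n, c, hn, -, e⟩ := exists_bump_ratio H hK (inf_le_left : K ⊓ K₁ ≤ K)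
  obtain ⟨n', c', -, hc', e'⟩ := exists_bump_ratio H hK₁ (inf_le_right : K ⊓ K₁ ≤ K₁)
  have f1 := e hφ (hθ.smul (φ.1 1)) (hsm1 _) Λ hΛ
  have f2 := e' hψ (hθ.smul (ψ.1 1)) (hsm1 _) Λ hΛ
  rw [hz, mul_zero, map_smul, smul_eq_mul] at f1
  have hθ0 : Λ θ = 0 := by simpa [hn, h1] using f1
  rw [map_smul, hθ0, smul_zero, mul_zero] at f2
  simpa [hc'] using f2.symm

/-- The functional `φ ↦ Λ (ℓ ∘ φ)` attached to a `δ⁻¹`-equivariant functional `ℓ`. -/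
def liftFunctional (Λ : indSpace H (charRepresentation (δ⁻¹).1) →ₗ[ℂ] ℂ) (ℓ : W →ₗ[ℂ] ℂ)
    (hℓ : ∀ h w, ℓ (σ h w) = charRepresentation (δ⁻¹).1 h (ℓ w)) : indSpace H σ →ₗ[ℂ] ℂ :=
  Λ ∘ₗ indSpaceMap ℓ hℓ

theorem exists_fixing_openSubgroup (hσ : ∀ w, σ.IsSmoothVector w) (w : W) :
    ∃ U : Set G, U ∈ 𝓝 (1 : G) ∧ ∀ h : H, (h : G) ∈ U → σ h w = w := by
  have h := (σ.isSmoothVector_iff w).1 (hσ w)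
  rw [nhds_subtype_eq_comap, Filter.eventually_comap] at h
  exact ⟨_, h, fun x hx => hx x rfl⟩

/-- Both `w` and the character `δ` are fixed by `H ∩ K`. -/
def FixedBy (δ : smoothChar H) (σ : Representation ℂ H W) (w : W) (K : OpenSubgroup G) : Prop :=
  IsCompact (K : Set G) ∧ ∀ h : H, (h : G) ∈ K → σ h w = w ∧ δ.1 h = 1

theorem FixedBy.mono {w : W} {K K' : OpenSubgroup G} (h : FixedBy δ σ w K) (hK : K' ≤ K) :
    FixedBy δ σ w K' :=
  ⟨h.1.of_isClosed_subset K'.isClosed hK, fun x hx => h.2 x (hK hx)⟩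

theorem exists_fixedBy_nhds (δ : smoothChar H) (hσ : ∀ w, σ.IsSmoothVector w) (w : W) :
    ∃ U : Set G, U ∈ 𝓝 (1 : G) ∧ ∀ K : OpenSubgroup G, IsCompact (K : Set G) → (K : Set G) ⊆ U →
      FixedBy δ σ w K := by
  obtain ⟨U, hU, hU'⟩ := exists_fixing_openSubgroup hσ w
  have h : ∀ᶠ h in 𝓝 (1 : H), δ.1 h = 1 := by
    simpa using δ.2.eventually_eq 1
  rw [nhds_subtype_eq_comap, Filter.eventually_comap] at h
  exact ⟨_, Filter.inter_mem hU h, fun K hK hKU => ⟨hK, fun x hx =>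
    ⟨hU' x (hKU hx).1, (hKU hx).2 x rfl⟩⟩⟩

theorem exists_fixedBy (δ : smoothChar H) (hσ : ∀ w, σ.IsSmoothVector w) (w : W) :
    ∃ K : OpenSubgroup G, FixedBy δ σ w K := by
  obtain ⟨U, hU, h⟩ := exists_fixedBy_nhds δ hσ w
  obtain ⟨K, hK, hKU⟩ := IsLGroup.exists_compact_openSubgroup hU
  exact ⟨K, h K hK hKU⟩

theorem FixedBy.exists_unit_bump {w : W} {K : OpenSubgroup G} (h : FixedBy δ σ w K) :
    ∃ θ : indSpace H (charRepresentation (δ⁻¹).1), IsBump H K θ.1 ∧ θ.1 1 = 1 :=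
  exists_isBump h.1 _ 1 fun x hx => by
    rw [charRepresentation_inv_apply, (h.2 x hx).2]
    simp

/-- Composing a bump of value `w` with `ℓ` gives a bump of value `ℓ w`, and `Λ` cannot vanish on it
unless `ℓ w = 0`. This is the uniqueness of `ℓ`. -/
theorem eq_zero_of_liftFunctional_eq_zero (hσ : ∀ w, σ.IsSmoothVector w)
    (hΛ : IsInvariantFunctional Λ) (h0 : Λ ≠ 0) (ℓ : W →ₗ[ℂ] ℂ)
    (hℓ : ∀ h w, ℓ (σ h w) = charRepresentation (δ⁻¹).1 h (ℓ w))
    (hz : liftFunctional Λ ℓ hℓ = 0) : ℓ = 0 := by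
  refine LinearMap.ext fun w => ?_
  obtain ⟨K, hK⟩ := exists_fixedBy δ hσ w
  obtain ⟨φ, hφ, hφ1⟩ := exists_isBump hK.1 σ w fun h hh => (hK.2 h hh).1
  by_contra hne
  refine bump_functional_ne_zero hΛ h0 hK.1 (isBump_indSpaceMap ℓ hℓ hφ) ?_
    (LinearMap.congr_fun hz φ)
  rwa [indSpaceMap_apply, hφ1]

/-- The functional `ℓ` is recovered on `w` as the ratio of `T` on a bump of value `w` to `Λ` on the
bump of value `1` at the same level; by `exists_bump_ratio` this ratio does not depend on the level.
This is the universal property of `Λ` behind the uniqueness of `δ` and Frobenius reciprocity. -/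
theorem exists_liftFunctional_eq (hσ : ∀ w, σ.IsSmoothVector w)
    (hΛ : IsInvariantFunctional Λ) (h0 : Λ ≠ 0) (T : indSpace H σ →ₗ[ℂ] ℂ)
    (hT : IsInvariantFunctional T) :
    ∃ (ℓ : W →ₗ[ℂ] ℂ) (hℓ : ∀ h w, ℓ (σ h w) = charRepresentation (δ⁻¹).1 h (ℓ w)),
      liftFunctional Λ ℓ hℓ = T := by
  choose K₀ hK₀ using exists_fixedBy δ hσ
  have hb : ∀ w K, FixedBy δ σ w K → ∃ φ : indSpace H σ, IsBump H K φ.1 ∧ φ.1 1 = w :=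
    fun w K h => exists_isBump h.1 σ w fun x hx => (h.2 x hx).1
  let r : W → ℂ := fun w =>
    T (hb w _ (hK₀ w)).choose / Λ (FixedBy.exists_unit_bump (hK₀ w)).choose
  have hr : ∀ w K, FixedBy δ σ w K → ∀ (φ : indSpace H σ)
      (θ : indSpace H (charRepresentation (δ⁻¹).1)), IsBump H K φ.1 → φ.1 1 = w →
      IsBump H K θ.1 → θ.1 1 = 1 → T φ = r w * Λ θ := by
    -- Shrinking the level multiplies numerator and denominator by the same factor `c / n`.
    have aux : ∀ w K K', FixedBy δ σ w K → K' ≤ K → ∀ (φ φ' : indSpace H σ)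
        (θ θ' : indSpace H (charRepresentation (δ⁻¹).1)), IsBump H K φ.1 → φ.1 1 = w →
        IsBump H K' φ'.1 → φ'.1 1 = w → IsBump H K θ.1 → θ.1 1 = 1 →
        IsBump H K' θ'.1 → θ'.1 1 = 1 → T φ / Λ θ = T φ' / Λ θ' := by
      intro w K K' hK hle φ φ' θ θ' h1 h2 h3 h4 h5 h6 h7 h8
      obtain ⟨n, c, hn, hc, e⟩ := exists_bump_ratio H hK.1 hle
      have e1 := e h1 h3 (h2.trans h4.symm) T hT
      have e2 := e h5 h7 (h6.trans h8.symm) Λ hΛ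
      have hθ : Λ θ ≠ 0 := bump_functional_ne_zero hΛ h0 hK.1 h5 (by rw [h6]; exact one_ne_zero)
      have hθ' : Λ θ' ≠ 0 := bump_functional_ne_zero hΛ h0 (hK.mono hle).1 h7
        (by rw [h8]; exact one_ne_zero)
      have hn' : (n : ℂ) ≠ 0 := Nat.cast_ne_zero.2 hn
      have hc' : (c : ℂ) ≠ 0 := Nat.cast_ne_zero.2 hc
      rw [div_eq_div_iff hθ hθ']
      have : (c : ℂ) * n * (T φ * Λ θ') = c * n * (T φ' * Λ θ) := by
        linear_combination (-(n : ℂ) * Λ θ') * e1 + (n : ℂ) * T φ' * e2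
      exact mul_left_cancel₀ (mul_ne_zero hc' hn') this
    intro w K hK φ θ h1 h2 h3 h4
    have hθ : Λ θ ≠ 0 := bump_functional_ne_zero hΛ h0 hK.1 h3 (by rw [h4]; exact one_ne_zero)
    rw [← div_eq_iff hθ]
    have hK' : FixedBy δ σ w (K ⊓ K₀ w) := hK.mono inf_le_left
    obtain ⟨φ', h5, h6⟩ := hb w _ hK'
    obtain ⟨θ', h7, h8⟩ := hK'.exists_unit_bump
    rw [aux w K _ hK inf_le_left φ φ' θ θ' h1 h2 h5 h6 h3 h4 h7 h8]
    exact (aux w _ _ (hK₀ w) inf_le_right _ φ' _ θ' (hb w _ (hK₀ w)).choose_spec.1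
      (hb w _ (hK₀ w)).choose_spec.2 h5 h6 (FixedBy.exists_unit_bump (hK₀ w)).choose_spec.1
      (FixedBy.exists_unit_bump (hK₀ w)).choose_spec.2 h7 h8).symm
  let ℓ : W →ₗ[ℂ] ℂ :=
    { toFun := r
      map_add' := fun v w => by
        have hv : FixedBy δ σ v (K₀ v ⊓ K₀ w) := (hK₀ v).mono inf_le_left
        have hw : FixedBy δ σ w (K₀ v ⊓ K₀ w) := (hK₀ w).mono inf_le_right
        have hvw : FixedBy δ σ (v + w) (K₀ v ⊓ K₀ w) :=
          ⟨hv.1, fun x hx => ⟨by rw [map_add, (hv.2 x hx).1, (hw.2 x hx).1], (hv.2 x hx).2⟩⟩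
        obtain ⟨φ, h1, h2⟩ := hb v _ hv
        obtain ⟨φ', h3, h4⟩ := hb w _ hw
        obtain ⟨θ, h5, h6⟩ := hv.exists_unit_bump
        have hθ : Λ θ ≠ 0 := bump_functional_ne_zero hΛ h0 hv.1 h5 (by rw [h6]; exact one_ne_zero)
        have e1 := hr v _ hv φ θ h1 h2 h5 h6
        have e2 := hr w _ hw φ' θ h3 h4 h5 h6
        have e3 := hr (v + w) _ hvw (φ + φ') θ (h1.add h3) (congrArg₂ (· + ·) h2 h4) h5 h6
        rw [map_add, e1, e2, ← add_mul] at e3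
        exact (mul_right_cancel₀ hθ e3).symm
      map_smul' := fun z w => by
        have hw := hK₀ w
        have hzw : FixedBy δ σ (z • w) (K₀ w) :=
          ⟨hw.1, fun x hx => ⟨by rw [map_smul, (hw.2 x hx).1], (hw.2 x hx).2⟩⟩
        obtain ⟨φ, h1, h2⟩ := hb w _ hw
        obtain ⟨θ, h5, h6⟩ := hw.exists_unit_bump
        have hθ : Λ θ ≠ 0 := bump_functional_ne_zero hΛ h0 hw.1 h5 (by rw [h6]; exact one_ne_zero)
        have e1 := hr w _ hw φ θ h1 h2 h5 h6
        have e3 := hr (z • w) _ hzw (z • φ) θ (h1.smul z) (congrArg (z • ·) h2) h5 h6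
        rw [map_smul, e1, smul_eq_mul, ← mul_assoc] at e3
        exact (mul_right_cancel₀ hθ e3).symm }
  have hℓ : ∀ h w, ℓ (σ h w) = charRepresentation (δ⁻¹).1 h (ℓ w) := by
    intro h w
    have hw := hK₀ w
    obtain ⟨φ, h1, h2⟩ := hb w _ hw
    obtain ⟨θ, h5, h6⟩ := hw.exists_unit_bump
    -- Translating by `h ∈ H` turns a `K`-bump of value `w` into an `hKh⁻¹`-bump of value `σ h w`.
    -- The unit bump `θ` becomes one of value `δ(h)⁻¹`, hence the correction by `δ h` below.
    have hconj : FixedBy δ σ (σ h w) ((K₀ w).conjBy (h : G)) := by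
      refine ⟨OpenSubgroup.isCompact_conjBy hw.1 _, fun x hx => ?_⟩
      obtain ⟨f1, f2⟩ := hw.2 (h⁻¹ * x * h) (OpenSubgroup.mem_conjBy.1 hx)
      constructor
      · conv_rhs => rw [← f1]
        rw [← Module.End.mul_apply, ← Module.End.mul_apply, ← map_mul, ← map_mul]
        congr 2
        group
      · rw [map_mul, map_mul, map_inv, mul_right_comm, inv_mul_cancel, one_mul] at f2
        exact f2
    have tr : ∀ {X : Type} [AddCommGroup X] [Module ℂ X] {τ : Representation ℂ H X}
        {ξ : indSpace H τ}, IsBump H (K₀ w) ξ.1 →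
        IsBump H ((K₀ w).conjBy (h : G)) (indRep τ (h : G) ξ).1 ∧
          (indRep τ (h : G) ξ).1 1 = τ h (ξ.1 1) := by
      intro X _ _ τ ξ hξ
      refine ⟨IsBump.translate hξ.1 fun y hy => ?_, ?_⟩
      · obtain ⟨h', hh', k, hk, e⟩ := hξ.2 y hy
        exact ⟨h' * (h : G)⁻¹, mul_mem hh' (inv_mem h.2), k, hk, by rw [e]; group⟩
      · rw [indRep_apply, one_mul, ← ξ.2.2.1, mul_one]
    have hδ : ((δ.1 h : ℂ)) ≠ 0 := Units.ne_zero _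
    have hθ : Λ θ ≠ 0 := bump_functional_ne_zero hΛ h0 hw.1 h5 (by rw [h6]; exact one_ne_zero)
    have e1 := hr w _ hw φ θ h1 h2 h5 h6
    have e2 := hr (σ h w) _ hconj (indRep σ (h : G) φ) ((δ.1 h : ℂ) • indRep _ (h : G) θ)
      (tr h1).1 ((tr h1).2.trans (by rw [h2])) ((tr h5).1.smul _) (by
        change (δ.1 h : ℂ) • (indRep _ (h : G) θ).1 1 = 1
        rw [(tr h5).2, h6, charRepresentation_inv_apply, smul_eq_mul, mul_one, mul_inv_cancel₀ hδ])
    rw [map_smul, hT, hΛ, e1, smul_eq_mul, ← mul_assoc] at e2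
    have e3 := mul_right_cancel₀ hθ e2
    rw [charRepresentation_inv_apply]
    change r (σ h w) = _ * r w
    rw [e3]
    field_simp
  refine ⟨ℓ, hℓ, ?_⟩
  choose U hU hU' using exists_fixedBy_nhds δ hσ
  refine LinearMap.ext fun ψ => ?_
  -- Both functionals are invariant, so it is enough to compare them on bumps whose level fixes the
  -- value and `δ`, where the equality is the definition of the ratio.
  refine indSpace_induction U hU (LinearMap.eqLocus (liftFunctional Λ ℓ hℓ) T) ?_ ?_ ψ
  · intro g φ hφ
    have e : indSpaceMap ℓ hℓ (indRep σ g φ) = indRep _ g (indSpaceMap ℓ hℓ φ) := rfl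
    change Λ (indSpaceMap ℓ hℓ (indRep σ g φ)) = T (indRep σ g φ)
    rw [e, hΛ, hT]
    exact hφ
  · intro K hK φ hφ hKU
    have hf := hU' _ K hK hKU
    obtain ⟨θ, h5, h6⟩ := hf.exists_unit_bump
    change Λ (indSpaceMap ℓ hℓ φ) = T φ
    rw [hr _ K hf φ θ hφ rfl h5 h6]
    have e : indSpaceMap ℓ hℓ φ = r (φ.1 1) • θ := by
      refine IsBump.ext (isBump_indSpaceMap ℓ hℓ hφ) (h5.smul _) ?_
      change r (φ.1 1) = r (φ.1 1) • θ.1 1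
      rw [h6, smul_eq_mul, mul_one]
    rw [e, map_smul, smul_eq_mul]

end Functionals

/-! ### The projection formula -/

section TensorInd

variable {G : Type} [Group G] [TopologicalSpace G] [IsLGroup G] {H : Subgroup G}
  {V : Type} [AddCommGroup V] [Module ℂ V] {W : Type} [AddCommGroup W] [Module ℂ W]
  {ρ : Representation ℂ G V}

open TensorProduct in
/-- The projection formula map `V ⊗ ind W → ind (V|_H ⊗ W)`, `v ⊗ φ ↦ (x ↦ x v ⊗ φ x)`. -/
def tensorInd (hρ : ∀ v, ρ.IsSmoothVector v) (σ : Representation ℂ H W) :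
    V ⊗[ℂ] indSpace H σ →ₗ[ℂ] indSpace H (Representation.tprod (ρ.comp H.subtype) σ) :=
  TensorProduct.lift (LinearMap.mk₂ ℂ
    (fun v φ => ⟨fun x => ρ x v ⊗ₜ φ.1 x, by
      obtain ⟨h1, h2, C, hC, hφC⟩ := φ.2
      refine ⟨((hρ v).isLocallyConstant.prodMk h1).comp fun p => p.1 ⊗ₜ p.2, fun h g => ?_, C, hC,
        fun x hx => hφC fun h0 => hx ?_⟩
      · dsimp only
        rw [h2, Representation.tprod_apply, TensorProduct.map_tmul, map_mul]
        rfl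
      · dsimp only
        rw [h0, tmul_zero]⟩)
    (fun v v' φ => Subtype.ext (funext fun x => by
      change ρ x (v + v') ⊗ₜ[ℂ] φ.1 x = ρ x v ⊗ₜ[ℂ] φ.1 x + ρ x v' ⊗ₜ[ℂ] φ.1 x
      rw [map_add, add_tmul]))
    (fun c v φ => Subtype.ext (funext fun x => by
      change ρ x (c • v) ⊗ₜ[ℂ] φ.1 x = c • (ρ x v ⊗ₜ[ℂ] φ.1 x)
      rw [map_smul, smul_tmul']))
    (fun v φ φ' => Subtype.ext (funext fun x => tmul_add (R := ℂ) (ρ x v) (φ.1 x) (φ'.1 x)))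
    (fun c v φ => Subtype.ext (funext fun x => tmul_smul (R := ℂ) c (ρ x v) (φ.1 x))))

variable (hρ : ∀ v, ρ.IsSmoothVector v) {σ : Representation ℂ H W}

open TensorProduct

theorem tensorInd_tmul_apply (v : V) (φ : indSpace H σ) (x : G) :
    (tensorInd hρ σ (v ⊗ₜ φ)).1 x = ρ x v ⊗ₜ φ.1 x := rfl

theorem tensorInd_equivariant (g : G) (t : V ⊗[ℂ] indSpace H σ) :
    tensorInd hρ σ ((ρ.tprod (indRep σ)) g t) = indRep _ g (tensorInd hρ σ t) := by
  induction t using TensorProduct.induction_on with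
  | zero => simp only [map_zero]
  | add a b ha hb => simp only [map_add, ha, hb]
  | tmul v φ =>
    refine Subtype.ext (funext fun x => ?_)
    rw [Representation.tprod_apply, TensorProduct.map_tmul, tensorInd_tmul_apply, indRep_apply,
      indRep_apply, tensorInd_tmul_apply, map_mul]
    rfl

/-- Write `t` as a sum of `b i ⊗ φ i` over a basis of `V`. Undoing `ρ x` on the first factor of the
value at `x` leaves the sum of the `b i ⊗ φ i x`, so every `φ i x` can be read off. -/
theorem tensorInd_injective : Function.Injective (tensorInd hρ σ) := by
  classical
  rw [injective_iff_map_eq_zero]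
  intro t ht
  have key : ∀ (l : Module.Dual ℂ V) (x : G) (t : V ⊗[ℂ] indSpace H σ),
      (TensorProduct.lid ℂ _ (l.rTensor _ t)).1 x =
        TensorProduct.lid ℂ W ((l ∘ₗ ρ x⁻¹).rTensor W ((tensorInd hρ σ t).1 x)) := by
    intro l x t
    induction t using TensorProduct.induction_on with
    | zero => simp
    | add a b ha hb =>
      simp only [map_add, Submodule.coe_add, Pi.add_apply] at *
      rw [ha, hb]
    | tmul v φ =>
      rw [tensorInd_tmul_apply]
      simp
  let b := Module.Basis.ofVectorSpace ℂ V
  apply (TensorProduct.equivFinsuppOfBasisLeft b).injective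
  ext i x
  rw [TensorProduct.equivFinsuppOfBasisLeft_apply, key, ht]
  simp

/-- A bump of value `v ⊗ w` at a level fixing `v` is the image of `v` tensored with the bump of
value `w`. For a general tensor the level must fix the vectors of a decomposition, so the smallness
condition depends on the value; this is why `indSpace_induction` allows such a dependence. -/
theorem tensorInd_surjective (hσ : ∀ w, σ.IsSmoothVector w) :
    Function.Surjective (tensorInd hρ σ) := by
  have hN : ∀ t : V ⊗[ℂ] W, ∃ U ∈ 𝓝 (1 : G), ∀ K : OpenSubgroup G, IsCompact (K : Set G) →
      (K : Set G) ⊆ U → ∃ s, IsBump H K (tensorInd hρ σ s).1 ∧ (tensorInd hρ σ s).1 1 = t := by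
    intro t
    induction t using TensorProduct.induction_on with
    | zero =>
      refine ⟨Set.univ, Filter.univ_mem, fun K _ _ => ⟨0, ?_, ?_⟩⟩
      · rw [map_zero]
        exact ⟨fun _ _ _ => rfl, fun y hy => (hy rfl).elim⟩
      · rw [map_zero]
        rfl
    | add a b ha hb =>
      obtain ⟨U, hU, h1⟩ := ha
      obtain ⟨U', hU', h2⟩ := hb
      refine ⟨U ∩ U', Filter.inter_mem hU hU', fun K hK hKU => ?_⟩
      obtain ⟨s, h3, h4⟩ := h1 K hK fun x hx => (hKU hx).1
      obtain ⟨s', h5, h6⟩ := h2 K hK fun x hx => (hKU hx).2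
      refine ⟨s + s', ?_, ?_⟩
      · rw [map_add]
        exact h3.add h5
      · rw [map_add]
        exact congrArg₂ (· + ·) h4 h6
    | tmul v w =>
      obtain ⟨U, hU, h1⟩ := exists_fixing_openSubgroup hσ w
      have h2 := (ρ.isSmoothVector_iff v).1 (hρ v)
      refine ⟨_, Filter.inter_mem hU h2, fun K hK hKU => ?_⟩
      obtain ⟨φ, h3, h4⟩ := exists_isBump hK σ w fun h hh => h1 h (hKU hh).1
      refine ⟨v ⊗ₜ φ, ⟨fun y k hk => ?_, fun y hy => h3.2 y fun h => hy ?_⟩, ?_⟩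
      · have : ρ k v = v := (hKU hk).2
        rw [tensorInd_tmul_apply, tensorInd_tmul_apply, h3.1 y k hk, map_mul,
          Module.End.mul_apply, this]
      · rw [tensorInd_tmul_apply, h, tmul_zero]
      · rw [tensorInd_tmul_apply, h4, map_one, Module.End.one_apply]
  choose U hU h using hN
  intro ψ
  refine indSpace_induction U hU (LinearMap.range (tensorInd hρ σ)) ?_ ?_ ψ
  · rintro g _ ⟨t, rfl⟩
    exact ⟨_, tensorInd_equivariant hρ g t⟩
  · intro K hK φ hφ hKU
    obtain ⟨s, h1, h2⟩ := h _ K hK hKU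
    exact ⟨s, h1.ext hφ h2⟩

/-- The projection formula `V ⊗ ind W ≃ ind (V|_H ⊗ W)`. -/
def tensorIndEquiv (hσ : ∀ w, σ.IsSmoothVector w) :
    V ⊗[ℂ] indSpace H σ ≃ₗ[ℂ] indSpace H (Representation.tprod (ρ.comp H.subtype) σ) :=
  LinearEquiv.ofBijective (tensorInd hρ σ)
    ⟨tensorInd_injective hρ, tensorInd_surjective hρ hσ⟩

end TensorInd

/-! ### Generalized invariants and unipotent operators -/

section GenInvariants

variable {G : Type} [Group G] {V : Type} [AddCommGroup V] [Module ℂ V]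

theorem Representation.mem_genInvariants_succ {ρ : Representation ℂ G V} {k : ℕ} {v : V} :
    v ∈ ρ.genInvariants (k + 1) ↔ ∀ g, ρ g v - v ∈ ρ.genInvariants k := by
  constructor
  · intro h g f
    have := h (Fin.snoc f g)
    rw [List.ofFn_succ'] at this
    simpa [List.prod_append] using this
  · intro h f
    have := h (f (Fin.last _)) fun i => f i.castSucc
    rw [List.ofFn_succ']
    simpa [List.prod_append] using this

theorem Representation.mem_genInvariants_zero {ρ : Representation ℂ G V} {v : V} :
    v ∈ ρ.genInvariants 0 ↔ ∀ g, ρ g v = v := by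
  constructor
  · intro h g
    have := h fun _ => g
    simpa [sub_eq_zero] using this
  · intro h f
    simp [h]

/-- An element `T` of generalized invariants is killed by `(g - 1) ^ (k + 1)`. -/
theorem Representation.genInvariants_pow {ρ : Representation ℂ G V} {k : ℕ} {v : V}
    (hv : v ∈ ρ.genInvariants k) (g : G) : ((ρ g - 1) ^ (k + 1)) v = 0 := by
  have := hv fun _ => g
  rwa [List.ofFn_const, List.prod_replicate] at this

/-- A power of the augmentation ideal annihilates the generalized invariants. -/
theorem Representation.asAlgebraHom_genInvariants {ρ : Representation ℂ G V} {k : ℕ} {v : V}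
    (hv : v ∈ ρ.genInvariants k) {a : MonoidAlgebra ℂ G}
    (ha : a ∈ RingHom.ker (MonoidAlgebra.lift ℂ ℂ G 1) ^ (k + 1)) : ρ.asAlgebraHom a v = 0 := by
  have aug : ∀ (p : Submodule ℂ V) (v : V), (∀ g, ρ g v - v ∈ p) →
      ∀ b ∈ RingHom.ker (MonoidAlgebra.lift ℂ ℂ G 1), ρ.asAlgebraHom b v ∈ p := by
    intro p v h b hb
    -- Modulo `p` every group element acts on `v` as the identity, so `c` acts as its augmentation.
    have : ∀ c : MonoidAlgebra ℂ G,
        ρ.asAlgebraHom c v - (MonoidAlgebra.lift ℂ ℂ G 1 c) • v ∈ p := by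
      intro c
      induction c using MonoidAlgebra.induction_linear with
      | zero => simp
      | add x y hx hy =>
        rw [map_add, map_add, LinearMap.add_apply, add_smul, add_sub_add_comm]
        exact add_mem hx hy
      | single g r =>
        have := p.smul_mem r (h g)
        simpa [Representation.asAlgebraHom_single, smul_sub] using this
    have h2 := this b
    rw [RingHom.mem_ker] at hb
    have hb' : MonoidAlgebra.lift ℂ ℂ G 1 b = 0 := hb
    rwa [hb', zero_smul, sub_zero] at h2
  induction k generalizing v a with
  | zero =>
    rw [zero_add, Submodule.pow_one] at ha
    have := aug ⊥ v (fun g => by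
      rw [Submodule.mem_bot, Representation.mem_genInvariants_zero.1 hv g, sub_self]) a ha
    simpa using this
  | succ k ih =>
    rw [Submodule.pow_succ] at ha
    induction ha using Submodule.mul_induction_on' with
    | mem_mul_mem m hm n hn =>
      rw [map_mul, Module.End.mul_apply]
      exact ih (aug _ v (Representation.mem_genInvariants_succ.1 hv) n hn) hm
    | add x _ y _ hx hy => rw [map_add, LinearMap.add_apply, hx, hy, add_zero]

/-- A vector killed by a power of `A - 1` and by `A ^ n - 1`, `n ≠ 0`, is fixed by `A`. -/
theorem apply_eq_self_of_unipotent_of_finite_order {A : Module.End ℂ V} {v : V} {m n : ℕ}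
    (hn : n ≠ 0) (h1 : ((A - 1) ^ m) v = 0) (h2 : (A ^ n) v = v) : A v = v := by
  open Polynomial in
  -- Since `q 1 = n ≠ 0` in characteristic zero, `q` is prime to every power of `X - 1`. Hence `X -
  -- 1` is a combination of `(X - 1) ^ m` and `X ^ n - 1`.
  let q : ℂ[X] := ∑ i ∈ Finset.range n, X ^ i
  have hq : q * (X - 1) = X ^ n - 1 := geom_sum_mul X n
  have hcop : IsCoprime ((X - 1 : ℂ[X]) ^ m) q := by
    refine IsCoprime.pow_left ?_
    have hirr : Irreducible (X - 1 : ℂ[X]) := by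
      simpa using Polynomial.irreducible_X_sub_C (1 : ℂ)
    rw [hirr.coprime_iff_not_dvd]
    intro hd
    have : q.IsRoot 1 := by
      rw [← Polynomial.dvd_iff_isRoot]
      simpa using hd
    rw [Polynomial.IsRoot] at this
    simp [q, Polynomial.eval_finsetSum, hn] at this
  obtain ⟨a, b, hab⟩ := hcop
  have e : (X - 1 : ℂ[X]) = (X - 1) * a * (X - 1) ^ m + b * (X ^ n - 1) := by
    rw [← hq]
    linear_combination (-(X - 1 : ℂ[X])) * hab
  have h3 := congrArg (fun p => Polynomial.aeval A p v) e
  simp only [map_sub, map_add, map_mul, map_pow, Polynomial.aeval_X, map_one,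
    LinearMap.add_apply, Module.End.mul_apply, LinearMap.sub_apply, Module.End.one_apply, h1, h2,
    sub_self, map_zero, add_zero] at h3
  exact sub_eq_zero.1 h3

end GenInvariants

/-! ### Compact elements fix generalized homomorphisms -/

section CompactElements

variable {G : Type} [Group G] [TopologicalSpace G] [IsLGroup G]

/-- An open subgroup contained in `U` meets the compact group `K` in a subgroup of finite index. -/
theorem exists_pow_mem_of_mem_compact {K : Subgroup G} (hK : IsCompact (K : Set G)) {g : G}
    (hg : g ∈ K) {U : Set G} (hU : U ∈ 𝓝 (1 : G)) : ∃ n : ℕ, n ≠ 0 ∧ g ^ n ∈ U := by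
  obtain ⟨L, -, hL⟩ := IsLGroup.exists_compact_openSubgroup hU
  have : CompactSpace K := isCompact_iff_compactSpace.1 hK
  have hop : IsOpen ((L.toSubgroup.subgroupOf K : Subgroup K) : Set K) :=
    L.isOpen.preimage continuous_subtype_val
  have : Finite (K ⧸ L.toSubgroup.subgroupOf K) := Subgroup.quotient_finite_of_isOpen _ hop
  obtain ⟨n, hn, -, hm⟩ := Subgroup.exists_pow_mem_of_index_ne_zero
    (Subgroup.index_ne_zero_of_finite (H := L.toSubgroup.subgroupOf K)) ⟨g, hg⟩
  exact ⟨n, hn.ne', hL hm⟩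

variable {X : Type} [AddCommGroup X] [Module ℂ X] {Y : Type} [AddCommGroup Y] [Module ℂ Y]
  {ρ : Representation ℂ G X} {τ : Representation ℂ G Y}

/-- The representation on `Hom(X, Y)` need not be smooth, so no power of `g` obviously fixes `T`.
Only the restriction of `T` to the `g`-orbit of one vector `x` is used: it takes finitely many
values, all smooth, so some power of `g` fixes it, and an operator that is both unipotent and of
finite order on a vector fixes it. -/
theorem linHom_apply_eq_of_mem_compact (hρ : ∀ x, ρ.IsSmoothVector x)
    (hτ : ∀ y, τ.IsSmoothVector y) {k : ℕ} {T : X →ₗ[ℂ] Y}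
    (hT : T ∈ (ρ.linHom τ).genInvariants k) {K : Subgroup G} (hK : IsCompact (K : Set G)) {g : G}
    (hg : g ∈ K) : ρ.linHom τ g T = T := by
  refine LinearMap.ext fun x => ?_
  -- The action of `g` on `T`, seen on the sequence `i ↦ T (g ^ i x)`.
  let A : Module.End ℂ (ℤ → Y) :=
    { toFun := fun f i => τ g (f (i - 1))
      map_add' := fun f f' => funext fun i => map_add _ _ _
      map_smul' := fun c f => funext fun i => map_smul _ _ _ }
  let ev : (X →ₗ[ℂ] Y) →ₗ[ℂ] (ℤ → Y) :=
    { toFun := fun S i => S (ρ (g ^ i) x)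
      map_add' := fun f f' => rfl
      map_smul' := fun c f => rfl }
  have hev : ∀ S, ev (ρ.linHom τ g S) = A (ev S) := by
    intro S
    funext i
    change τ g (S (ρ g⁻¹ (ρ (g ^ i) x))) = τ g (S (ρ (g ^ (i - 1)) x))
    rw [← Module.End.mul_apply, ← map_mul, zpow_sub_one, ← zpow_neg_one, ← zpow_add, ← zpow_add,
      add_comm]
  have hpow : ∀ (m : ℕ) S, ev (((ρ.linHom τ g - 1) ^ m) S) = ((A - 1) ^ m) (ev S) := by
    intro m
    induction m with
    | zero => intro S; rfl
    | succ m ih =>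
      intro S
      rw [pow_succ, pow_succ, Module.End.mul_apply, Module.End.mul_apply, ih]
      congr 1
      rw [LinearMap.sub_apply, LinearMap.sub_apply, map_sub, hev]
      rfl
  have hApow : ∀ (n : ℕ) (f : ℤ → Y) (i : ℤ), (A ^ n) f i = τ (g ^ n) (f (i - n)) := by
    intro n
    induction n with
    | zero => intro f i; simp
    | succ n ih =>
      intro f i
      rw [pow_succ', Module.End.mul_apply]
      change τ g ((A ^ n) f (i - 1)) = _
      rw [ih, ← Module.End.mul_apply, ← map_mul, ← pow_succ']
      congr 2
      push_cast
      ring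
  obtain ⟨m, hm, hgm⟩ := exists_pow_mem_of_mem_compact hK hg
    ((Representation.isSmoothVector_iff _ _).1 (hρ x))
  -- As `g ^ m` fixes `x`, the sequence is `m`-periodic. It is therefore enough that `g ^ n` fixes
  -- `x` and the `m` values of `T` on one period.
  have hU : ∀ᶠ u in 𝓝 (1 : G), ρ u x = x ∧
      ∀ i : Fin m, τ u (T (ρ (g ^ (i : ℤ)) x)) = T (ρ (g ^ (i : ℤ)) x) :=
    ((Representation.isSmoothVector_iff _ _).1 (hρ x)).and
      (Filter.eventually_all.2 fun i => (Representation.isSmoothVector_iff _ _).1 (hτ _))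
  obtain ⟨n, hn, hgn⟩ := exists_pow_mem_of_mem_compact hK hg hU
  have hper : ∀ (n : ℕ), ρ (g ^ n) x = x → ∀ j : ℤ, ρ (g ^ (n * j)) x = x := by
    intro n hgn j
    have h1 : ∀ j : ℕ, ρ (g ^ ((n : ℤ) * j)) x = x := by
      intro j
      induction j with
      | zero => simp
      | succ j ih =>
        rw [show (n : ℤ) * ((j + 1 : ℕ) : ℤ) = n * j + n by push_cast; ring, zpow_add, map_mul,
          Module.End.mul_apply, zpow_natCast g n, hgn, ih]
    obtain ⟨j, rfl | rfl⟩ := j.eq_nat_or_neg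
    · exact h1 j
    · conv_lhs => rw [← h1 j]
      rw [← Module.End.mul_apply, ← map_mul, ← zpow_add]
      simp
  have hfix : (A ^ n) (ev T) = ev T := by
    funext i
    rw [hApow]
    change τ (g ^ n) (T (ρ (g ^ (i - n)) x)) = T (ρ (g ^ i) x)
    have e1 : ρ (g ^ (i - n)) x = ρ (g ^ i) x := by
      have h1 := hper n hgn.1 (-1)
      rw [show i - n = i + n * (-1) by ring, zpow_add, map_mul, Module.End.mul_apply, h1]
    have e2 : ρ (g ^ i) x = ρ (g ^ (i % m)) x := by
      have h1 := hper m hgm (i / m)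
      conv_lhs => rw [← Int.emod_add_mul_ediv i m, zpow_add, map_mul, Module.End.mul_apply, h1]
    rw [e1, e2]
    have hm0 : (m : ℤ) ≠ 0 := Nat.cast_ne_zero.2 hm
    have h0 := Int.emod_nonneg i hm0
    have h1 := Int.emod_lt_of_pos i (b := m) (by omega)
    have := hgn.2 ⟨(i % m).toNat, by omega⟩
    rwa [Fin.val_mk, Int.toNat_of_nonneg h0] at this
  have hz : ((A - 1) ^ (k + 1)) (ev T) = 0 := by
    rw [← hpow, Representation.genInvariants_pow hT g, map_zero]
  have hfin := congrFun (apply_eq_self_of_unipotent_of_finite_order hn hz hfix) 0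
  rw [← hev] at hfin
  change (ρ.linHom τ g T) (ρ (g ^ (0 : ℤ)) x) = T (ρ (g ^ (0 : ℤ)) x) at hfin
  simpa using hfin

/-- The stabilizer of `T` is a subgroup that contains every compact subgroup. -/
theorem linHom_apply_eq_of_mem_compactGen (hρ : ∀ x, ρ.IsSmoothVector x)
    (hτ : ∀ y, τ.IsSmoothVector y) {k : ℕ} {T : X →ₗ[ℂ] Y}
    (hT : T ∈ (ρ.linHom τ).genInvariants k) {g : G} (hg : g ∈ compactGen G) :
    ρ.linHom τ g T = T := by
  let S : Subgroup G :=
    { carrier := {g | ρ.linHom τ g T = T}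
      one_mem' := by
        change ρ.linHom τ 1 T = T
        rw [map_one, Module.End.one_apply]
      mul_mem' := fun {a b} ha hb => by
        change ρ.linHom τ (a * b) T = T
        rw [map_mul, Module.End.mul_apply, hb, ha]
      inv_mem' := fun {a} ha => by
        change ρ.linHom τ a⁻¹ T = T
        conv_lhs => rw [← show ρ.linHom τ a T = T from ha]
        rw [← Module.End.mul_apply, ← map_mul, inv_mul_cancel, map_one, Module.End.one_apply] }
  have : compactGen G ≤ S := sSup_le fun K hK x hx =>
    linHom_apply_eq_of_mem_compact hρ hτ hT hK hx
  exact this hg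

end CompactElements

/-! ### The universal property of `J_{G,k}` -/

section JSpaceAction

variable {G : Type} [Group G] [TopologicalSpace G] [IsLGroup G]

theorem JSpace.induction {k : ℕ} {p : JSpace G k → Prop} (h0 : p 0)
    (hadd : ∀ a b, p a → p b → p (a + b)) (hsmul : ∀ (c : ℂ) a, p a → p (c • a))
    (hof : ∀ g : G, p (JSpace.of G k g)) (a : JSpace G k) : p a := by
  obtain ⟨a, rfl⟩ := Submodule.Quotient.mk_surjective _ a
  induction a using MonoidAlgebra.induction_linear with
  | zero => exact h0
  | add a b ha hb => exact hadd _ _ ha hb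
  | single q r =>
    obtain ⟨g, rfl⟩ := QuotientGroup.mk_surjective q
    have : (Submodule.Quotient.mk (MonoidAlgebra.single (g : Lam G) r) : JSpace G k) =
        r • JSpace.of G k g := by
      rw [JSpace.of, ← Submodule.Quotient.mk_smul, MonoidAlgebra.of_apply,
        MonoidAlgebra.smul_single, smul_eq_mul, mul_one]
    rw [this]
    exact hsmul _ _ (hof g)

theorem JSpace.linearMap_ext {k : ℕ} {M : Type*} [AddCommGroup M] [Module ℂ M]
    {f f' : JSpace G k →ₗ[ℂ] M} (h : ∀ g, f (JSpace.of G k g) = f' (JSpace.of G k g)) : f = f' := by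
  refine LinearMap.ext fun a => ?_
  induction a using JSpace.induction with
  | h0 => simp only [map_zero]
  | hadd a b ha hb => simp only [map_add, ha, hb]
  | hsmul c a ha => simp only [map_smul, ha]
  | hof g => exact h g

/-- A product of `k + 1` factors `g - 1` lies in `I_G ^ (k + 1)`, which is zero in `J_{G,k}`. -/
theorem JSpace.of_one_mem_genInvariants (k : ℕ) :
    JSpace.of G k 1 ∈ (SmoothRep.J G k).obj.ρ.genInvariants k := by
  intro g
  have aug : ∀ g : G, MonoidAlgebra.of ℂ (Lam G) (g : Lam G) - 1 ∈ augIdeal G := by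
    intro g
    rw [augIdeal, RingHom.mem_ker]
    change MonoidAlgebra.lift ℂ ℂ (Lam G) 1 _ = 0
    simp
  have act : ∀ (g : G) (a : MonoidAlgebra ℂ (Lam G)),
      ((SmoothRep.J G k).obj.ρ g - 1) (Submodule.Quotient.mk a : JSpace G k) =
        (Submodule.Quotient.mk ((MonoidAlgebra.of ℂ (Lam G) (g : Lam G) - 1) * a) :
          JSpace G k) := by
    intro g a
    rw [sub_mul, one_mul, Submodule.Quotient.mk_sub]
    rfl
  have key : ∀ (m : ℕ) (g : Fin (m + 1) → G), ∃ a ∈ augIdeal G ^ (m + 1),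
      (List.ofFn fun i => (SmoothRep.J G k).obj.ρ (g i) - 1).prod (JSpace.of G k 1) =
        (Submodule.Quotient.mk a : JSpace G k) := by
    intro m
    induction m with
    | zero =>
      intro g
      refine ⟨(MonoidAlgebra.of ℂ (Lam G) (g 0 : Lam G) - 1) * 1, ?_, ?_⟩
      · rw [Submodule.pow_one, mul_one]
        exact aug _
      · rw [List.ofFn_succ, List.ofFn_zero, List.prod_cons, List.prod_nil, mul_one, ← act]
        rw [JSpace.of, QuotientGroup.mk_one, map_one]
    | succ m ih =>
      intro g
      obtain ⟨a, ha, e⟩ := ih fun i => g i.succ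
      refine ⟨(MonoidAlgebra.of ℂ (Lam G) (g 0 : Lam G) - 1) * a, ?_, ?_⟩
      · rw [Submodule.pow_succ' _ (Nat.succ_ne_zero m)]
        exact Submodule.mul_mem_mul (aug _) ha
      · rw [List.ofFn_succ, List.prod_cons]
        exact (congrArg _ e).trans (act _ _)
  obtain ⟨a, ha, e⟩ := key k g
  rw [e]
  exact (Submodule.Quotient.mk_eq_zero _).2 ha

/-- The map `a ↦ a · T` from `J_{G,k}` attached to a generalized homomorphism `T`. -/
theorem exists_JSpace_action {X : Type} [AddCommGroup X] [Module ℂ X] {Y : Type} [AddCommGroup Y]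
    [Module ℂ Y] {ρ : Representation ℂ G X} {τ : Representation ℂ G Y}
    (hρ : ∀ x, ρ.IsSmoothVector x) (hτ : ∀ y, τ.IsSmoothVector y) {k : ℕ} {T : X →ₗ[ℂ] Y}
    (hT : T ∈ (ρ.linHom τ).genInvariants k) :
    ∃ E : JSpace G k →ₗ[ℂ] (X →ₗ[ℂ] Y), ∀ g, E (JSpace.of G k g) = ρ.linHom τ g T := by
  -- The vectors fixed by `G°`, among which `T` is, form a representation of `Λ_G`. There `T` is
  -- still a generalized invariant, so `I_G ^ (k + 1)` kills it and the orbit map of `T` descends to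
  -- `J_{G,k}`.
  let π := (ρ.linHom τ).quotientToInvariants (compactGen G)
  let T' : Representation.invariants ((ρ.linHom τ).comp (compactGen G).subtype) :=
    ⟨T, fun g => linHom_apply_eq_of_mem_compactGen hρ hτ hT g.2⟩
  have hT' : T' ∈ π.genInvariants k := by
    intro q
    have key : ∀ (l : List G), (((l.map fun g : G => π (QuotientGroup.mk g) - 1).prod T').1 : X →ₗ[ℂ] Y) =
        (l.map fun g : G => ρ.linHom τ g - 1).prod T := by
      intro l
      induction l with
      | nil => rfl
      | cons a l ih =>
        rw [List.map_cons, List.prod_cons, List.map_cons, List.prod_cons, Module.End.mul_apply,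
          Module.End.mul_apply, ← ih]
        rfl
    have h := key (List.ofFn fun i => (q i).out)
    simp only [List.map_ofFn, Function.comp_def, QuotientGroup.out_eq'] at h
    exact Subtype.ext (h.trans (hT _))
  let f : MonoidAlgebra ℂ (Lam G) →ₗ[ℂ] (X →ₗ[ℂ] Y) :=
    Submodule.subtype _ ∘ₗ (LinearMap.applyₗ T') ∘ₗ π.asAlgebraHom.toLinearMap
  have hf : ∀ a ∈ (augIdeal G ^ (k + 1)).restrictScalars ℂ, f a = 0 := by
    intro a ha
    change ((π.asAlgebraHom a T').1 : X →ₗ[ℂ] Y) = 0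
    rw [Representation.asAlgebraHom_genInvariants hT' ha]
    rfl
  refine ⟨((augIdeal G ^ (k + 1)).restrictScalars ℂ).liftQ f hf ∘ₗ
    (Submodule.Quotient.restrictScalarsEquiv ℂ (augIdeal G ^ (k + 1))).symm.toLinearMap,
    fun g => ?_⟩
  change f (MonoidAlgebra.of ℂ (Lam G) (g : Lam G)) = _
  change ((π.asAlgebraHom (MonoidAlgebra.of ℂ (Lam G) (g : Lam G)) T').1 : X →ₗ[ℂ] Y) = _
  rw [Representation.asAlgebraHom_of]
  rfl

end JSpaceAction

/-! ### Invariant forms and the smooth contragredient -/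

section SmoothDual

open TensorProduct

variable {G : Type} [Group G] [TopologicalSpace G] [IsTopologicalGroup G]
  {V : Type} [AddCommGroup V] [Module ℂ V] {X : Type} [AddCommGroup X] [Module ℂ X]
  {ρ : Representation ℂ G V} {τ : Representation ℂ G X}

theorem tprod_isSmoothVector (hρ : ∀ v, ρ.IsSmoothVector v) (hτ : ∀ x, τ.IsSmoothVector x)
    (t : V ⊗[ℂ] X) : (ρ.tprod τ).IsSmoothVector t :=
  ObjectProperty.prop_tensor (P₁ := isSmoothRep G) (P₂ := isSmoothRep G) (Q := isSmoothRep G)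
    (X₁ := Rep.of ρ) (X₂ := Rep.of τ) hρ hτ t

/-- The smooth contragredient. -/
def Representation.smoothDual (ρ : Representation ℂ G V) :
    Representation ℂ G ρ.dual.smoothVectors :=
  ρ.dual.subrepresentation ρ.dual.smoothVectors ρ.dual.smoothVectors_le_comap

theorem Representation.smoothDual_apply (ρ : Representation ℂ G V) (g : G)
    (l : ρ.dual.smoothVectors) (v : V) : (ρ.smoothDual g l).1 v = l.1 (ρ g⁻¹ v) := rfl

theorem Representation.smoothDual_isSmoothVector (ρ : Representation ℂ G V)
    (l : ρ.dual.smoothVectors) : ρ.smoothDual.IsSmoothVector l := by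
  obtain ⟨U, hU⟩ := l.2
  exact ⟨U, fun g hg => Subtype.ext (hU g hg)⟩

/-- An invariant pairing of a smooth representation with `V` takes values in the smooth dual. -/
def smoothDualLift {M : Type} [AddCommGroup M] [Module ℂ M] {μ : Representation ℂ G M}
    (hμ : ∀ m, μ.IsSmoothVector m) (B : V ⊗[ℂ] M →ₗ[ℂ] ℂ)
    (hB : ∀ g t, B (ρ.tprod μ g t) = B t) : M →ₗ[ℂ] ρ.dual.smoothVectors :=
  (TensorProduct.curry B).flip.codRestrict _ (fun m => by
    obtain ⟨U, hU⟩ := hμ m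
    refine ⟨U, fun g hg => LinearMap.ext fun v => ?_⟩
    have := hB g (ρ g⁻¹ v ⊗ₜ m)
    rw [Representation.tprod_apply, TensorProduct.map_tmul, hU g hg] at this
    change B (ρ g⁻¹ v ⊗ₜ m) = B (v ⊗ₜ m)
    rw [← this]
    simp)

theorem smoothDualLift_apply {M : Type} [AddCommGroup M] [Module ℂ M] {μ : Representation ℂ G M}
    (hμ : ∀ m, μ.IsSmoothVector m) (B : V ⊗[ℂ] M →ₗ[ℂ] ℂ)
    (hB : ∀ g t, B (ρ.tprod μ g t) = B t) (m : M) (v : V) :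
    (smoothDualLift hμ B hB m).1 v = B (v ⊗ₜ m) := rfl

theorem smoothDualLift_equivariant {M : Type} [AddCommGroup M] [Module ℂ M]
    {μ : Representation ℂ G M} (hμ : ∀ m, μ.IsSmoothVector m) (B : V ⊗[ℂ] M →ₗ[ℂ] ℂ)
    (hB : ∀ g t, B (ρ.tprod μ g t) = B t) (g : G) (m : M) :
    smoothDualLift hμ B hB (μ g m) = ρ.smoothDual g (smoothDualLift hμ B hB m) := by
  refine Subtype.ext (LinearMap.ext fun v => ?_)
  rw [Representation.smoothDual_apply, smoothDualLift_apply, smoothDualLift_apply,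
    ← hB g (ρ g⁻¹ v ⊗ₜ m), Representation.tprod_apply, TensorProduct.map_tmul]
  simp

end SmoothDual

section InvariantForms

open TensorProduct

variable {G : Type} [Group G] [TopologicalSpace G] [IsLGroup G]
  {V : Type} [AddCommGroup V] [Module ℂ V] {X : Type} [AddCommGroup X] [Module ℂ X]
  {ρ : Representation ℂ G V} {τ : Representation ℂ G X}

/-- The action of `G` on `J_{G,k}`. -/
def JRep (G : Type) [Group G] [TopologicalSpace G] [IsLGroup G] (k : ℕ) :
    Representation ℂ G (JSpace G k) := (SmoothRep.J G k).obj.ρ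

theorem JRep_of (k : ℕ) (g x : G) : JRep G k g (JSpace.of G k x) = JSpace.of G k (g * x) :=
  SmoothRep.J_apply G k g x

theorem JRep_isSmoothVector (k : ℕ) (a : JSpace G k) : (JRep G k).IsSmoothVector a :=
  (SmoothRep.J G k).property a

/-- The space of generalized homomorphisms between two representations. -/
abbrev genHomSpace {Y : Type} [AddCommGroup Y] [Module ℂ Y] (τ : Representation ℂ G X)
    (τ' : Representation ℂ G Y) (k : ℕ) : Submodule ℂ (X →ₗ[ℂ] Y) := (τ.linHom τ').genInvariants k

/-- The class of `1` is a generalized invariant of `J_{G,k}`, and equivariant maps preserve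
generalized invariants. With `exists_equivariant_of_mem_genHomSpace` this identifies `Hom_{G,k}(X,
Y)` with `Hom_G(J_{G,k}, Hom(X, Y))` for smooth `X` and `Y`. -/
theorem mem_genHomSpace_of_equivariant {Y : Type} [AddCommGroup Y] [Module ℂ Y]
    {τ : Representation ℂ G X} {τ' : Representation ℂ G Y} {k : ℕ}
    (F : JSpace G k →ₗ[ℂ] (X →ₗ[ℂ] Y)) (hF : ∀ g a x, F (JRep G k g a) x = τ' g (F a (τ g⁻¹ x))) :
    F (JSpace.of G k 1) ∈ genHomSpace τ τ' k :=
  Representation.genInvariants_le_comap (ρ := JRep G k) F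
    (fun g a => LinearMap.ext fun x => hF g a x) k (JSpace.of_one_mem_genInvariants k)

theorem exists_equivariant_of_mem_genHomSpace {Y : Type} [AddCommGroup Y] [Module ℂ Y]
    {τ : Representation ℂ G X} {τ' : Representation ℂ G Y} (hτ : ∀ x, τ.IsSmoothVector x)
    (hτ' : ∀ y, τ'.IsSmoothVector y) {k : ℕ} {T : X →ₗ[ℂ] Y} (hT : T ∈ genHomSpace τ τ' k) :
    ∃ E : JSpace G k →ₗ[ℂ] (X →ₗ[ℂ] Y), E (JSpace.of G k 1) = T ∧
      ∀ g a x, E (JRep G k g a) x = τ' g (E a (τ g⁻¹ x)) := by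
  obtain ⟨E, hE⟩ := exists_JSpace_action hτ hτ' hT
  refine ⟨E, by rw [hE, map_one, Module.End.one_apply], fun g a x => ?_⟩
  have : E ∘ₗ JRep G k g = τ.linHom τ' g ∘ₗ E := JSpace.linearMap_ext fun x => by
    rw [LinearMap.comp_apply, LinearMap.comp_apply, JRep_of, hE, hE, map_mul, Module.End.mul_apply]
  exact LinearMap.congr_fun (LinearMap.congr_fun this a) x

/-- The generalized homomorphism `x ↦ (v ↦ B (v ⊗ (1 ⊗ x)))`. -/
def genForm (hτ : ∀ x, τ.IsSmoothVector x) {k : ℕ} (B : V ⊗[ℂ] (JSpace G k ⊗[ℂ] X) →ₗ[ℂ] ℂ)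
    (hB : ∀ g t, B (ρ.tprod ((JRep G k).tprod τ) g t) = B t) :
    genHomSpace τ ρ.smoothDual k :=
  ⟨TensorProduct.curry (smoothDualLift
      (tprod_isSmoothVector (JRep_isSmoothVector k) hτ) B hB) (JSpace.of G k 1),
    mem_genHomSpace_of_equivariant _ fun g a x => by
        have hs := tprod_isSmoothVector (JRep_isSmoothVector (G := G) k) hτ
        change smoothDualLift hs B hB (JRep G k g a ⊗ₜ x) =
          ρ.smoothDual g (smoothDualLift hs B hB (a ⊗ₜ τ g⁻¹ x))
        rw [← smoothDualLift_equivariant, Representation.tprod_apply, TensorProduct.map_tmul]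
        simp⟩

theorem genForm_apply (hτ : ∀ x, τ.IsSmoothVector x) {k : ℕ}
    (B : V ⊗[ℂ] (JSpace G k ⊗[ℂ] X) →ₗ[ℂ] ℂ)
    (hB : ∀ g t, B (ρ.tprod ((JRep G k).tprod τ) g t) = B t) (x : X) (v : V) :
    ((genForm hτ B hB).1 x).1 v = B (v ⊗ₜ (JSpace.of G k 1 ⊗ₜ x)) := rfl

theorem genForm_congr (hτ : ∀ x, τ.IsSmoothVector x) {k : ℕ}
    {B B' : V ⊗[ℂ] (JSpace G k ⊗[ℂ] X) →ₗ[ℂ] ℂ} (h : B = B')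
    (hB : ∀ g t, B (ρ.tprod ((JRep G k).tprod τ) g t) = B t)
    (hB' : ∀ g t, B' (ρ.tprod ((JRep G k).tprod τ) g t) = B' t) :
    genForm hτ B hB = genForm hτ B' hB' := by
  subst h
  rfl

/-- Extend `T` to a `G`-map `E` from `J_{G,k}` and pair: `B (v ⊗ a ⊗ x) = ⟨E a x, v⟩`. -/
theorem genForm_surjective (hτ : ∀ x, τ.IsSmoothVector x) {k : ℕ}
    (T : genHomSpace τ ρ.smoothDual k) :
    ∃ (B : V ⊗[ℂ] (JSpace G k ⊗[ℂ] X) →ₗ[ℂ] ℂ)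
      (hB : ∀ g t, B (ρ.tprod ((JRep G k).tprod τ) g t) = B t), genForm hτ B hB = T := by
  obtain ⟨E, hE, hE'⟩ := exists_equivariant_of_mem_genHomSpace hτ ρ.smoothDual_isSmoothVector T.2
  let B : V ⊗[ℂ] (JSpace G k ⊗[ℂ] X) →ₗ[ℂ] ℂ :=
    TensorProduct.lift ((Submodule.subtype _ ∘ₗ TensorProduct.lift E).flip)
  have hBa : ∀ v a x, B (v ⊗ₜ (a ⊗ₜ x)) = (E a x).1 v := fun _ _ _ => rfl
  have hB : ∀ g t, B (ρ.tprod ((JRep G k).tprod τ) g t) = B t := by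
    intro g
    refine LinearMap.congr_fun (f := B ∘ₗ ρ.tprod ((JRep G k).tprod τ) g) (g := B) ?_
    refine TensorProduct.ext (LinearMap.ext fun v => TensorProduct.ext (LinearMap.ext fun a =>
      LinearMap.ext fun x => ?_))
    change B (ρ g v ⊗ₜ (JRep G k g a ⊗ₜ τ g x)) = B (v ⊗ₜ (a ⊗ₜ x))
    rw [hBa, hBa, hE']
    rw [Representation.smoothDual_apply]
    simp
  refine ⟨B, hB, Subtype.ext (LinearMap.ext fun x => Subtype.ext (LinearMap.ext fun v => ?_))⟩
  rw [genForm_apply, hBa, hE]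

/-- The classes of group elements span `J_{G,k}`, and invariance of `B` moves each of them to the
class of `1`. -/
theorem eq_zero_of_genForm_eq_zero (hτ : ∀ x, τ.IsSmoothVector x) {k : ℕ}
    (B : V ⊗[ℂ] (JSpace G k ⊗[ℂ] X) →ₗ[ℂ] ℂ)
    (hB : ∀ g t, B (ρ.tprod ((JRep G k).tprod τ) g t) = B t) (h : genForm hτ B hB = 0) :
    B = 0 := by
  have h1 : ∀ v x, B (v ⊗ₜ (JSpace.of G k 1 ⊗ₜ x)) = 0 := by
    intro v x
    rw [← genForm_apply hτ B hB, h]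
    rfl
  refine TensorProduct.ext (LinearMap.ext fun v => TensorProduct.ext ?_)
  refine JSpace.linearMap_ext fun g => LinearMap.ext fun x => ?_
  change B (v ⊗ₜ (JSpace.of G k g ⊗ₜ x)) = 0
  have := hB g (ρ g⁻¹ v ⊗ₜ (JSpace.of G k 1 ⊗ₜ τ g⁻¹ x))
  rw [h1, Representation.tprod_apply, TensorProduct.map_tmul, Representation.tprod_apply,
    TensorProduct.map_tmul, JRep_of, mul_one] at this
  simpa using this

end InvariantForms

/-! ### Frobenius reciprocity for generalized homomorphisms -/

section Frobenius

open TensorProduct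

variable {G : Type} [Group G] [TopologicalSpace G] [IsLGroup G] {H : Subgroup G}
  {δ : smoothChar H} {k : ℕ} {V : SmoothRep G} {V₀ : SmoothRep H}

/-- The action of `H` on `J_{G,k} ⊗ V₀`. -/
abbrev twistRep (k : ℕ) (V₀ : SmoothRep H) : Representation ℂ H (JSpace G k ⊗[ℂ] V₀.obj) :=
  Representation.tprod ((JRep G k).comp H.subtype) V₀.obj.ρ

/-- The action of `H` on `V ⊗ (J_{G,k} ⊗ V₀)`. -/
abbrev pairRep (k : ℕ) (V : SmoothRep G) (V₀ : SmoothRep H) :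
    Representation ℂ H (V.obj ⊗[ℂ] (JSpace G k ⊗[ℂ] V₀.obj)) :=
  Representation.tprod (V.obj.ρ.comp H.subtype) (twistRep k V₀)

/-- The inclusion `t ↦ 1 ⊗ t` of `J_{G,k} ⊗ V₀` into `δ ⊗ (J_{G,k} ⊗ V₀)`. -/
def twistIncl (δ : smoothChar H) (k : ℕ) (V₀ : SmoothRep H) :
    JSpace G k ⊗[ℂ] V₀.obj →ₗ[ℂ] ((SmoothRep.twist H δ k).obj V₀).obj :=
  (TensorProduct.lid ℂ (JSpace G k ⊗[ℂ] V₀.obj)).symm.toLinearMap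

theorem twistIncl_surjective (δ : smoothChar H) (k : ℕ) (V₀ : SmoothRep H) :
    Function.Surjective (twistIncl (G := G) δ k V₀) :=
  (TensorProduct.lid ℂ (JSpace G k ⊗[ℂ] V₀.obj)).symm.surjective

theorem twistIncl_equivariant (h : H) (t : JSpace G k ⊗[ℂ] V₀.obj) :
    ((SmoothRep.twist H δ k).obj V₀).obj.ρ h (twistIncl δ k V₀ t) =
      (δ.1 h : ℂ) • twistIncl δ k V₀ (twistRep k V₀ h t) := by
  change ((δ.1 h : ℂ) • (1 : ℂ)) ⊗ₜ[ℂ] (twistRep k V₀ h t) =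
    (δ.1 h : ℂ) • ((1 : ℂ) ⊗ₜ[ℂ] (twistRep k V₀ h t))
  rw [TensorProduct.smul_tmul']

/-- The inclusion of the smooth dual into the full dual. -/
def dualIncl (W : SmoothRep H) : W.dual.obj →ₗ[ℂ] Module.Dual ℂ W.obj :=
  Submodule.subtype W.obj.ρ.dual.smoothVectors

/-- The functional `v ⊗ t ↦ ⟨ψ (1 ⊗ t), v⟩`. -/
def pairing (ψ : (SmoothRep.twist H δ k).obj V₀ ⟶ ((SmoothRep.res H).obj V).dual) :
    V.obj ⊗[ℂ] (JSpace G k ⊗[ℂ] V₀.obj) →ₗ[ℂ] ℂ :=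
  TensorProduct.lift ((dualIncl _ ∘ₗ ψ.hom.hom.toLinearMap ∘ₗ twistIncl δ k V₀ :
    JSpace G k ⊗[ℂ] V₀.obj →ₗ[ℂ] Module.Dual ℂ V.obj).flip)

/-- The twist by `δ` on the source of `ψ` reappears as the target `δ⁻¹` of the pairing. This is the
equivariance required for composing with `Λ`. -/
theorem pairing_equivariant
    (ψ : (SmoothRep.twist H δ k).obj V₀ ⟶ ((SmoothRep.res H).obj V).dual) (h : H)
    (u : V.obj ⊗[ℂ] (JSpace G k ⊗[ℂ] V₀.obj)) :
    pairing ψ (pairRep k V V₀ h u) = charRepresentation (δ⁻¹).1 h (pairing ψ u) := by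
  rw [charRepresentation_inv_apply]
  induction u using TensorProduct.induction_on with
  | zero => simp only [map_zero, mul_zero]
  | add a b ha hb => simp only [map_add, ha, hb, mul_add]
  | tmul v t =>
    have e := twistIncl_equivariant (δ := δ) h t
    have e2 : twistIncl δ k V₀ (twistRep k V₀ h t) =
        ((δ.1 h : ℂ))⁻¹ • ((SmoothRep.twist H δ k).obj V₀).obj.ρ h (twistIncl δ k V₀ t) := by
      rw [e, smul_smul, inv_mul_cancel₀ (Units.ne_zero _), one_smul]
    change (ψ.hom.hom (twistIncl δ k V₀ (twistRep k V₀ h t))).1 (V.obj.ρ h v) = _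
    rw [e2, map_smul, Rep.hom_comm_apply]
    change ((δ.1 h : ℂ))⁻¹ * (ψ.hom.hom (twistIncl δ k V₀ t)).1
      (V.obj.ρ ((h⁻¹ : H) : G) (V.obj.ρ h v)) = _
    rw [← Module.End.mul_apply, ← map_mul]
    simp
    rfl

/-- Smoothness of `δ ⊗ J_{G,k} ⊗ V₀` forces the functionals on `V` defined by `ℓ` to be smooth for
`H`. Thus the smooth dual is the right target, and `ψ ↦ pairing ψ` is a bijection onto the
`δ⁻¹`-equivariant functionals. -/
theorem exists_pairing_eq (ℓ : V.obj ⊗[ℂ] (JSpace G k ⊗[ℂ] V₀.obj) →ₗ[ℂ] ℂ)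
    (hℓ : ∀ h u, ℓ (pairRep k V V₀ h u) = charRepresentation (δ⁻¹).1 h (ℓ u)) :
    ∃ ψ : (SmoothRep.twist H δ k).obj V₀ ⟶ ((SmoothRep.res H).obj V).dual, pairing ψ = ℓ := by
  let M := (SmoothRep.twist H δ k).obj V₀
  let e : M.obj →ₗ[ℂ] JSpace G k ⊗[ℂ] V₀.obj :=
    (TensorProduct.lid ℂ (JSpace G k ⊗[ℂ] V₀.obj)).toLinearMap
  have he : ∀ t, e (twistIncl δ k V₀ t) = t := fun t =>
    (TensorProduct.lid ℂ (JSpace G k ⊗[ℂ] V₀.obj)).apply_symm_apply t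
  let B : V.obj ⊗[ℂ] M.obj →ₗ[ℂ] ℂ := ℓ ∘ₗ TensorProduct.map LinearMap.id e
  have hB : ∀ h t, B (Representation.tprod (V.obj.ρ.comp H.subtype) M.obj.ρ h t) = B t := by
    intro h t
    induction t using TensorProduct.induction_on with
    | zero => simp only [map_zero]
    | add a b ha hb => simp only [map_add, ha, hb]
    | tmul v m =>
      obtain ⟨t, rfl⟩ := twistIncl_surjective δ k V₀ m
      have h1 : B (Representation.tprod (V.obj.ρ.comp H.subtype) M.obj.ρ h
          (v ⊗ₜ twistIncl δ k V₀ t)) =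
          ℓ (V.obj.ρ h v ⊗ₜ e (M.obj.ρ h (twistIncl δ k V₀ t))) := rfl
      have h2 : B (v ⊗ₜ twistIncl δ k V₀ t) = ℓ (v ⊗ₜ e (twistIncl δ k V₀ t)) := rfl
      have h3 := hℓ h (v ⊗ₜ t)
      rw [charRepresentation_inv_apply] at h3
      change ℓ (V.obj.ρ h v ⊗ₜ twistRep k V₀ h t) = _ at h3
      rw [h1, h2, he, twistIncl_equivariant, map_smul, he, TensorProduct.tmul_smul, map_smul, h3,
        smul_eq_mul, mul_inv_cancel_left₀ (Units.ne_zero _)]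
  refine ⟨ObjectProperty.homMk (Rep.ofHom ⟨smoothDualLift M.property B hB, fun h => ?_⟩), ?_⟩
  · exact LinearMap.ext fun m => smoothDualLift_equivariant M.property B hB h m
  · refine TensorProduct.ext (LinearMap.ext fun v => LinearMap.ext fun t => ?_)
    change ℓ (v ⊗ₜ e (twistIncl δ k V₀ t)) = ℓ (v ⊗ₜ t)
    rw [he]

theorem pairing_injective :
    Function.Injective (pairing (δ := δ) (k := k) (V := V) (V₀ := V₀)) := by
  intro ψ ψ' h
  refine ObjectProperty.hom_ext _ (Rep.hom_ext ?_)
  ext t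
  obtain ⟨t, rfl⟩ := twistIncl_surjective δ k V₀ t
  refine Subtype.ext (LinearMap.ext fun v => ?_)
  exact LinearMap.congr_fun h (v ⊗ₜ t)

/-- The invariant form `V ⊗ (J_{G,k} ⊗ ind V₀) → ℂ` attached to an invariant functional on
`ind (V ⊗ (J_{G,k} ⊗ V₀))`. -/
def projForm (k : ℕ) (V : SmoothRep G) (V₀ : SmoothRep H) :
    V.obj ⊗[ℂ] (JSpace G k ⊗[ℂ] indSpace H V₀.obj.ρ) ≃ₗ[ℂ] indSpace H (pairRep k V V₀) :=
  (TensorProduct.congr (LinearEquiv.refl ℂ V.obj)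
    (tensorIndEquiv (JRep_isSmoothVector k) V₀.property)).trans
    (tensorIndEquiv (σ := twistRep k V₀) V.property (tprod_isSmoothVector
      ((SmoothRep.res H).obj (SmoothRep.J G k)).property V₀.property))

theorem projForm_tmul_apply (v : V.obj) (a : JSpace G k) (φ : indSpace H V₀.obj.ρ) (x : G) :
    (projForm k V V₀ (v ⊗ₜ (a ⊗ₜ φ))).1 x = V.obj.ρ x v ⊗ₜ (JRep G k x a ⊗ₜ φ.1 x) := rfl

theorem projForm_equivariant (g : G)
    (t : V.obj ⊗[ℂ] (JSpace G k ⊗[ℂ] indSpace H V₀.obj.ρ)) :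
    projForm k V V₀ (V.obj.ρ.tprod ((JRep G k).tprod (indRep V₀.obj.ρ)) g t) =
      indRep _ g (projForm k V V₀ t) := by
  refine LinearMap.congr_fun (f := (projForm k V V₀).toLinearMap ∘ₗ
    V.obj.ρ.tprod ((JRep G k).tprod (indRep V₀.obj.ρ)) g)
    (g := indRep _ g ∘ₗ (projForm k V V₀).toLinearMap) ?_ t
  refine TensorProduct.ext (LinearMap.ext fun v => TensorProduct.ext (LinearMap.ext fun a =>
    LinearMap.ext fun φ => Subtype.ext (funext fun x => ?_)))
  change (projForm k V V₀ (V.obj.ρ g v ⊗ₜ (JRep G k g a ⊗ₜ indRep V₀.obj.ρ g φ))).1 x =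
    (projForm k V V₀ (v ⊗ₜ (a ⊗ₜ φ))).1 (x * g)
  rw [projForm_tmul_apply, projForm_tmul_apply, map_mul, map_mul]
  rfl

variable (Λ : indSpace H (charRepresentation (δ⁻¹).1) →ₗ[ℂ] ℂ)

/-- The invariant form attached to an `H`-homomorphism. -/
def frobForm (ψ : (SmoothRep.twist H δ k).obj V₀ ⟶ ((SmoothRep.res H).obj V).dual) :
    V.obj ⊗[ℂ] (JSpace G k ⊗[ℂ] indSpace H V₀.obj.ρ) →ₗ[ℂ] ℂ :=
  liftFunctional Λ (pairing ψ) (pairing_equivariant ψ) ∘ₗ (projForm k V V₀).toLinearMap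

variable {Λ}

theorem liftFunctional_invariant {W : Type} [AddCommGroup W] [Module ℂ W]
    {σ : Representation ℂ H W} (hΛ : IsInvariantFunctional Λ) (ℓ : W →ₗ[ℂ] ℂ)
    (hℓ : ∀ h w, ℓ (σ h w) = charRepresentation (δ⁻¹).1 h (ℓ w)) :
    IsInvariantFunctional (liftFunctional Λ ℓ hℓ) := fun g φ =>
  hΛ g (indSpaceMap ℓ hℓ φ)

theorem frobForm_invariant (hΛ : IsInvariantFunctional Λ)
    (ψ : (SmoothRep.twist H δ k).obj V₀ ⟶ ((SmoothRep.res H).obj V).dual) (g : G)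
    (t : V.obj ⊗[ℂ] (JSpace G k ⊗[ℂ] indSpace H V₀.obj.ρ)) :
    frobForm Λ ψ (V.obj.ρ.tprod ((JRep G k).tprod (indRep V₀.obj.ρ)) g t) = frobForm Λ ψ t := by
  change liftFunctional Λ _ _ (projForm k V V₀ _) = liftFunctional Λ _ _ (projForm k V V₀ _)
  rw [projForm_equivariant]
  exact liftFunctional_invariant hΛ _ _ g _

theorem indRep_isSmoothVector {W : Type} [AddCommGroup W] [Module ℂ W] {σ : Representation ℂ H W}
    (φ : indSpace H σ) : (indRep σ).IsSmoothVector φ := by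
  obtain ⟨U, hU⟩ := indSpace_smooth H σ φ.1 φ.2
  exact ⟨U, fun g hg => Subtype.ext (hU g hg)⟩

/-- At the class of `1`, the factor `JRep G k x` produces the `x̄` of the explicit formula; this
matches the abstract construction with the prescribed one. -/
theorem frobForm_apply (ψ : (SmoothRep.twist H δ k).obj V₀ ⟶ ((SmoothRep.res H).obj V).dual)
    (φ : indSpace H V₀.obj.ρ) (v : V.obj) :
    frobForm Λ ψ (v ⊗ₜ (JSpace.of G k 1 ⊗ₜ φ)) = Λ (frobFun ψ φ v) := by
  change Λ (indSpaceMap _ _ (projForm k V V₀ _)) = _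
  congr 1
  refine Subtype.ext (funext fun x => ?_)
  rw [indSpaceMap_apply, projForm_tmul_apply, JRep_of, mul_one]
  rfl

/-- Frobenius reciprocity for generalized homomorphisms, from right to left. -/
def frobInv (hΛ : IsInvariantFunctional Λ) (k : ℕ) (V : SmoothRep G) (V₀ : SmoothRep H) :
    ((SmoothRep.twist H δ k).obj V₀ ⟶ ((SmoothRep.res H).obj V).dual) →ₗ[ℂ]
      genHomSpace (indRep V₀.obj.ρ) V.obj.ρ.smoothDual k where
  toFun ψ := genForm indRep_isSmoothVector (frobForm Λ ψ) (frobForm_invariant hΛ ψ)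
  map_add' ψ ψ' := by
    refine Subtype.ext (LinearMap.ext fun φ => Subtype.ext (LinearMap.ext fun v => ?_))
    change frobForm Λ (ψ + ψ') (v ⊗ₜ (JSpace.of G k 1 ⊗ₜ φ)) =
      frobForm Λ ψ (v ⊗ₜ (JSpace.of G k 1 ⊗ₜ φ)) + frobForm Λ ψ' (v ⊗ₜ (JSpace.of G k 1 ⊗ₜ φ))
    rw [frobForm_apply, frobForm_apply, frobForm_apply, ← map_add]
    rfl
  map_smul' c ψ := by
    refine Subtype.ext (LinearMap.ext fun φ => Subtype.ext (LinearMap.ext fun v => ?_))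
    change frobForm Λ (c • ψ) (v ⊗ₜ (JSpace.of G k 1 ⊗ₜ φ)) =
      c • frobForm Λ ψ (v ⊗ₜ (JSpace.of G k 1 ⊗ₜ φ))
    rw [frobForm_apply, frobForm_apply, ← map_smul]
    rfl

theorem frobInv_apply (hΛ : IsInvariantFunctional Λ)
    (ψ : (SmoothRep.twist H δ k).obj V₀ ⟶ ((SmoothRep.res H).obj V).dual)
    (φ : indSpace H V₀.obj.ρ) (v : V.obj) :
    ((frobInv hΛ k V V₀ ψ).1 φ).1 v = Λ (frobFun ψ φ v) :=
  frobForm_apply ψ φ v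

theorem pairRep_isSmoothVector (u : V.obj ⊗[ℂ] (JSpace G k ⊗[ℂ] V₀.obj)) :
    (pairRep k V V₀).IsSmoothVector u :=
  tprod_isSmoothVector ((SmoothRep.res H).obj V).property (tprod_isSmoothVector
    ((SmoothRep.res H).obj (SmoothRep.J G k)).property V₀.property) u

/-- Each stage is injective: forms to generalized homomorphisms, equivariant functionals to
invariant ones, and homomorphisms to pairings. The projection formula allows the middle stage to be
tested on all of the induced space. -/
theorem frobInv_injective (hΛ : IsInvariantFunctional Λ) (h0 : Λ ≠ 0) :
    Function.Injective (frobInv hΛ k V V₀) := by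
  rw [injective_iff_map_eq_zero]
  intro ψ hψ
  have h1 := eq_zero_of_genForm_eq_zero indRep_isSmoothVector _ (frobForm_invariant hΛ ψ) hψ
  have h2 : liftFunctional Λ (pairing ψ) (pairing_equivariant ψ) = 0 := by
    refine LinearMap.ext fun t => ?_
    obtain ⟨t, rfl⟩ := (projForm k V V₀).surjective t
    exact LinearMap.congr_fun h1 t
  apply pairing_injective
  rw [eq_zero_of_liftFunctional_eq_zero pairRep_isSmoothVector hΛ h0 _ _ h2]
  refine TensorProduct.ext (LinearMap.ext fun v => LinearMap.ext fun t => ?_)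
  rfl

theorem comp_projForm_symm_invariant
    (B : V.obj ⊗[ℂ] (JSpace G k ⊗[ℂ] indSpace H V₀.obj.ρ) →ₗ[ℂ] ℂ)
    (hB : ∀ g t, B (V.obj.ρ.tprod ((JRep G k).tprod (indRep V₀.obj.ρ)) g t) = B t) :
    IsInvariantFunctional (B ∘ₗ (projForm k V V₀).symm.toLinearMap) := by
  intro g φ
  obtain ⟨t, rfl⟩ := (projForm k V V₀).surjective φ
  rw [← projForm_equivariant]
  simp only [LinearMap.comp_apply, LinearEquiv.coe_coe, LinearEquiv.symm_apply_apply]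
  exact hB g t

/-- Go back through the stages: `T` comes from an invariant form, which the projection formula makes
an invariant functional on an induced space, hence one of the form `Λ (ℓ ∘ ·)`; and `ℓ` is the
pairing of some `ψ`. -/
theorem frobInv_surjective (hΛ : IsInvariantFunctional Λ) (h0 : Λ ≠ 0) :
    Function.Surjective (frobInv hΛ k V V₀) := by
  intro T
  obtain ⟨B, hB, hT⟩ := genForm_surjective indRep_isSmoothVector T
  obtain ⟨ℓ, hℓ, e⟩ := exists_liftFunctional_eq pairRep_isSmoothVector hΛ h0 _
    (comp_projForm_symm_invariant B hB)
  obtain ⟨ψ, hψ⟩ := exists_pairing_eq ℓ hℓ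
  subst hψ
  have : frobForm Λ ψ = B := LinearMap.ext fun t =>
    (LinearMap.congr_fun e (projForm k V V₀ t)).trans
      (congrArg B ((projForm k V V₀).symm_apply_apply t))
  exact ⟨ψ, (genForm_congr _ this _ _).trans hT⟩

end Frobenius

/-! ### Naturality of Frobenius reciprocity -/

section FrobeniusIso

variable {G : Type} [Group G] [TopologicalSpace G] [IsLGroup G] {H : Subgroup G}
  {δ : smoothChar H}

/-- The linear functional underlying an element of `Hom_G(ind_H^G δ⁻¹, ℂ)`. -/
def IndFunctional.toFunctional (Λ : IndFunctional H δ) :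
    indSpace H (charRepresentation (δ⁻¹).1) →ₗ[ℂ] ℂ := Λ.hom.hom.toLinearMap

theorem IndFunctional.invariant (Λ : IndFunctional H δ) :
    IsInvariantFunctional Λ.toFunctional := fun g φ =>
  Rep.hom_comm_apply Λ.hom g φ

theorem IndFunctional.toFunctional_injective :
    Function.Injective (IndFunctional.toFunctional (H := H) (δ := δ)) := by
  intro Λ Λ' h
  refine ObjectProperty.hom_ext _ (Rep.hom_ext ?_)
  ext φ
  exact LinearMap.congr_fun h φ

theorem IndFunctional.toFunctional_ne_zero {Λ : IndFunctional H δ} (h : Λ ≠ 0) :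
    Λ.toFunctional ≠ 0 := fun h0 => h (IndFunctional.toFunctional_injective h0)

/-- An invariant linear functional as an element of `Hom_G(ind_H^G δ⁻¹, ℂ)`. -/
def IndFunctional.ofFunctional (T : indSpace H (charRepresentation (δ⁻¹).1) →ₗ[ℂ] ℂ)
    (hT : IsInvariantFunctional T) : IndFunctional H δ :=
  ObjectProperty.homMk (Rep.ofHom ⟨T, fun g => LinearMap.ext fun φ => hT g φ⟩)

theorem frobFun_precomp {k : ℕ} {V : SmoothRep G} {V₀ V₀' : SmoothRep H} (f : V₀' ⟶ V₀)
    (ψ : (SmoothRep.twist H δ k).obj V₀ ⟶ ((SmoothRep.res H).obj V).dual)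
    (φ : indSpace H V₀'.obj.ρ) (v : V.obj) :
    frobFun ((SmoothRep.twist H δ k).map f ≫ ψ) φ v =
      frobFun ψ (((SmoothRep.ind H).map f).hom.hom φ) v := rfl

/-- The transpose of `f` moves onto `v`, and `f` commutes with the action of `G`, not just with that
of `H`. Naturality in `V` reduces to this, and naturality in `V₀` to `frobFun_precomp`. -/
theorem frobFun_postcomp {k : ℕ} {V V' : SmoothRep G} {V₀ : SmoothRep H} (f : V' ⟶ V)
    (ψ : (SmoothRep.twist H δ k).obj V₀ ⟶ ((SmoothRep.res H).obj V).dual)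
    (φ : indSpace H V₀.obj.ρ) (v : V'.obj) :
    frobFun (ψ ≫ SmoothRep.dualMap ((SmoothRep.res H).map f)) φ v =
      frobFun ψ φ (f.hom.hom v) := by
  refine Subtype.ext (funext fun x => ?_)
  change (ψ.hom.hom _).1 (f.hom.hom (V'.obj.ρ x v)) = (ψ.hom.hom _).1 (V.obj.ρ x (f.hom.hom v))
  rw [Rep.hom_comm_apply]

/-- The components of the Frobenius reciprocity. -/
def frobComponent {Λ : IndFunctional H δ} (hΛ : Λ ≠ 0) (k : ℕ) (V : (SmoothRep G)ᵒᵖ)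
    (V₀ : (SmoothRep H)ᵒᵖ) :
    ((frobRight H δ k).obj V).obj V₀ ≅ ((frobLeft H k).obj V).obj V₀ :=
  LinearEquiv.toModuleIso (LinearEquiv.ofBijective (frobInv Λ.invariant k V.unop V₀.unop)
      ⟨frobInv_injective _ (IndFunctional.toFunctional_ne_zero hΛ),
        frobInv_surjective _ (IndFunctional.toFunctional_ne_zero hΛ)⟩)

theorem frobComponent_apply {Λ : IndFunctional H δ} (hΛ : Λ ≠ 0) (k : ℕ) (V : (SmoothRep G)ᵒᵖ)
    (V₀ : (SmoothRep H)ᵒᵖ)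
    (ψ : (SmoothRep.twist H δ k).obj V₀.unop ⟶ ((SmoothRep.res H).obj V.unop).dual)
    (φ : indSpace H V₀.unop.obj.ρ) (v : V.unop.obj) :
    (((frobComponent hΛ k V V₀).hom.hom ψ).1 φ).1 v = Λ.toFunctional (frobFun ψ φ v) :=
  frobInv_apply Λ.invariant ψ φ v

theorem frobComponent_ext {k : ℕ} {V : (SmoothRep G)ᵒᵖ} {V₀ : (SmoothRep H)ᵒᵖ}
    {T T' : ((frobLeft H k).obj V).obj V₀}
    (h : ∀ (φ : indSpace H V₀.unop.obj.ρ) (v : V.unop.obj), (T.1 φ).1 v = (T'.1 φ).1 v) : T = T' :=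
  Subtype.ext (LinearMap.ext fun φ => Subtype.ext (LinearMap.ext fun v => h φ v))

theorem frobComponent_naturality_right {Λ : IndFunctional H δ} (hΛ : Λ ≠ 0) (k : ℕ)
    (V : (SmoothRep G)ᵒᵖ) {V₀ V₀' : (SmoothRep H)ᵒᵖ} (f : V₀ ⟶ V₀') :
    ((frobRight H δ k).obj V).map f ≫ (frobComponent hΛ k V V₀').hom =
      (frobComponent hΛ k V V₀).hom ≫ ((frobLeft H k).obj V).map f := by
  refine ModuleCat.hom_ext (LinearMap.ext fun ψ => frobComponent_ext fun φ v => ?_)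
  refine (frobComponent_apply hΛ k V V₀' ((SmoothRep.twist H δ k).map f.unop ≫ ψ) φ v).trans ?_
  refine (congrArg Λ.toFunctional (frobFun_precomp (k := k) (V := V.unop) f.unop ψ φ v)).trans ?_
  exact (frobComponent_apply hΛ k V V₀ ψ (((SmoothRep.ind H).map f.unop).hom.hom φ) v).symm

theorem frobComponent_naturality_left {Λ : IndFunctional H δ} (hΛ : Λ ≠ 0) (k : ℕ)
    {V V' : (SmoothRep G)ᵒᵖ} (f : V ⟶ V') (V₀ : (SmoothRep H)ᵒᵖ) :
    ((frobRight H δ k).map f).app V₀ ≫ (frobComponent hΛ k V' V₀).hom =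
      (frobComponent hΛ k V V₀).hom ≫ ((frobLeft H k).map f).app V₀ := by
  refine ModuleCat.hom_ext (LinearMap.ext fun ψ => frobComponent_ext fun φ v => ?_)
  refine (frobComponent_apply hΛ k V' V₀
    (ψ ≫ SmoothRep.dualMap ((SmoothRep.res H).map f.unop)) φ v).trans ?_
  refine (congrArg Λ.toFunctional (frobFun_postcomp (k := k) (V₀ := V₀.unop) f.unop ψ φ v)).trans ?_
  exact (frobComponent_apply hΛ k V V₀ ψ φ (f.unop.hom.hom v)).symm

/-- Frobenius reciprocity for generalized homomorphisms. -/
def frobIso {Λ : IndFunctional H δ} (hΛ : Λ ≠ 0) (k : ℕ) : frobLeft H k ≅ frobRight H δ k :=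
  Iso.symm (NatIso.ofComponents (fun V => NatIso.ofComponents (fun V₀ => frobComponent hΛ k V V₀)
    (fun f => frobComponent_naturality_right hΛ k V f))
    (fun f => NatTrans.ext (funext fun V₀ => frobComponent_naturality_left hΛ k f V₀)))

theorem isFrobenius_frobIso {Λ : IndFunctional H δ} (hΛ : Λ ≠ 0) (k : ℕ) :
    IsFrobenius Λ (frobIso hΛ k) := fun V V₀ ψ φ v =>
  frobComponent_apply hΛ k (op V) (op V₀) ψ φ v

end FrobeniusIso

/-! ### Exactness of tensor products and of induction -/

theorem SmoothRep.epi_of_surjective {G : Type} [Group G] [TopologicalSpace G]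
    {X Y : SmoothRep G} (f : X ⟶ Y)
    (hf : Function.Surjective f.hom.hom) : Epi f := by
  have : Epi ((isSmoothRep G).ι.map f) := (Rep.epi_iff_surjective f.hom).2 hf
  exact (isSmoothRep G).ι.epi_of_epi_map this

section Exactness

variable {G : Type} [Group G] [TopologicalSpace G] [IsTopologicalGroup G]

instance : (isSmoothRep G).ι.PreservesHomology where
  preservesKernels _ _ f := (isSmoothRep G).preservesKernels_ι f
  preservesCokernels _ _ f := (isSmoothRep G).preservesCokernels_ι f

/-- The inclusion into all representations and the forgetful functor to vector spaces are faithful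
and preserve homology, so exactness can be tested on elements. -/
theorem SmoothRep.exact_iff (S : ShortComplex (SmoothRep G)) :
    S.Exact ↔ ∀ y : S.X₂.obj, S.g.hom.hom y = 0 → ∃ x : S.X₁.obj, S.f.hom.hom x = y := by
  rw [← S.exact_map_iff_of_faithful (isSmoothRep G).ι,
    ← (S.map (isSmoothRep G).ι).exact_map_iff_of_faithful
      (forget₂ (Rep.{0} ℂ G) (ModuleCat.{0} ℂ)), ShortComplex.moduleCat_exact_iff]
  rfl

instance SmoothRep.tensorLeft_preservesHomology (X : SmoothRep G) :
    (tensorLeft X).PreservesHomology :=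
  Functor.preservesHomology_of_map_exact _ fun S hS => by
    rw [SmoothRep.exact_iff] at hS ⊢
    have h : Function.Exact S.f.hom.hom.toLinearMap S.g.hom.hom.toLinearMap := by
      intro y
      refine ⟨hS y, ?_⟩
      rintro ⟨x, rfl⟩
      have := congrArg (fun f => f.hom.hom x) S.zero
      exact this
    exact fun y hy => (Module.Flat.lTensor_exact X.obj h y).1 hy

end Exactness

section IndExact

variable {G : Type} [Group G] [TopologicalSpace G] [IsLGroup G] {H : Subgroup G}

/-- A bump lifts to a bump whose value is a chosen preimage of the value at `1`, provided the level
is small enough to fix that preimage. -/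
theorem indSpaceMap_surjective {W : Type} [AddCommGroup W] [Module ℂ W] {W' : Type}
    [AddCommGroup W'] [Module ℂ W'] {σ : Representation ℂ H W} {σ' : Representation ℂ H W'}
    (hσ : ∀ w, σ.IsSmoothVector w) (f : W →ₗ[ℂ] W') (hf : ∀ h w, f (σ h w) = σ' h (f w))
    (hs : Function.Surjective f) : Function.Surjective (indSpaceMap f hf) := by
  choose s hs using hs
  choose U hU hU' using fun w => exists_fixing_openSubgroup hσ (s w)
  intro φ
  refine indSpace_induction U hU (LinearMap.range (indSpaceMap f hf)) ?_ ?_ φ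
  · rintro g _ ⟨φ, rfl⟩
    exact ⟨indRep σ g φ, rfl⟩
  · intro K hK φ hφ hKU
    obtain ⟨ψ, h1, h2⟩ := exists_isBump hK σ (s (φ.1 1)) fun h hh => hU' _ h (hKU hh)
    refine ⟨ψ, (isBump_indSpaceMap f hf h1).ext hφ ?_⟩
    rw [indSpaceMap_apply, h2, hs]

instance SmoothRep.ind_preservesHomology : (SmoothRep.ind H).PreservesHomology :=
  Functor.preservesHomology_of_map_exact _ fun S hS => by
    rw [SmoothRep.exact_iff] at hS ⊢
    intro (φ : indSpace H S.X₂.obj.ρ) hφ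
    let g : S.X₂.obj →ₗ[ℂ] S.X₃.obj := S.g.hom.hom.toLinearMap
    have hg : ∀ x, g (φ.1 x) = 0 := fun x => congrFun (congrArg Subtype.val hφ) x
    -- A function killed by `g` takes its values in `Z`. Exactness in the middle is thus
    -- surjectivity of induction applied to `X₁ → Z`.
    let Z : Submodule ℂ S.X₂.obj := LinearMap.ker g
    have hZ : ∀ h, Z ≤ Z.comap (S.X₂.obj.ρ h) := by
      intro h w hw
      change S.g.hom.hom (S.X₂.obj.ρ h w) = 0
      rw [Rep.hom_comm_apply, show S.g.hom.hom w = 0 from hw, map_zero]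
    let f : S.X₁.obj →ₗ[ℂ] Z := S.f.hom.hom.toLinearMap.codRestrict Z fun x =>
      show S.g.hom.hom (S.f.hom.hom x) = 0 from congrArg (fun f => f.hom.hom x) S.zero
    obtain ⟨ψ, hψ⟩ := indSpaceMap_surjective (σ := S.X₁.obj.ρ)
      (σ' := S.X₂.obj.ρ.subrepresentation Z hZ) S.X₁.property f
      (fun h w => Subtype.ext (Rep.hom_comm_apply S.f.hom h w))
      (fun w => by
        obtain ⟨x, hx⟩ := hS w.1 w.2
        exact ⟨x, Subtype.ext hx⟩)
      ⟨fun x => ⟨φ.1 x, hg x⟩, by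
        obtain ⟨h1, h2, C, hC, hφC⟩ := φ.2
        refine ⟨(IsLocallyConstant.iff_eventually_eq _).2 fun x => ?_,
          fun h x => Subtype.ext (h2 h x), C, hC, fun x hx => hφC fun h => hx (Subtype.ext h)⟩
        filter_upwards [h1.eventually_eq x] with y hy using Subtype.ext hy⟩
    exact ⟨ψ, Subtype.ext (funext fun x => congrArg Subtype.val
      (congrFun (congrArg Subtype.val hψ) x))⟩

end IndExact

/-! ### Derived functors of composites with an exact functor that preserves projectives -/

section DerivedComparison

variable {B C E : Type*} [Category* B] [Category* C] [Category* E]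
  [Abelian B] [Abelian C] [Abelian E] [HasProjectiveResolutions B] [HasProjectiveResolutions C]
  (L : B ⥤ C) [L.Additive] [L.PreservesHomology] [L.PreservesProjectiveObjects]
  (F : C ⥤ E) [F.Additive]

theorem mapProjectiveResolution_π_f_zero {X : B} (P : ProjectiveResolution X) :
    (L.mapProjectiveResolution P).π.f 0 = L.map (P.π.f 0) := by
  rw [Functor.mapProjectiveResolution_π]
  refine (congrArg (fun t => L.map (P.π.f 0) ≫ t)
    (HomologicalComplex.singleMapHomologicalComplex_hom_app_self L (ComplexShape.down ℕ) 0 X)).trans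
    ?_
  refine (congrArg (fun t => L.map (P.π.f 0) ≫ t) (?_ : _ = 𝟙 _)).trans (Category.comp_id _)
  refine (congrArg₂ (fun a b => a ≫ b) (L.map_id _) (rfl : _ = 𝟙 _)).trans (Category.comp_id _)

/-- For `L` exact and preserving projectives, `L_i (L ⋙ F) ≅ L ⋙ L_i F`. -/
def derivedCompIso (i : ℕ) (X : B) :
    ((L ⋙ F).leftDerived i).obj X ≅ (F.leftDerived i).obj (L.obj X) :=
  (projectiveResolution X).isoLeftDerivedObj (L ⋙ F) i ≪≫
    ((L.mapProjectiveResolution (projectiveResolution X)).isoLeftDerivedObj F i).symm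

theorem inv_comp_trans_symm_hom {E : Type*} [Category* E] {X Y A A' : E} (p : X ≅ A) (q : X ≅ A')
    (q' : Y ≅ A') (a : A ⟶ A') (t : A ⟶ Y) (h : p.inv = a ≫ q.inv) (ht : a ≫ q'.inv = t) :
    p.inv ≫ (q ≪≫ q'.symm).hom = t := by
  rw [h, ← ht]
  simp

theorem lift_id_f_zero {X : B} (P Q : ProjectiveResolution X) :
    (ProjectiveResolution.lift (𝟙 X) P Q).f 0 ≫ Q.π.f 0 = P.π.f 0 :=
  (ProjectiveResolution.lift_commutes_zero (𝟙 X) P Q).trans (Category.comp_id _)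

/-- Naturality at the identity of `X`: the identification with the derived functor is compatible
with every comparison of resolutions. Only the degree-zero compatibility with the augmentations is
needed, which is what `IsDerivedFrom` provides. -/
theorem isoLeftDerivedObj_inv_eq {X : B} (P Q : ProjectiveResolution X) (K : B ⥤ E) [K.Additive]
    (i : ℕ) (φ : P.complex ⟶ Q.complex) (hφ : φ.f 0 ≫ Q.π.f 0 = P.π.f 0) :
    (P.isoLeftDerivedObj K i).inv =
      HomologicalComplex.homologyMap ((K.mapHomologicalComplex _).map φ) i ≫
        (Q.isoLeftDerivedObj K i).inv := by
  have h := ProjectiveResolution.isoLeftDerivedObj_inv_naturality (𝟙 X) P Q φ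
    (hφ.trans (Category.comp_id _).symm) K i
  rw [(K.leftDerived i).map_id] at h
  exact (Category.comp_id _).symm.trans h

/-- `derivedCompIso` is built from one chosen resolution. Both `L P` and `L` of the chosen one are
projective resolutions of `L X`, so the map does not depend on that choice nor on the resolution `R`
used for comparison. -/
theorem derivedCompIso_hom_eq (i : ℕ) {X : B} (P : ProjectiveResolution X)
    (R : ProjectiveResolution (L.obj X))
    (α : (L.mapHomologicalComplex _).obj P.complex ⟶ R.complex)
    (hα : α.f 0 ≫ R.π.f 0 = L.map (P.π.f 0)) :
    (P.isoLeftDerivedObj (L ⋙ F) i).inv ≫ (derivedCompIso L F i X).hom =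
      HomologicalComplex.homologyMap ((F.mapHomologicalComplex _).map α) i ≫
        (R.isoLeftDerivedObj F i).inv := by
  have h2 := isoLeftDerivedObj_inv_eq (L.mapProjectiveResolution P) R F i α
    (hα.trans (mapProjectiveResolution_π_f_zero L P).symm)
  have h3 := isoLeftDerivedObj_inv_eq (L.mapProjectiveResolution P)
    (L.mapProjectiveResolution (projectiveResolution X)) F i
    ((L.mapHomologicalComplex _).map (ProjectiveResolution.lift (𝟙 X) _ _))
    ((congrArg (fun t => L.map ((ProjectiveResolution.lift (𝟙 X) P _).f 0) ≫ t)
      (mapProjectiveResolution_π_f_zero L (projectiveResolution X))).trans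
      (((L.map_comp _ _).symm.trans (congrArg L.map (lift_id_f_zero _ _))).trans
        (mapProjectiveResolution_π_f_zero L P).symm))
  exact inv_comp_trans_symm_hom _ _ _ _ _
    (isoLeftDerivedObj_inv_eq P (projectiveResolution X) (L ⋙ F) i
      (ProjectiveResolution.lift (𝟙 X) _ _) (lift_id_f_zero _ _)) (h3.symm.trans h2)

theorem derivedCompIso_hom_eq' (i : ℕ) {X : B} (P : ProjectiveResolution X) :
    (P.isoLeftDerivedObj (L ⋙ F) i).inv ≫ (derivedCompIso L F i X).hom =
      ((L.mapProjectiveResolution P).isoLeftDerivedObj F i).inv := by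
  have h : HomologicalComplex.Hom.f
      (𝟙 ((L.mapHomologicalComplex (ComplexShape.down ℕ)).obj P.complex)) 0 ≫
      (L.mapProjectiveResolution P).π.f 0 = L.map (P.π.f 0) :=
    (Category.id_comp _).trans (mapProjectiveResolution_π_f_zero L P)
  refine (derivedCompIso_hom_eq L F i P (L.mapProjectiveResolution P) (𝟙 _) h).trans ?_
  have h' : HomologicalComplex.Hom.f
      (𝟙 ((L.mapHomologicalComplex (ComplexShape.down ℕ)).obj P.complex)) 0 ≫
      (L.mapProjectiveResolution P).π.f 0 = (L.mapProjectiveResolution P).π.f 0 :=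
    Category.id_comp _
  exact (isoLeftDerivedObj_inv_eq (L.mapProjectiveResolution P) (L.mapProjectiveResolution P) F i
    (𝟙 _) h').symm

/-- Formal core of the naturality statements: a square commutes once it does so after identification
with the homology of resolutions. -/
theorem comp_eq_comp_of_inv_comp {E : Type*} [Category* E] {X X' Y Y' A A' : E} (p : X ≅ A)
    (q : X' ≅ A') (a : A ⟶ A') (f : X ⟶ X') (c : X ⟶ Y) (c' : X' ⟶ Y') (d : A ⟶ Y) (d' : A' ⟶ Y')
    (g : Y ⟶ Y') (h : p.inv ≫ f = a ≫ q.inv) (hd : p.inv ≫ c = d) (hd' : q.inv ≫ c' = d')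
    (h' : d ≫ g = a ≫ d') : f ≫ c' = c ≫ g := by
  rw [← cancel_epi p.inv, reassoc_of% h, reassoc_of% hd, hd', h']

theorem derivedCompIso_naturality (i : ℕ) {X Y : B} (f : X ⟶ Y) :
    ((L ⋙ F).leftDerived i).map f ≫ (derivedCompIso L F i Y).hom =
      (derivedCompIso L F i X).hom ≫ (F.leftDerived i).map (L.map f) := by
  have h1 := ProjectiveResolution.isoLeftDerivedObj_inv_naturality f (projectiveResolution X)
    (projectiveResolution Y) (ProjectiveResolution.lift f _ _)
    (ProjectiveResolution.lift_commutes_zero f _ _) (L ⋙ F) i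
  have h3 := ProjectiveResolution.isoLeftDerivedObj_inv_naturality (L.map f)
    (L.mapProjectiveResolution (projectiveResolution X))
    (L.mapProjectiveResolution (projectiveResolution Y))
    ((L.mapHomologicalComplex _).map (ProjectiveResolution.lift f _ _))
    ((congrArg (fun t => L.map ((ProjectiveResolution.lift f _ _).f 0) ≫ t)
      (mapProjectiveResolution_π_f_zero L (projectiveResolution Y))).trans
      (((L.map_comp _ _).symm.trans
        (congrArg L.map (ProjectiveResolution.lift_commutes_zero f _ _))).trans
        ((L.map_comp _ _).trans (congrArg (fun t => t ≫ L.map f)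
          (mapProjectiveResolution_π_f_zero L (projectiveResolution X)).symm)))) F i
  exact comp_eq_comp_of_inv_comp _ _ _ _ _ _ _ _ _ h1 (derivedCompIso_hom_eq' L F i _)
    (derivedCompIso_hom_eq' L F i _) h3

theorem inv_comp_leftDerived_app {K K₁ : B ⥤ E} [K.Additive] [K₁.Additive] (η : K ⟶ K₁) (i : ℕ)
    {X : B} (P : ProjectiveResolution X) :
    (P.isoLeftDerivedObj K i).inv ≫ (NatTrans.leftDerived η i).app X =
      HomologicalComplex.homologyMap
        ((NatTrans.mapHomologicalComplex η (ComplexShape.down ℕ)).app P.complex) i ≫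
        (P.isoLeftDerivedObj K₁ i).inv := by
  rw [ProjectiveResolution.leftDerived_app_eq η P, Iso.inv_hom_id_assoc]
  rfl

theorem derivedCompIso_naturality_functor {F₁ : C ⥤ E} [F₁.Additive] (η : F ⟶ F₁) (i : ℕ) (X : B) :
    (NatTrans.leftDerived (Functor.whiskerLeft L η) i).app X ≫ (derivedCompIso L F₁ i X).hom =
      (derivedCompIso L F i X).hom ≫ (NatTrans.leftDerived η i).app (L.obj X) :=
  comp_eq_comp_of_inv_comp _ _ _ _ _ _ _ _ _
    (inv_comp_leftDerived_app (Functor.whiskerLeft L η) i (projectiveResolution X))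
    (derivedCompIso_hom_eq' L F i _) (derivedCompIso_hom_eq' L F₁ i _)
    (inv_comp_leftDerived_app η i (L.mapProjectiveResolution (projectiveResolution X)))

variable {D : Type*} [Category* D] [Abelian D] [HasProjectiveResolutions D] {L' : B ⥤ D}
  [L'.Additive] [L'.PreservesHomology] [L'.PreservesProjectiveObjects] {F' : D ⥤ E} [F'.Additive]
  {L F}

/-- The isomorphism of derived functors induced by an isomorphism of composite functors. -/
def derivedIso (θ : L' ⋙ F' ≅ L ⋙ F) (i : ℕ) (X : B) :
    (F'.leftDerived i).obj (L'.obj X) ≅ (F.leftDerived i).obj (L.obj X) :=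
  (derivedCompIso L' F' i X).symm ≪≫
    ⟨(NatTrans.leftDerived θ.hom i).app X, (NatTrans.leftDerived θ.inv i).app X, by
      rw [← NatTrans.comp_app, ← NatTrans.leftDerived_comp, Iso.hom_inv_id, NatTrans.leftDerived_id,
        NatTrans.id_app], by
      rw [← NatTrans.comp_app, ← NatTrans.leftDerived_comp, Iso.inv_hom_id, NatTrans.leftDerived_id,
        NatTrans.id_app]⟩ ≪≫ derivedCompIso L F i X

theorem comp_inv_comp_of_eq {E : Type*} [Category* E] {X X₁ Y Y₁ A A₁ A' : E} (p : X ≅ A)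
    (p₁ : X₁ ≅ A₁) (c : X ≅ Y) (c₁ : X₁ ⟶ Y₁) (b : A ⟶ A') (q : A' ⟶ Y) (l : X ⟶ X₁)
    (t : A ⟶ A₁) (r : A₁ ⟶ Y₁)
    (h : p.inv ≫ c.hom = b ≫ q) (hl : p.inv ≫ l = t ≫ p₁.inv) (hr : p₁.inv ≫ c₁ = r) :
    b ≫ q ≫ c.inv ≫ l ≫ c₁ = t ≫ r := by
  rw [← Category.assoc b, ← h, Category.assoc, Iso.hom_inv_id_assoc, reassoc_of% hl, hr]

/-- Independence of resolutions on both sides, around the computation of the derived transformation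
of `θ` on the resolution `P` itself. -/
theorem isDerivedFrom_derivedIso (θ : L' ⋙ F' ≅ L ⋙ F) (i : ℕ) (X : B) :
    IsDerivedFrom θ.hom i X (derivedIso θ i X).hom := by
  intro P Q R β α hβ hα
  exact comp_inv_comp_of_eq _ _ _ _ _ _ _ _ _ (derivedCompIso_hom_eq L' F' i P Q β hβ)
    (inv_comp_leftDerived_app θ.hom i P) (derivedCompIso_hom_eq L F i P R α hα)

theorem derivedIso_naturality (θ : L' ⋙ F' ≅ L ⋙ F) (i : ℕ) {X Y : B} (f : X ⟶ Y) :
    (F'.leftDerived i).map (L'.map f) ≫ (derivedIso θ i Y).hom =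
      (derivedIso θ i X).hom ≫ (F.leftDerived i).map (L.map f) := by
  dsimp only [derivedIso, Iso.trans_hom, Iso.symm_hom]
  rw [Category.assoc, Category.assoc, ← derivedCompIso_naturality,
    ← NatTrans.naturality_assoc, Iso.eq_inv_comp,
    ← reassoc_of% (derivedCompIso_naturality L' F' i f), Iso.hom_inv_id_assoc]

theorem derivedIso_naturality_functor {F₁ : C ⥤ E} [F₁.Additive] {F₁' : D ⥤ E} [F₁'.Additive]
    (θ : L' ⋙ F' ≅ L ⋙ F) (θ₁ : L' ⋙ F₁' ≅ L ⋙ F₁) (η : F ⟶ F₁) (η' : F' ⟶ F₁')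
    (h : Functor.whiskerLeft L' η' ≫ θ₁.hom = θ.hom ≫ Functor.whiskerLeft L η) (i : ℕ) (X : B) :
    (NatTrans.leftDerived η' i).app (L'.obj X) ≫ (derivedIso θ₁ i X).hom =
      (derivedIso θ i X).hom ≫ (NatTrans.leftDerived η i).app (L.obj X) := by
  dsimp only [derivedIso, Iso.trans_hom, Iso.symm_hom]
  rw [Category.assoc, Category.assoc, ← derivedCompIso_naturality_functor, Iso.eq_inv_comp,
    ← reassoc_of% (derivedCompIso_naturality_functor L' F' η' i X), Iso.hom_inv_id_assoc,
    ← NatTrans.comp_app_assoc, ← NatTrans.leftDerived_comp, h, NatTrans.leftDerived_comp,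
    NatTrans.comp_app_assoc]

attribute [irreducible] derivedIso derivedCompIso

end DerivedComparison

/-! ### The isomorphism of extension groups -/

section ShapiroIso

variable {G : Type} [Group G] [TopologicalSpace G] [IsLGroup G] {H : Subgroup G}
  [IsClosed (H : Set G)] {δ : smoothChar H} {k : ℕ}

instance SmoothRep.twist_preservesHomology : (SmoothRep.twist H δ k).PreservesHomology :=
  Functor.preservesHomology_of_map_exact _ fun _ hS =>
    (hS.map (tensorLeft ((SmoothRep.res H).obj (SmoothRep.J G k)))).map
      (tensorLeft (SmoothRep.ofChar δ))

variable [(SmoothRep.ind H).PreservesProjectiveObjects]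
  [(SmoothRep.twist H δ k).PreservesProjectiveObjects]

/-- The Frobenius reciprocity for fixed `V`, as an isomorphism of covariant functors. -/
def frobOpIso (Θ : frobLeft H k ≅ frobRight H δ k) (V : (SmoothRep G)ᵒᵖ) :
    SmoothRep.twist H δ k ⋙
      ((linearYoneda ℂ (SmoothRep H)).obj ((SmoothRep.res H).obj V.unop).dual).rightOp ≅
    SmoothRep.ind H ⋙ ((SmoothRep.genHom G k).obj V.unop.dual).rightOp :=
  ⟨NatTrans.rightOp (Θ.hom.app V), NatTrans.rightOp (Θ.inv.app V),
    congrArg NatTrans.rightOp (Θ.inv_hom_id_app V), congrArg NatTrans.rightOp (Θ.hom_inv_id_app V)⟩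

attribute [local irreducible] Functor.leftDerived NatTrans.leftDerived

/-- The components of the isomorphism of extension groups. -/
def shapiroComponent (Θ : frobLeft H k ≅ frobRight H δ k) (i : ℕ) (V : (SmoothRep G)ᵒᵖ)
    (V₀ : (SmoothRep H)ᵒᵖ) :
    ((shapiroLeft H k i).obj V).obj V₀ ≅ ((shapiroRight H δ k i).obj V).obj V₀ :=
  -- Contravariant Hom functors are derived as covariant functors into the opposite category;
  -- removing the `op` reverses the arrow, so it runs from `Ext_{G,k}` to `Ext_H`.
  (derivedIso (frobOpIso Θ V) i V₀.unop).unop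

theorem unop_comp_eq_of_comp_eq {E : Type*} [Category* E] {X Y Z W : Eᵒᵖ} {f : X ⟶ Y} {g : Y ⟶ Z}
    {h : X ⟶ W} {l : W ⟶ Z} (e : f ≫ g = h ≫ l) {f' : Y.unop ⟶ X.unop} {g' : Z.unop ⟶ Y.unop}
    {h' : W.unop ⟶ X.unop} {l' : Z.unop ⟶ W.unop} (hf : f' = f.unop) (hg : g' = g.unop)
    (hh : h' = h.unop) (hl : l' = l.unop) : l' ≫ h' = g' ≫ f' := by
  rw [hf, hg, hh, hl]
  exact (congrArg Quiver.Hom.unop e).symm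

theorem shapiroComponent_naturality_right (Θ : frobLeft H k ≅ frobRight H δ k) (i : ℕ)
    (V : (SmoothRep G)ᵒᵖ) {V₀ V₀' : (SmoothRep H)ᵒᵖ} (f : V₀ ⟶ V₀') :
    ((shapiroLeft H k i).obj V).map f ≫ (shapiroComponent Θ i V V₀').hom =
      (shapiroComponent Θ i V V₀).hom ≫ ((shapiroRight H δ k i).obj V).map f := by
  apply unop_comp_eq_of_comp_eq (derivedIso_naturality (frobOpIso Θ V) i f.unop)
  all_goals exact rfl

theorem shapiroComponent_naturality_left (Θ : frobLeft H k ≅ frobRight H δ k) (i : ℕ)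
    {V V' : (SmoothRep G)ᵒᵖ} (f : V ⟶ V') (V₀ : (SmoothRep H)ᵒᵖ) :
    ((shapiroLeft H k i).map f).app V₀ ≫ (shapiroComponent Θ i V' V₀).hom =
      (shapiroComponent Θ i V V₀).hom ≫ ((shapiroRight H δ k i).map f).app V₀ := by
  apply unop_comp_eq_of_comp_eq (derivedIso_naturality_functor (frobOpIso Θ V') (frobOpIso Θ V)
    (NatTrans.rightOp ((SmoothRep.genHom G k).map (SmoothRep.dualMap f.unop)))
    (NatTrans.rightOp ((linearYoneda ℂ (SmoothRep H)).map
      (SmoothRep.dualMap ((SmoothRep.res H).map f.unop))))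
    (congrArg NatTrans.rightOp (Θ.hom.naturality f).symm) i V₀.unop)
  all_goals exact rfl

/-- The isomorphism of extension groups induced by the Frobenius reciprocity. -/
def shapiroIso (Θ : frobLeft H k ≅ frobRight H δ k) (i : ℕ) :
    shapiroLeft H k i ≅ shapiroRight H δ k i :=
  NatIso.ofComponents (fun V => NatIso.ofComponents (fun V₀ => shapiroComponent Θ i V V₀)
    (fun f => shapiroComponent_naturality_right Θ i V f))
    (fun f => NatTrans.ext (funext fun V₀ => shapiroComponent_naturality_left Θ i f V₀))

theorem isInducedBy_shapiroIso (Θ : frobLeft H k ≅ frobRight H δ k) (i : ℕ) :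
    IsInducedBy Θ (shapiroIso Θ i) := fun V V₀ =>
  isDerivedFrom_derivedIso (frobOpIso Θ (op V)) i V₀

end ShapiroIso

/-! ### Induction from the trivial subgroup and its transitivity -/

section Transitivity

variable {G : Type} [Group G] [TopologicalSpace G] {U : Type} [AddCommGroup U] [Module ℂ U]

/-- Over the trivial subgroup the equivariance condition is empty and the support condition is
ordinary compactness. -/
theorem mem_indSpace_bot {σ : Representation ℂ (⊥ : Subgroup G) U} {f : G → U}
    (hf : IsLocallyConstant f) {C : Set G} (hC : IsCompact C) (hfC : Function.support f ⊆ C) :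
    f ∈ indSpace ⊥ σ := by
  refine ⟨hf, fun h g => ?_, C, hC, fun x hx => ⟨1, one_mem _, x, hfC hx, one_mul x⟩⟩
  rw [Subsingleton.elim h 1, map_one, OneMemClass.coe_one, one_mul, Module.End.one_apply]

theorem exists_compact_support_of_mem_indSpace_bot {σ : Representation ℂ (⊥ : Subgroup G) U}
    (f : indSpace ⊥ σ) : ∃ C : Set G, IsCompact C ∧ Function.support f.1 ⊆ C := by
  obtain ⟨-, -, C, hC, h⟩ := f.2
  refine ⟨C, hC, h.trans ?_⟩
  rintro _ ⟨a, ha, c, hc, rfl⟩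
  rw [Subgroup.coe_bot, Set.mem_singleton_iff] at ha
  change a * c ∈ C
  rwa [ha, one_mul]

variable [IsLGroup G] {H : Subgroup G} [hH : IsClosed (H : Set G)]
  (σ : Representation ℂ (⊥ : Subgroup G) U) (τ : Representation ℂ (⊥ : Subgroup H) U)

/-- The function `h ↦ f (h x)` on `H`. -/
def sliceFun (f : indSpace ⊥ σ) (x : G) : indSpace ⊥ τ :=
  ⟨fun h => f.1 (h * x), by
    obtain ⟨C, hC, hfC⟩ := exists_compact_support_of_mem_indSpace_bot f
    have hc : Continuous fun h : H => (h : G) * x := by fun_prop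
    -- Closedness of `H` makes the restriction of a compact support to `Hx` compact.
    refine mem_indSpace_bot (f.2.1.comp_continuous hc)
      (hH.isClosedEmbedding_subtypeVal.isCompact_preimage
        (hC.image (continuous_mul_const x⁻¹))) fun h hh => ?_
    exact ⟨_, hfC hh, by simp⟩⟩

/-- Transitivity of induction from the trivial subgroup: `f ↦ (x ↦ (h ↦ f (h x)))`. -/
def indTrans : indSpace ⊥ σ ≃ₗ[ℂ] indSpace H (indRep τ) where
  toFun f := ⟨fun x => sliceFun σ τ f x, by
    obtain ⟨C, hC, hfC⟩ := exists_compact_support_of_mem_indSpace_bot f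
    obtain ⟨K, hK⟩ := indSpace_smooth ⊥ σ f.1 f.2
    refine ⟨isLocallyConstant_of_right_invariant K fun y k hk => Subtype.ext (funext fun h => ?_),
      fun h g => Subtype.ext (funext fun h' => ?_), C, hC, fun x hx => ?_⟩
    · change f.1 (h * (y * k)) = f.1 (h * y)
      rw [← mul_assoc]
      exact congrFun (hK k hk) _
    · change f.1 (h' * (h * g)) = f.1 ((h' * h : H) * g)
      rw [Subgroup.coe_mul, mul_assoc]
    · by_contra hn
      refine hx (Subtype.ext (funext fun h => not_not.1 fun hne => hn ?_))
      exact ⟨(h : G)⁻¹, inv_mem h.2, h * x, hfC hne, by simp⟩⟩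
  map_add' _ _ := rfl
  map_smul' _ _ := rfl
  invFun Φ := ⟨fun x => (Φ.1 x).1 1, by
    obtain ⟨h1, h2, C, hC, hΦC⟩ := Φ.2
    -- On the compact set `C` the locally constant `Φ` takes finitely many values, each a function
    -- of compact support on `H`. The support of `x ↦ Φ x 1` lies in the product of the union of
    -- these supports with `C`.
    have hfin : (Φ.1 '' C).Finite := by
      have : CompactSpace C := isCompact_iff_compactSpace.1 hC
      have := (h1.comp_continuous (continuous_subtype_val (p := (· ∈ C)))).range_finite
      rwa [Set.range_comp, Subtype.range_coe] at this
    choose D hD hDs using fun f : indSpace ⊥ τ => exists_compact_support_of_mem_indSpace_bot f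
    have hDc : IsCompact (⋃ f ∈ Φ.1 '' C, D f) := hfin.isCompact_biUnion fun f _ => hD f
    refine mem_indSpace_bot (h1.comp fun f : indSpace ⊥ τ => f.1 1)
      ((hDc.image continuous_subtype_val).mul hC) fun x hx => ?_
    have hx0 : x ∈ Function.support Φ.1 := fun h0 => hx (by
      change (Φ.1 x).1 1 = 0
      rw [h0]
      rfl)
    obtain ⟨h, hh, c, hc, rfl⟩ := hΦC hx0
    refine ⟨h, ⟨⟨h, hh⟩, Set.mem_biUnion ⟨c, hc, rfl⟩ (hDs _ fun h0 => hx ?_), rfl⟩, c, hc, rfl⟩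
    have := congrFun (congrArg Subtype.val (h2 ⟨h, hh⟩ c)) 1
    refine this.trans ?_
    change (Φ.1 c).1 (1 * ⟨h, hh⟩) = 0
    rwa [one_mul]⟩
  left_inv f := Subtype.ext (funext fun x => by
    change f.1 ((1 : H) * x) = f.1 x
    rw [OneMemClass.coe_one, one_mul])
  right_inv Φ := Subtype.ext (funext fun x => Subtype.ext (funext fun h => by
    have := congrFun (congrArg Subtype.val (Φ.2.2.1 h x)) 1
    refine this.trans ?_
    change (Φ.1 x).1 (1 * h) = _
    rw [one_mul]))

theorem indTrans_equivariant (g : G) (f : indSpace ⊥ σ) :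
    indTrans (H := H) σ τ (indRep σ g f) = indRep (indRep τ) g (indTrans σ τ f) :=
  Subtype.ext (funext fun x => Subtype.ext (funext fun h => by
    change f.1 (h * x * g) = f.1 (h * (x * g))
    rw [mul_assoc]))

end Transitivity

/-! ### Haar functionals and their modulus characters -/

section Haar

variable (G : Type) [Group G] [TopologicalSpace G] [IsLGroup G]

/-- The trivial one-dimensional representation of the trivial subgroup. -/
abbrev botRep : Representation ℂ (⊥ : Subgroup G) ℂ :=
  charRepresentation ((1 : smoothChar (⊥ : Subgroup G))⁻¹).1

/-- The space of test functions on `G`. -/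
abbrev testSpace : Type := indSpace ⊥ (botRep G)

variable {G}

/-- `G` acts by right translations, so left Haar measure is applied after inverting the argument.
Nonvanishing is seen on the indicator of a compact open subgroup. -/
theorem exists_invariant_functional (G : Type) [Group G] [TopologicalSpace G] [IsLGroup G] :
    ∃ I : testSpace G →ₗ[ℂ] ℂ, IsInvariantFunctional I ∧ I ≠ 0 := by
  classical
  let _ : MeasurableSpace G := borel G
  have _ : BorelSpace G := ⟨rfl⟩
  let μ : MeasureTheory.Measure G := MeasureTheory.Measure.haar
  have hint : ∀ f : testSpace G, MeasureTheory.Integrable (fun x => f.1 x⁻¹) μ := by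
    intro f
    obtain ⟨C, hC, hfC⟩ := exists_compact_support_of_mem_indSpace_bot f
    refine Continuous.integrable_of_hasCompactSupport (f.2.1.continuous.comp continuous_inv) ?_
    exact HasCompactSupport.intro hC.inv fun x hx => not_not.1 fun h => hx (hfC h)
  refine ⟨{ toFun := fun f => ∫ x, f.1 x⁻¹ ∂μ
            map_add' := fun f g => MeasureTheory.integral_add (hint f) (hint g)
            map_smul' := fun c f => MeasureTheory.integral_const_mul c _ }, fun g f => ?_, ?_⟩
  · change ∫ x, f.1 (x⁻¹ * g) ∂μ = ∫ x, f.1 x⁻¹ ∂μ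
    rw [← MeasureTheory.integral_mul_left_eq_self (fun x => f.1 x⁻¹) g⁻¹]
    simp
  · obtain ⟨K, hK, -⟩ := IsLGroup.exists_compact_openSubgroup (G := G) Filter.univ_mem
    have hKo : IsOpen (K : Set G) := K.isOpen
    have hlc : IsLocallyConstant ((K : Set G).indicator (fun _ => (1 : ℂ))) := by
      refine isLocallyConstant_of_right_invariant K fun y k hk => ?_
      have : y * k ∈ (K : Set G) ↔ y ∈ (K : Set G) := Subgroup.mul_mem_cancel_right K.toSubgroup hk
      by_cases h : y ∈ (K : Set G)
      · rw [Set.indicator_of_mem h, Set.indicator_of_mem (this.2 h)]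
      · rw [Set.indicator_of_notMem h, Set.indicator_of_notMem fun h' => h (this.1 h')]
    let f : testSpace G := ⟨(K : Set G).indicator (fun _ => (1 : ℂ)),
      mem_indSpace_bot hlc hK Set.support_indicator_subset⟩
    intro h0
    have h1 : ∫ x, (K : Set G).indicator (fun _ => (1 : ℂ)) x⁻¹ ∂μ = 0 := LinearMap.congr_fun h0 f
    have h2 : (fun x : G => (K : Set G).indicator (fun _ => (1 : ℂ)) x⁻¹) =
        (K : Set G).indicator (fun _ => (1 : ℂ)) := by
      funext x
      have : x⁻¹ ∈ (K : Set G) ↔ x ∈ (K : Set G) := K.toSubgroup.inv_mem_iff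
      by_cases h : x ∈ (K : Set G)
      · rw [Set.indicator_of_mem h, Set.indicator_of_mem (this.2 h)]
      · rw [Set.indicator_of_notMem h, Set.indicator_of_notMem fun h' => h (this.1 h')]
    rw [h2, MeasureTheory.integral_indicator_const _ hKo.measurableSet] at h1
    have h3 : μ (K : Set G) ≠ 0 := (hKo.measure_pos μ ⟨1, one_mem K⟩).ne'
    have h4 : μ (K : Set G) ≠ ⊤ := hK.measure_lt_top.ne
    simp [MeasureTheory.Measure.real, ENNReal.toReal_eq_zero_iff, h3, h4] at h1

theorem charRepresentation_isSmoothVector {H : Subgroup G} (δ : smoothChar H) (z : ℂ) :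
    (charRepresentation δ.1).IsSmoothVector z := (SmoothRep.ofChar δ).property z

/-- Invariant functionals on `ind_H^G δ⁻¹` are unique up to scalars. -/
theorem exists_eq_smul_of_invariant {H : Subgroup G} {δ : smoothChar H}
    {Λ T : indSpace H (charRepresentation (δ⁻¹).1) →ₗ[ℂ] ℂ} (hΛ : IsInvariantFunctional Λ)
    (h0 : Λ ≠ 0) (hT : IsInvariantFunctional T) : ∃ c : ℂ, T = c • Λ := by
  obtain ⟨ℓ, hℓ, rfl⟩ := exists_liftFunctional_eq (charRepresentation_isSmoothVector δ⁻¹) hΛ h0 T hT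
  refine ⟨ℓ 1, LinearMap.ext fun φ => ?_⟩
  have : indSpaceMap ℓ hℓ φ = ℓ 1 • φ := Subtype.ext (funext fun x => by
    change ℓ (φ.1 x) = ℓ 1 • φ.1 x
    rw [smul_eq_mul, mul_comm, ← smul_eq_mul (φ.1 x), ← map_smul, smul_eq_mul, mul_one])
  change Λ (indSpaceMap ℓ hℓ φ) = ℓ 1 • Λ φ
  rw [this, map_smul]

end Haar

section Modulus

variable {G : Type} [Group G] [TopologicalSpace G] [IsLGroup G]

/-- Left translation of test functions. -/
def leftTrans (a : G) : testSpace G →ₗ[ℂ] testSpace G :=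
  (LinearMap.funLeft ℂ ℂ (a⁻¹ * ·)).restrict fun f hf => by
    obtain ⟨C, hC, hfC⟩ := exists_compact_support_of_mem_indSpace_bot ⟨f, hf⟩
    exact mem_indSpace_bot (hf.1.comp_continuous (continuous_const_mul a⁻¹))
      (hC.image (continuous_const_mul a)) fun x hx => ⟨_, hfC hx, by simp⟩

theorem leftTrans_apply (a : G) (f : testSpace G) (x : G) :
    (leftTrans a f).1 x = f.1 (a⁻¹ * x) := rfl

/-- Multiplication of test functions by a character. -/
def mulChar (η : smoothChar G) : testSpace G →ₗ[ℂ] testSpace G :=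
  (LinearMap.mulLeft ℂ (fun x => (η.1 x : ℂ))).restrict fun f hf => by
    obtain ⟨C, hC, hfC⟩ := exists_compact_support_of_mem_indSpace_bot ⟨f, hf⟩
    exact mem_indSpace_bot ((η.2.comp (fun u : ℂˣ => (u : ℂ))).mul hf.1) hC
      fun x hx => hfC fun h => hx (by
        change (η.1 x : ℂ) * f x = 0
        rw [show f x = 0 from h, mul_zero])

/-- Inversion of the argument of test functions. -/
def invTest : testSpace G →ₗ[ℂ] testSpace G :=
  (LinearMap.funLeft ℂ ℂ (fun x => x⁻¹)).restrict fun f hf => by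
    obtain ⟨C, hC, hfC⟩ := exists_compact_support_of_mem_indSpace_bot ⟨f, hf⟩
    exact mem_indSpace_bot (hf.1.comp_continuous continuous_inv) hC.inv
      fun x hx => Set.mem_inv.2 (hfC hx)

theorem testSpace_ext {f g : testSpace G} (h : ∀ x, f.1 x = g.1 x) : f = g :=
  Subtype.ext (funext h)

theorem leftTrans_indRep (a g : G) (f : testSpace G) :
    leftTrans a (indRep (botRep G) g f) = indRep (botRep G) g (leftTrans a f) :=
  testSpace_ext fun x => by
    rw [leftTrans_apply, indRep_apply, indRep_apply, leftTrans_apply, mul_assoc]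

theorem exists_test_bump {K : OpenSubgroup G} (hK : IsCompact (K : Set G)) :
    ∃ φ : testSpace G, IsBump ⊥ K φ.1 ∧ φ.1 1 = 1 :=
  exists_isBump hK _ 1 fun h _ => by
    rw [Subsingleton.elim h 1, (botRep G).map_one, Module.End.one_apply]

theorem leftTrans_bump {K : OpenSubgroup G} {φ : testSpace G} (hφ : IsBump ⊥ K φ.1) {a : G}
    (ha : a ∈ K) : leftTrans a φ = φ := by
  refine IsBump.ext (K := K) ⟨fun y k hk => ?_, fun y hy => ?_⟩ hφ ?_
  · rw [leftTrans_apply, leftTrans_apply, ← mul_assoc, hφ.1 _ _ hk]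
  · obtain ⟨h, hh, k, hk, e⟩ := hφ.2 _ hy
    refine ⟨1, one_mem _, a * k, mul_mem ha hk, ?_⟩
    rw [Subgroup.mem_bot] at hh
    rw [hh, one_mul] at e
    rw [← e, one_mul, mul_inv_cancel_left]
  · have := hφ.1 1 a⁻¹ (inv_mem ha)
    rwa [one_mul, ← mul_one a⁻¹] at this

/-- Left translations act on an invariant functional through a character. -/
theorem exists_modulus {I : testSpace G →ₗ[ℂ] ℂ} (hI : IsInvariantFunctional I) (h0 : I ≠ 0) :
    ∃ c : smoothChar G, ∀ a f, I (leftTrans a f) = c.1 a * I f := by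
  obtain ⟨K, hK, -⟩ := IsLGroup.exists_compact_openSubgroup (G := G) Filter.univ_mem
  obtain ⟨φ, hφ, hφ1⟩ := exists_test_bump hK
  have hφ0 : I φ ≠ 0 := bump_functional_ne_zero hI h0 hK hφ (by rw [hφ1]; exact one_ne_zero)
  have hex : ∀ a : G, ∃ z : ℂ, ∀ f, I (leftTrans a f) = z * I f := by
    intro a
    -- Left translations commute with right ones, so `I ∘ leftTrans a` is again invariant.
    -- Uniqueness up to scalars applies with the trivial subgroup and `δ = 1`.
    obtain ⟨z, hz⟩ := exists_eq_smul_of_invariant (T := I ∘ₗ leftTrans a) hI h0 fun g f => by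
      rw [LinearMap.comp_apply, leftTrans_indRep, hI]
      rfl
    exact ⟨z, fun f => LinearMap.congr_fun hz f⟩
  choose z hz using hex
  have huniq : ∀ {x y : ℂ}, x * I φ = y * I φ → x = y := fun h => mul_right_cancel₀ hφ0 h
  let c : G →* ℂ :=
    { toFun := z
      map_one' := huniq (by
        rw [← hz, one_mul]
        congr 1
        exact testSpace_ext fun x => by rw [leftTrans_apply, inv_one, one_mul])
      map_mul' := fun a b => huniq (by
        rw [← hz, mul_assoc, ← hz, ← hz]
        congr 1
        exact testSpace_ext fun x => by
          simp only [leftTrans_apply, mul_inv_rev, mul_assoc]) }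
  -- The bump at level `K`, the indicator of `K`, is also invariant under left translation by `K`,
  -- and `I` does not vanish on it.
  have hc : ∀ k ∈ K, c.toHomUnits k = 1 := fun k hk => Units.ext (huniq (by
    change z k * I φ = 1 * I φ
    rw [← hz, leftTrans_bump hφ hk, one_mul]))
  exact ⟨⟨c.toHomUnits, isLocallyConstant_of_right_invariant K fun y k hk => by
    rw [map_mul, hc k hk, mul_one]⟩, hz⟩

/-- Functionals on test functions which are equivariant for left translations with respect to a
given character are unique up to scalars. -/
theorem exists_eq_smul_of_left_equivariant {c : smoothChar G} {ℓ T : testSpace G →ₗ[ℂ] ℂ}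
    (hℓ : ∀ a f, ℓ (leftTrans a f) = c.1 a * ℓ f) (h0 : ℓ ≠ 0)
    (hT : ∀ a f, T (leftTrans a f) = c.1 a * T f) : ∃ z : ℂ, T = z • ℓ := by
  -- Inverting the argument and multiplying by `c⁻¹` turns left `c`-equivariance into right
  -- invariance, where uniqueness is known.
  let E : testSpace G →ₗ[ℂ] testSpace G := mulChar c⁻¹ ∘ₗ invTest
  have hE : ∀ a f, E (indRep (botRep G) a f) = (c.1 a : ℂ)⁻¹ • leftTrans a (E f) := by
    intro a f
    refine testSpace_ext fun x => ?_
    change (((c.1 x)⁻¹ : ℂˣ) : ℂ) * f.1 (x⁻¹ * a) =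
      (c.1 a : ℂ)⁻¹ * ((((c.1 (a⁻¹ * x))⁻¹ : ℂˣ) : ℂ) * f.1 (a⁻¹ * x)⁻¹)
    rw [map_mul, map_inv, mul_inv_rev, mul_inv_rev, inv_inv, inv_inv]
    push_cast
    field_simp
  have hsurj : ∀ f, E (invTest (mulChar c f)) = f := fun f => testSpace_ext fun x => by
    change (((c.1 x)⁻¹ : ℂˣ) : ℂ) * ((c.1 x⁻¹⁻¹ : ℂ) * f.1 x⁻¹⁻¹) = f.1 x
    rw [inv_inv, ← mul_assoc, Units.inv_mul, one_mul]
  have hinv : ∀ T : testSpace G →ₗ[ℂ] ℂ, (∀ a f, T (leftTrans a f) = c.1 a * T f) →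
      IsInvariantFunctional (T ∘ₗ E) := by
    intro T hT a f
    rw [LinearMap.comp_apply, hE, map_smul, hT, smul_eq_mul,
      inv_mul_cancel_left₀ (Units.ne_zero _)]
    rfl
  obtain ⟨z, hz⟩ := exists_eq_smul_of_invariant (hinv ℓ hℓ) (fun h => h0 (LinearMap.ext fun f => by
    rw [← hsurj f]
    exact LinearMap.congr_fun h _)) (hinv T hT)
  refine ⟨z, LinearMap.ext fun f => ?_⟩
  rw [← hsurj f]
  exact LinearMap.congr_fun hz _

/-- A vector outside the span is detected by a functional vanishing on the span. Such a functional
is left `c`-equivariant, hence a multiple of `ℓ`, and so it vanishes on `f` after all. -/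
theorem mem_span_of_left_equivariant_eq_zero {c : smoothChar G} {ℓ : testSpace G →ₗ[ℂ] ℂ}
    (hℓ : ∀ a f, ℓ (leftTrans a f) = c.1 a * ℓ f) (h0 : ℓ ≠ 0) {f : testSpace G} (hf : ℓ f = 0) :
    f ∈ Submodule.span ℂ {z : testSpace G | ∃ a f, z = leftTrans a f - (c.1 a : ℂ) • f} := by
  by_contra hn
  obtain ⟨T, hT, hTp⟩ := Submodule.exists_le_ker_of_notMem hn
  obtain ⟨z, rfl⟩ := exists_eq_smul_of_left_equivariant hℓ h0 (T := T) fun a f => by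
    have := hTp (Submodule.subset_span ⟨a, f, rfl⟩)
    rw [LinearMap.mem_ker, map_sub, map_smul, sub_eq_zero] at this
    exact this
  exact hT (by rw [LinearMap.smul_apply, hf, smul_zero])

end Modulus

/-! ### Existence of the character `δ` -/

section ExistsFunctional

variable {G : Type} [Group G] [TopologicalSpace G] [IsLGroup G] (H : Subgroup G)
  [IsClosed (H : Set G)]

/-- There is a character `δ` of `H` for which `ind_H^G δ⁻¹` carries a nonzero invariant
functional. -/
theorem exists_char_invariant_functional : ∃ (δ : smoothChar H)
    (Λ : indSpace H (charRepresentation (δ⁻¹).1) →ₗ[ℂ] ℂ), IsInvariantFunctional Λ ∧ Λ ≠ 0 := by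
  obtain ⟨I, hI, hI0⟩ := exists_invariant_functional G
  obtain ⟨J, hJ, hJ0⟩ := exists_invariant_functional H
  obtain ⟨cG, hcG⟩ := exists_modulus hI hI0
  obtain ⟨d, hd⟩ := exists_modulus hJ hJ0
  let c : smoothChar H := smoothChar.res H cG
  -- With this choice `ℓ` below is left equivariant for `c`, the modulus of `G` restricted to `H`,
  -- and right equivariant for `δ⁻¹`. The first property matches `T`, the second gives the target
  -- `ind δ⁻¹`.
  let δ : smoothChar H := c * d⁻¹
  let ℓ : testSpace H →ₗ[ℂ] ℂ := J ∘ₗ mulChar δ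
  have hℓR : ∀ h f, ℓ (indRep (botRep H) h f) = charRepresentation (δ⁻¹).1 h (ℓ f) := by
    intro h f
    have : mulChar δ (indRep (botRep H) h f) =
        (δ.1 h : ℂ)⁻¹ • indRep (botRep H) h (mulChar δ f) := testSpace_ext fun x => by
      change (δ.1 x : ℂ) * f.1 (x * h) = (δ.1 h : ℂ)⁻¹ * ((δ.1 (x * h) : ℂ) * f.1 (x * h))
      rw [map_mul]
      push_cast
      field_simp
    change J (mulChar δ _) = _
    rw [charRepresentation_inv_apply, this, map_smul, hJ]
    rfl
  have hℓL : ∀ h f, ℓ (leftTrans h f) = c.1 h * ℓ f := by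
    intro h f
    have : mulChar δ (leftTrans h f) = (δ.1 h : ℂ) • leftTrans h (mulChar δ f) :=
      testSpace_ext fun x => by
        change (δ.1 x : ℂ) * f.1 (h⁻¹ * x) = δ.1 h * ((δ.1 (h⁻¹ * x) : ℂ) * f.1 (h⁻¹ * x))
        rw [map_mul, map_inv]
        push_cast
        field_simp
    change J (mulChar δ _) = _
    rw [this, map_smul, hd, smul_eq_mul, ← mul_assoc]
    congr 1
    change ((c.1 h * (d.1 h)⁻¹ : ℂˣ) : ℂ) * d.1 h = c.1 h
    push_cast
    field_simp
  have hℓ0 : ℓ ≠ 0 := fun h => hJ0 (LinearMap.ext fun f => by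
    have : mulChar δ (mulChar δ⁻¹ f) = f := testSpace_ext fun x => by
      change (δ.1 x : ℂ) * ((((δ.1 x)⁻¹ : ℂˣ) : ℂ) * f.1 x) = f.1 x
      rw [← mul_assoc, Units.mul_inv, one_mul]
    rw [← this]
    exact LinearMap.congr_fun h _)
  have hsm : ∀ f, (indRep (botRep H)).IsSmoothVector f := fun f => by
    obtain ⟨U, hU⟩ := indSpace_smooth ⊥ (botRep H) f.1 f.2
    exact ⟨U, fun g hg => Subtype.ext (hU g hg)⟩
  let e := indTrans (H := H) (botRep G) (botRep H)
  let T : indSpace H (indRep (botRep H)) →ₗ[ℂ] ℂ := I ∘ₗ e.symm.toLinearMap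
  have hTe : ∀ f, T (e f) = I f := fun f => congrArg I (e.symm_apply_apply f)
  have hT : IsInvariantFunctional T := by
    intro g Φ
    obtain ⟨f, rfl⟩ := e.surjective Φ
    rw [← indTrans_equivariant]
    exact (hTe _).trans ((hI g f).trans (hTe f).symm)
  have hT0 : T ≠ 0 := fun h => hI0 (LinearMap.ext fun f => by
    rw [← hTe, h]
    rfl)
  -- Left translation in the fibre `S(H)` corresponds under `S(G) = ind S(H)` to left translation by
  -- `h` on `G`, so it scales `T` by `c h`.
  have hTL : ∀ (h : H) Φ, T (indSpaceMap (leftTrans h)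
      (fun g w => leftTrans_indRep h g w) Φ) = c.1 h * T Φ := by
    intro h Φ
    obtain ⟨f, rfl⟩ := e.surjective Φ
    have : indSpaceMap (leftTrans h) (fun g w => leftTrans_indRep h g w) (e f) =
        e (leftTrans (h : G) f) := Subtype.ext (funext fun x => testSpace_ext fun y => by
      change f.1 ((h⁻¹ * y : H) * x) = f.1 ((h : G)⁻¹ * (y * x))
      rw [Subgroup.coe_mul, Subgroup.coe_inv, mul_assoc])
    rw [this, hTe, hTe, hcG]
    rfl
  -- The kernel of `ℓ` is spanned by the vectors `leftTrans h f - c h • f`. A bump with such a value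
  -- is the translate in the fibre of a bump `Ψ` of value `f` minus `c h • Ψ`, so `T` kills it. The
  -- level must be small enough to fix the vectors entering `z`.
  have hker : ∀ z, ℓ z = 0 → ∃ N ∈ 𝓝 (1 : G), ∀ K : OpenSubgroup G, IsCompact (K : Set G) →
      (K : Set G) ⊆ N → ∀ Φ : indSpace H (indRep (botRep H)), IsBump H K Φ.1 → Φ.1 1 = z →
      T Φ = 0 := by
    intro z hz
    refine Submodule.span_induction ?_ ?_ ?_ ?_ (mem_span_of_left_equivariant_eq_zero hℓL hℓ0 hz)
    · rintro _ ⟨h, f, rfl⟩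
      obtain ⟨N, hN, hNf⟩ := exists_fixing_openSubgroup hsm f
      refine ⟨N, hN, fun K hK hKN Φ hΦ h1 => ?_⟩
      obtain ⟨Ψ, hΨ, hΨ1⟩ := exists_isBump hK (indRep (botRep H)) f fun x hx => hNf x (hKN hx)
      have : Φ + (c.1 h : ℂ) • Ψ =
          indSpaceMap (leftTrans h) (fun g w => leftTrans_indRep h g w) Ψ := by
        refine IsBump.ext (hΦ.add (hΨ.smul _)) (isBump_indSpaceMap _ _ hΨ) ?_
        change Φ.1 1 + (c.1 h : ℂ) • Ψ.1 1 = leftTrans h (Ψ.1 1)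
        rw [h1, hΨ1, sub_add_cancel]
      have h2 := congrArg T this
      rw [hTL, map_add, map_smul, smul_eq_mul] at h2
      exact left_eq_add.1 (by rw [add_comm]; exact h2.symm)
    · refine ⟨Set.univ, Filter.univ_mem, fun K _ _ Φ hΦ h1 => ?_⟩
      rw [IsBump.ext (φ := Φ) (ψ := 0) hΦ ⟨fun _ _ _ => rfl, fun y hy => (hy rfl).elim⟩ h1,
        map_zero]
    · rintro f g - - ⟨N, hN, hNf⟩ ⟨N', hN', hNg⟩
      obtain ⟨M, hM, hMf⟩ := exists_fixing_openSubgroup hsm f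
      refine ⟨N ∩ N' ∩ M, Filter.inter_mem (Filter.inter_mem hN hN') hM,
        fun K hK hKN Φ hΦ h1 => ?_⟩
      obtain ⟨Ψ, hΨ, hΨ1⟩ := exists_isBump hK (indRep (botRep H)) f fun x hx => hMf x (hKN hx).2
      have h2 := hNf K hK (fun x hx => (hKN hx).1.1) Ψ hΨ hΨ1
      have h3 := hNg K hK (fun x hx => (hKN hx).1.2) (Φ + (-1 : ℂ) • Ψ) (hΦ.add (hΨ.smul _)) (by
        change Φ.1 1 + (-1 : ℂ) • Ψ.1 1 = g
        rw [h1, hΨ1]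
        module)
      rwa [map_add, map_smul, h2, smul_zero, add_zero] at h3
    · rintro a f - ⟨N, hN, hNf⟩
      obtain ⟨M, hM, hMf⟩ := exists_fixing_openSubgroup hsm f
      refine ⟨N ∩ M, Filter.inter_mem hN hM, fun K hK hKN Φ hΦ h1 => ?_⟩
      obtain ⟨Ψ, hΨ, hΨ1⟩ := exists_isBump hK (indRep (botRep H)) f fun x hx => hMf x (hKN hx).2
      have h2 := hNf K hK (fun x hx => (hKN hx).1) Ψ hΨ hΨ1
      rw [IsBump.ext (φ := Φ) (ψ := a • Ψ) hΦ (hΨ.smul _) (by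
        change Φ.1 1 = a • Ψ.1 1
        rw [h1, hΨ1]), map_smul, h2, smul_zero]
  choose! N hN hNT using hker
  let A := indSpaceMap ℓ hℓR
  -- An element of `ker A` is a function with values in `ker ℓ`, hence a sum of translates of bumps
  -- covered by `hker`. So `T` factors through `A`.
  have hAT : ∀ Φ, A Φ = 0 → T Φ = 0 := by
    intro Φ hΦ
    have hg : ∀ x, ℓ (Φ.1 x) = 0 := fun x => congrFun (congrArg Subtype.val hΦ) x
    let Z : Submodule ℂ (testSpace H) := LinearMap.ker ℓ
    have hZ : ∀ h, Z ≤ Z.comap (indRep (botRep H) h) := by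
      intro h w hw
      change ℓ _ = 0
      rw [hℓR, show ℓ w = 0 from hw, map_zero]
    have hi : ∀ h (w : Z), Z.subtype ((indRep (botRep H)).subrepresentation Z hZ h w) =
        indRep (botRep H) h (Z.subtype w) := fun _ _ => rfl
    let i := indSpaceMap (H := H) (W := Z) (W' := testSpace H) (σ := (indRep (botRep H)).subrepresentation Z hZ)
      (σ' := indRep (botRep H)) Z.subtype hi
    let Φ' : indSpace H (W := Z) ((indRep (botRep H)).subrepresentation Z hZ) :=
      ⟨fun x => (⟨Φ.1 x, hg x⟩ : Z), by
        obtain ⟨h1, h2, C, hC, hφC⟩ := Φ.2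
        refine ⟨(IsLocallyConstant.iff_eventually_eq _).2 fun x => ?_,
          fun h x => Subtype.ext (h2 h x), C, hC, fun x hx => hφC fun h => hx (Subtype.ext h)⟩
        filter_upwards [h1.eventually_eq x] with y hy using Subtype.ext hy⟩
    refine indSpace_induction (fun z : Z => N z.1) (fun z => hN z.1 z.2) (LinearMap.ker (T ∘ₗ i))
      ?_ ?_ Φ'
    · intro g φ hφ
      exact (hT g (i φ)).trans hφ
    · intro K hK φ hφ hKN
      exact hNT (φ.1 1).1 (φ.1 1).2 K hK hKN (i φ) (isBump_indSpaceMap _ _ hφ) rfl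
  have hAs : Function.Surjective A := indSpaceMap_surjective hsm ℓ hℓR
    (LinearMap.surjective hℓ0)
  -- A merely linear section of `A` is enough: `T ∘ s` does not depend on it because `T` vanishes on
  -- `ker A`.
  obtain ⟨s, hs⟩ := A.exists_rightInverse_of_surjective (LinearMap.range_eq_top.2 hAs)
  have hΛ : ∀ Φ, T (s (A Φ)) = T Φ := by
    intro Φ
    rw [← sub_eq_zero, ← map_sub]
    apply hAT
    rw [map_sub, sub_eq_zero]
    exact LinearMap.congr_fun hs (A Φ)
  refine ⟨δ, T ∘ₗ s, fun g φ => ?_, fun h => hT0 (LinearMap.ext fun Φ => ?_)⟩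
  · obtain ⟨Φ, rfl⟩ := hAs φ
    have : indRep (charRepresentation (δ⁻¹).1) g (A Φ) = A (indRep (indRep (botRep H)) g Φ) := rfl
    rw [this]
    exact (hΛ _).trans ((hT g Φ).trans (hΛ Φ).symm)
  · rw [← hΛ]
    exact LinearMap.congr_fun h (A Φ)

end ExistsFunctional

/-! ### Tools for constructing lifts -/

theorem exists_linearMap_finsum {ι V E : Type*} [AddCommGroup V] [Module ℂ V] [AddCommGroup E]
    [Module ℂ E] (D : ι → V →ₗ[ℂ] E) (h : ∀ x, (Function.support fun i => D i x).Finite) :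
    ∃ F : V →ₗ[ℂ] E, ∀ x, F x = ∑ᶠ i, D i x :=
  ⟨{ toFun := fun x => ∑ᶠ i, D i x
     map_add' := fun x y => by
      simp only [map_add]
      exact finsum_add_distrib (h x) (h y)
     map_smul' := fun c x => by
      simp only [map_smul]
      exact (smul_finsum' c (h x)).symm }, fun _ => rfl⟩

section Morphisms

variable {G : Type} [Group G] [TopologicalSpace G]

/-- A smooth representation as an object of the category of smooth representations. -/
abbrev SmoothRep.ofRep {V : Type} [AddCommGroup V] [Module ℂ V] (ρ : Representation ℂ G V)
    (hρ : ∀ v, ρ.IsSmoothVector v) : SmoothRep G := ⟨Rep.of ρ, hρ⟩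

/-- A morphism of smooth representations from an equivariant linear map. -/
def SmoothRep.homOf {X Y : SmoothRep G} (f : X.obj →ₗ[ℂ] Y.obj)
    (hf : ∀ g x, f (X.obj.ρ g x) = Y.obj.ρ g (f x)) : X ⟶ Y :=
  ObjectProperty.homMk (Rep.ofHom ⟨f, fun g => LinearMap.ext fun x => hf g x⟩)

theorem SmoothRep.hom_ext {X Y : SmoothRep G} {f f' : X ⟶ Y}
    (h : ∀ x, f.hom.hom x = f'.hom.hom x) : f = f' :=
  ObjectProperty.hom_ext _ (Rep.hom_ext (by ext x; exact h x))

/-- An isomorphism of smooth representations from an equivariant linear equivalence. -/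
def SmoothRep.isoOf {X Y : SmoothRep G} (e : X.obj ≃ₗ[ℂ] Y.obj)
    (he : ∀ g x, e (X.obj.ρ g x) = Y.obj.ρ g (e x)) : X ≅ Y where
  hom := SmoothRep.homOf e.toLinearMap he
  inv := SmoothRep.homOf e.symm.toLinearMap fun g y => e.injective (by
    obtain ⟨x, rfl⟩ := e.surjective y
    change e (e.symm (Y.obj.ρ g (e x))) = e (X.obj.ρ g (e.symm (e x)))
    rw [e.apply_symm_apply, e.symm_apply_apply, he])
  hom_inv_id := SmoothRep.hom_ext fun x => e.symm_apply_apply x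
  inv_hom_id := SmoothRep.hom_ext fun x => e.apply_symm_apply x

theorem SmoothRep.projective_iff [IsTopologicalGroup G] {X : SmoothRep G} :
    Projective X ↔ ∀ (E Y : SmoothRep G) (f : X ⟶ Y) (e : E ⟶ Y) [Epi e], ∃ F : X.obj →ₗ[ℂ] E.obj,
      (∀ g x, F (X.obj.ρ g x) = E.obj.ρ g (F x)) ∧ ∀ x, e.hom.hom (F x) = f.hom.hom x := by
  constructor
  · intro _ E Y f e _
    refine ⟨(Projective.factorThru f e).hom.hom.toLinearMap, fun g x =>
      Rep.hom_comm_apply (Projective.factorThru f e).hom g x, fun x => ?_⟩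
    have := Projective.factorThru_comp f e
    conv_rhs => rw [← this]
    rfl
  · intro h
    refine ⟨fun {E Y} f e _ => ?_⟩
    obtain ⟨F, hF, hFe⟩ := h _ _ f e
    exact ⟨SmoothRep.homOf F hF, SmoothRep.hom_ext hFe⟩

theorem projective_of_retract {C : Type*} [Category* C] {X Y : C} [Projective Y] (i : X ⟶ Y)
    (r : Y ⟶ X) (h : i ≫ r = 𝟙 X) : Projective X :=
  ⟨fun f e _ => ⟨i ≫ Projective.factorThru (r ≫ f) e, by
    rw [Category.assoc, Projective.factorThru_comp, reassoc_of% h]⟩⟩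

end Morphisms

/-! ### Projectivity of representations induced from compact open subgroups -/

section CompactInduction

variable {G : Type} [Group G] [TopologicalSpace G] [IsLGroup G]

/-- The trivial representation is induced to a projective representation from compact open
subgroups. -/
theorem SmoothRep.projective_ind_compact {L : OpenSubgroup G} (hL : IsCompact (L : Set G)) :
    Projective (SmoothRep.ofRep (indRep (Representation.trivial ℂ L.toSubgroup ℂ))
      indRep_isSmoothVector) := by
  rw [SmoothRep.projective_iff]
  intro E Y f e _
  let σ := Representation.trivial ℂ L.toSubgroup ℂ
  have hinv : ∀ (φ : indSpace L.toSubgroup σ) (x : G), ∀ l ∈ L, φ.1 (l * x) = φ.1 x :=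
    fun φ x l hl => φ.2.2.1 ⟨l, hl⟩ x
  obtain ⟨θ, hθ, hθ1⟩ := exists_isBump hL σ 1 fun _ _ => rfl
  have hθL : ∀ l ∈ L, indRep σ l θ = θ := fun l hl => Subtype.ext (funext fun y => hθ.1 y l hl)
  -- An `L`-fixed lift exists because invariants under the compact group `L` are exact. A map out of
  -- `ind_L^G ℂ` is determined by the image of `θ`, the indicator of `L`, which can be any `L`-fixed
  -- vector.
  obtain ⟨ε, hε, hεL⟩ := SmoothRep.exists_lift_fixed e L.toSubgroup hL (f.hom.hom θ) fun l hl =>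
    (Rep.hom_comm_apply f.hom l θ).symm.trans (congrArg f.hom.hom (hθL l hl))
  -- Expand `φ` in translates of `θ`: it is the sum of `φ x⁻¹` times the translate of `θ` by `x`,
  -- over `x ∈ G / L`. The lift replaces `θ` by `ε`.
  let D : G ⧸ L.toSubgroup → indSpace L.toSubgroup σ →ₗ[ℂ] E.obj := fun q =>
    Quotient.liftOn' q (fun x =>
      { toFun := fun φ => φ.1 x⁻¹ • E.obj.ρ x ε
        map_add' := fun φ ψ => add_smul (φ.1 x⁻¹) (ψ.1 x⁻¹) _
        map_smul' := fun c φ => mul_smul c (φ.1 x⁻¹) _ }) (by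
      intro a b hab
      rw [QuotientGroup.leftRel_apply] at hab
      refine LinearMap.ext fun φ => ?_
      change φ.1 a⁻¹ • E.obj.ρ a ε = φ.1 b⁻¹ • E.obj.ρ b ε
      have h1 : b = a * (a⁻¹ * b) := (mul_inv_cancel_left a b).symm
      have h2 : φ.1 b⁻¹ = φ.1 a⁻¹ := by
        conv_lhs => rw [h1, mul_inv_rev]
        exact hinv φ _ _ (inv_mem hab)
      have h3 : E.obj.ρ b ε = E.obj.ρ a ε := by
        conv_lhs => rw [h1, map_mul, Module.End.mul_apply, hεL _ hab]
      rw [h2, h3])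
  have hD : ∀ (x : G) φ, D (x : G ⧸ L.toSubgroup) φ = φ.1 x⁻¹ • E.obj.ρ x ε := fun _ _ => rfl
  have hfin : ∀ φ, (Function.support fun q => D q φ).Finite := by
    intro φ
    obtain ⟨-, -, C, hC, hφC⟩ := φ.2
    have : DiscreteTopology (G ⧸ L.toSubgroup) := QuotientGroup.discreteTopology L.isOpen
    refine ((hC.inv.image (QuotientGroup.continuous_mk (N := L.toSubgroup))).finite_of_discrete).subset
      fun q hq => ?_
    induction q using QuotientGroup.induction_on with
    | H x =>
      rw [Function.mem_support, hD] at hq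
      obtain ⟨l, hl, c, hc, e⟩ := hφC (left_ne_zero_of_smul hq)
      refine ⟨c⁻¹, Set.inv_mem_inv.2 hc, ?_⟩
      refine QuotientGroup.eq.2 ?_
      have : (c⁻¹)⁻¹ * x = l⁻¹ := by
        rw [← inv_inv x, ← e]
        simp
      rw [this]
      exact inv_mem hl
  obtain ⟨F, hF⟩ := exists_linearMap_finsum D hfin
  have hFg : ∀ g φ, F (indRep σ g φ) = E.obj.ρ g (F φ) := by
    intro g φ
    have h1 := (E.obj.ρ g).toAddMonoidHom.map_finsum (hfin φ)
    rw [hF, hF]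
    refine Eq.trans ?_ h1.symm
    rw [← finsum_comp_equiv (MulAction.toPerm g : Equiv.Perm (G ⧸ L.toSubgroup))]
    refine finsum_congr fun q => ?_
    induction q using QuotientGroup.induction_on with
    | H x =>
      change φ.1 ((g * x)⁻¹ * g) • E.obj.ρ (g * x) ε = E.obj.ρ g (φ.1 x⁻¹ • E.obj.ρ x ε)
      rw [map_smul, ← Module.End.mul_apply, ← map_mul, mul_inv_rev, inv_mul_cancel_right]
  refine ⟨F, hFg, fun φ => ?_⟩
  have hFθ : F θ = ε := by
    rw [hF, finsum_eq_single _ ((1 : G) : G ⧸ L.toSubgroup)]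
    · rw [hD, inv_one, hθ1, one_smul, map_one, Module.End.one_apply]
    · intro q hq
      induction q using QuotientGroup.induction_on with
      | H x =>
        by_contra h0
        rw [hD] at h0
        obtain ⟨h, hh, k, hk, e⟩ := hθ.2 _ (left_ne_zero_of_smul h0)
        refine hq (QuotientGroup.eq.2 ?_)
        rw [mul_one, e]
        exact mul_mem hh hk
  refine indSpace_induction (fun _ => (L : Set G)) (fun _ => L.mem_nhds_one)
    (LinearMap.eqLocus (e.hom.hom.toLinearMap ∘ₗ F) f.hom.hom.toLinearMap) ?_ ?_ φ
  · intro g ψ hψ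
    have hψ' : e.hom.hom (F ψ) = f.hom.hom ψ := hψ
    change e.hom.hom (F (indRep σ g ψ)) = f.hom.hom (indRep σ g ψ)
    rw [hFg, Rep.hom_comm_apply, hψ']
    exact (Rep.hom_comm_apply f.hom g ψ).symm
  · intro K hK ψ hψ hKL
    -- For `K ⊆ L` a `K`-bump is supported in `LK = L`, and left `L`-invariance makes it constant
    -- there.
    have : ψ = ψ.1 1 • θ := by
      refine IsBump.ext (K := L) ⟨fun y k hk => ?_, fun y hy => ?_⟩ (hθ.smul _) ?_
      · have key : ∀ z, z ∈ L → ψ.1 z = ψ.1 1 := fun z hz => by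
          have := hinv ψ 1 z hz
          rwa [mul_one] at this
        have key' : ∀ z, z ∉ L → ψ.1 z = 0 := fun z hz => by
          by_contra h0
          obtain ⟨h, hh, k, hk, rfl⟩ := hψ.2 z h0
          exact hz (mul_mem hh (hKL hk))
        have hiff : y * k ∈ L ↔ y ∈ L := Subgroup.mul_mem_cancel_right L.toSubgroup hk
        by_cases hy : y ∈ L
        · rw [key _ hy, key _ (hiff.2 hy)]
        · rw [key' _ hy, key' _ fun h => hy (hiff.1 h)]
      · obtain ⟨h, hh, k, hk, rfl⟩ := hψ.2 y hy
        exact ⟨h, hh, k, hKL hk, rfl⟩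
      · change ψ.1 1 = ψ.1 1 • θ.1 1
        rw [hθ1, smul_eq_mul, mul_one]
    rw [this]
    refine Submodule.smul_mem _ _ ?_
    change e.hom.hom (F θ) = f.hom.hom θ
    rw [hFθ, hε]

/-- A representation which is approximated by an increasing sequence of projections onto
projective representations is projective. -/
theorem SmoothRep.projective_of_approx {X : SmoothRep G} (P : ℕ → SmoothRep G)
    [∀ n, Projective (P n)] (a : ∀ n, X ⟶ P n) (b : ∀ n, P n ⟶ X)
    (hab : ∀ n, (a n ≫ b n) ≫ a (n + 1) ≫ b (n + 1) = a n ≫ b n)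
    (hfin : ∀ x : X.obj, ∃ N, ∀ n ≥ N, (a n ≫ b n).hom.hom x = x) : Projective X := by
  rw [SmoothRep.projective_iff]
  intro E Y f e _
  let A : ℕ → X.obj →ₗ[ℂ] X.obj := fun n => (a n ≫ b n).hom.hom.toLinearMap
  have hA : ∀ n g x, A n (X.obj.ρ g x) = X.obj.ρ g (A n x) := fun n g x =>
    Rep.hom_comm_apply (a n ≫ b n).hom g x
  have hAA : ∀ n x, A (n + 1) (A n x) = A n x := fun n x =>
    congrArg (fun t => t.hom.hom x) (hab n)
  have hl : ∀ n, ∃ B : X.obj →ₗ[ℂ] E.obj, (∀ g x, B (X.obj.ρ g x) = E.obj.ρ g (B x)) ∧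
      ∀ x, e.hom.hom (B x) = f.hom.hom (A n x) := by
    intro n
    refine ⟨(a n ≫ Projective.factorThru (b n ≫ f) e).hom.hom.toLinearMap, fun g x =>
      Rep.hom_comm_apply (a n ≫ Projective.factorThru (b n ≫ f) e).hom g x, fun x => ?_⟩
    exact congrArg (fun t => t.hom.hom ((a n).hom.hom x)) (Projective.factorThru_comp (b n ≫ f) e)
  choose B hB hBe using hl
  -- The lifts `B n` of `f ∘ A n` need not be compatible. Using `B (n + 1) ∘ (1 - A n)` as
  -- increments makes the sum over `n` finite on each vector, and `A (n + 1) ∘ A n = A n` makes it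
  -- telescope to `f` after applying `e`.
  let D : ℕ → X.obj →ₗ[ℂ] E.obj := fun n => B (n + 1) ∘ₗ (LinearMap.id - A n)
  have hD : ∀ n x, D n x = B (n + 1) (x - A n x) := fun _ _ => rfl
  have hDfin : ∀ x, (Function.support fun n => D n x).Finite := by
    intro x
    obtain ⟨N, hN⟩ := hfin x
    refine (Finset.range N).finite_toSet.subset fun n hn => ?_
    by_contra h
    refine hn ?_
    change D n x = 0
    rw [hD, show A n x = x from hN n (by simpa using h), sub_self, map_zero]
  obtain ⟨F, hF⟩ := exists_linearMap_finsum D hDfin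
  refine ⟨B 0 + F, fun g x => ?_, fun x => ?_⟩
  · rw [LinearMap.add_apply, LinearMap.add_apply, map_add, hB, hF, hF]
    refine congrArg _ (Eq.trans ?_ ((E.obj.ρ g).toAddMonoidHom.map_finsum (hDfin x)).symm)
    refine finsum_congr fun n => ?_
    change D n _ = E.obj.ρ g (D n x)
    rw [hD, hD, hA, ← map_sub, hB]
  · obtain ⟨N, hN⟩ := hfin x
    have hs : (Function.support fun n => D n x) ⊆ (Finset.range N : Set ℕ) := by
      intro n hn
      by_contra h
      refine hn ?_
      change D n x = 0
      rw [hD, show A n x = x from hN n (by simpa using h), sub_self, map_zero]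
    have h1 : ∀ n, e.hom.hom (D n x) = f.hom.hom (A (n + 1) x) - f.hom.hom (A n x) := by
      intro n
      rw [hD, hBe, map_sub, map_sub, hAA]
    rw [LinearMap.add_apply, map_add, hBe, hF, finsum_eq_sum_of_support_subset _ hs, map_sum,
      Finset.sum_congr rfl fun n _ => h1 n, Finset.sum_range_sub (fun n => f.hom.hom (A n x)),
      add_sub_cancel,
      show A N x = x from hN N le_rfl]

end CompactInduction

/-! ### Projectivity of representations induced from the trivial subgroup -/

section TestProjective

variable {G : Type} [Group G] [TopologicalSpace G] [IsLGroup G]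

/-- Countability of the topology enters here: it allows test functions to be exhausted by a sequence
of spaces of left invariant functions, as `SmoothRep.projective_of_approx` requires. -/
theorem exists_antitone_compact_openSubgroups (G : Type) [Group G] [TopologicalSpace G]
    [IsLGroup G] : ∃ L : ℕ → OpenSubgroup G, (∀ n, IsCompact (L n : Set G)) ∧
      (∀ n, L (n + 1) ≤ L n) ∧ ∀ U ∈ 𝓝 (1 : G), ∃ N, ∀ n ≥ N, (L n : Set G) ⊆ U := by
  obtain ⟨B, hB⟩ := (𝓝 (1 : G)).exists_antitone_basis
  choose M hM hMB using fun n => IsLGroup.exists_compact_openSubgroup (hB.1.mem_of_mem (i := n) trivial)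
  let L : ℕ → OpenSubgroup G := fun n => Nat.rec (M 0) (fun n K => K ⊓ M (n + 1)) n
  have hLM : ∀ n, L n ≤ M n := fun n => by
    cases n with
    | zero => exact le_rfl
    | succ n => exact inf_le_right
  refine ⟨L, fun n => (hM n).of_isClosed_subset (L n).isClosed (hLM n),
    fun n => inf_le_left, fun U hU => ?_⟩
  obtain ⟨N, -, hN⟩ := hB.1.mem_iff.1 hU
  exact ⟨N, fun n hn x hx => hN (hB.2 hn (hMB n (hLM n hx)))⟩

instance (L : OpenSubgroup G) : IsClosed (L.toSubgroup : Set G) := L.isClosed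

/-- The normalized invariant functional on functions on a compact group. -/
theorem exists_normalized_functional {L : OpenSubgroup G} (hL : IsCompact (L : Set G)) :
    ∃ I : testSpace L.toSubgroup →ₗ[ℂ] ℂ, IsInvariantFunctional I ∧
      ∀ (f : testSpace L.toSubgroup) (z : ℂ), (∀ x, f.1 x = z) → I f = z := by
  have : CompactSpace L.toSubgroup := isCompact_iff_compactSpace.1 hL
  obtain ⟨I, hI, hI0⟩ := exists_invariant_functional L.toSubgroup
  let u : testSpace L.toSubgroup := ⟨fun _ => 1, mem_indSpace_bot (IsLocallyConstant.const 1)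
    isCompact_univ (Set.subset_univ _)⟩
  have hu : I u ≠ 0 := bump_functional_ne_zero (K := ⊤) hI hI0 isCompact_univ
    ⟨fun _ _ _ => rfl, fun y _ => ⟨1, one_mem _, y, trivial, (one_mul y).symm⟩⟩ one_ne_zero
  refine ⟨(I u)⁻¹ • I, fun g f => congrArg ((I u)⁻¹ • ·) (hI g f), fun f z hf => ?_⟩
  have : f = z • u := testSpace_ext fun x => (hf x).trans (mul_one z).symm
  rw [this, LinearMap.smul_apply, map_smul, smul_comm, smul_eq_mul (I u)⁻¹, inv_mul_cancel₀ hu,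
    smul_eq_mul, mul_one]

variable (G) in
/-- The representation on test functions is projective. -/
theorem SmoothRep.projective_test :
    Projective (SmoothRep.ofRep (indRep (botRep G)) indRep_isSmoothVector) := by
  obtain ⟨L, hL, hLa, hLU⟩ := exists_antitone_compact_openSubgroups G
  choose I hI hI1 using fun n => exists_normalized_functional (hL n)
  let σ : ∀ n, Representation ℂ (L n).toSubgroup ℂ := fun n =>
    Representation.trivial ℂ (L n).toSubgroup ℂ
  have hIσ : ∀ n h w, I n (indRep (botRep (L n).toSubgroup) h w) = σ n h (I n w) :=
    fun n h w => hI n h w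
  -- `a n` averages a test function over left translations by `L n`, and `b n` below is the
  -- inclusion of the left `L n`-invariant functions.
  let a : ∀ n, testSpace G →ₗ[ℂ] indSpace (L n).toSubgroup (σ n) := fun n =>
    indSpaceMap (I n) (hIσ n) ∘ₗ (indTrans (botRep G) (botRep (L n).toSubgroup)).toLinearMap
  have ha : ∀ n f x, (a n f).1 x = I n (sliceFun (botRep G) (botRep (L n).toSubgroup) f x) :=
    fun _ _ _ => rfl
  let b : ∀ n, indSpace (L n).toSubgroup (σ n) →ₗ[ℂ] testSpace G := fun n =>
    { toFun := fun φ => ⟨φ.1, by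
        obtain ⟨h1, -, C, hC, hφC⟩ := φ.2
        exact mem_indSpace_bot h1 ((hL n).mul hC) hφC⟩
      map_add' := fun _ _ => rfl
      map_smul' := fun _ _ => rfl }
  have hbL : ∀ n φ, ∀ l ∈ L n, ∀ x, (b n φ).1 (l * x) = (b n φ).1 x := fun n φ l hl x =>
    φ.2.2.1 ⟨l, hl⟩ x
  have hba : ∀ n f, (∀ l ∈ L n, ∀ x, f.1 (l * x) = f.1 x) → b n (a n f) = f := by
    intro n f hf
    refine testSpace_ext fun x => ?_
    change I n (sliceFun (botRep G) (botRep (L n).toSubgroup) f x) = f.1 x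
    exact hI1 n _ _ fun l => hf l l.2 x
  have hProj := fun n => SmoothRep.projective_ind_compact (hL n)
  refine SmoothRep.projective_of_approx (P := fun n => SmoothRep.ofRep (indRep (σ n))
    indRep_isSmoothVector) (fun n => SmoothRep.homOf (a n) fun g f => ?_)
    (fun n => SmoothRep.homOf (b n) fun g f => rfl) (fun n => ?_) fun f => ?_
  · change indSpaceMap (I n) (hIσ n) (indTrans _ _ (indRep (botRep G) g f)) = _
    rw [indTrans_equivariant]
    rfl
  · refine SmoothRep.hom_ext fun f => ?_
    exact hba (n + 1) (b n (a n f)) fun l hl => hbL n _ l (hLa n hl)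
  · obtain ⟨U, hU⟩ := indRep_isSmoothVector (invTest f)
    obtain ⟨N, hN⟩ := hLU U U.mem_nhds_one
    refine ⟨N, fun n hn => hba n f fun l hl x => ?_⟩
    have h1 := congrFun (congrArg Subtype.val (hU l⁻¹ (inv_mem (hN n hn hl)))) x⁻¹
    change f.1 (x⁻¹ * l⁻¹)⁻¹ = f.1 x⁻¹⁻¹ at h1
    rwa [mul_inv_rev, inv_inv, inv_inv] at h1

theorem finite_range_of_mem_indSpace_bot {U : Type} [AddCommGroup U] [Module ℂ U]
    {σ : Representation ℂ (⊥ : Subgroup G) U} (f : indSpace ⊥ σ) : (Set.range f.1).Finite := by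
  obtain ⟨C, hC, hfC⟩ := exists_compact_support_of_mem_indSpace_bot f
  have : CompactSpace C := isCompact_iff_compactSpace.1 hC
  have h := (f.2.1.comp_continuous (continuous_subtype_val (p := (· ∈ C)))).range_finite
  rw [Set.range_comp, Subtype.range_coe] at h
  refine (h.union (Set.finite_singleton 0)).subset ?_
  rintro _ ⟨x, rfl⟩
  by_cases hx : x ∈ C
  · exact Or.inl ⟨x, hx, rfl⟩
  · exact Or.inr (not_not.1 fun h => hx (hfC h))

/-- Representations induced from the trivial subgroup are projective. -/
theorem SmoothRep.projective_ind_bot {U : Type} [AddCommGroup U] [Module ℂ U]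
    (σ : Representation ℂ (⊥ : Subgroup G) U) :
    Projective (SmoothRep.ofRep (indRep σ) indRep_isSmoothVector) := by
  classical
  rw [SmoothRep.projective_iff]
  intro E Y f e _
  have hbot : ∀ h : (⊥ : Subgroup G), h = 1 := fun h => Subsingleton.elim _ _
  let v := Module.Basis.ofVectorSpace ℂ U
  have hj : ∀ i h (z : ℂ), LinearMap.toSpanSingleton ℂ U (v i) (botRep G h z) =
      σ h (LinearMap.toSpanSingleton ℂ U (v i) z) := by
    intro i h z
    rw [hbot h, σ.map_one, (botRep G).map_one]
    rfl
  have hp : ∀ i h u, v.coord i (σ h u) = botRep G h (v.coord i u) := by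
    intro i h u
    rw [hbot h, σ.map_one, (botRep G).map_one]
    rfl
  -- A basis of `U` splits the induced representation into copies of the test functions. A given
  -- function has finitely many values, so only finitely many coordinates occur and the lifts on the
  -- summands can be added.
  let j := fun i => indSpaceMap _ (hj i)
  let p := fun i => indSpaceMap _ (hp i)
  have hproj := SmoothRep.projective_test G
  rw [SmoothRep.projective_iff] at hproj
  choose F hF hFe using fun i => hproj E Y (SmoothRep.homOf (X := SmoothRep.ofRep (indRep (botRep G))
    indRep_isSmoothVector) (f.hom.hom.toLinearMap ∘ₗ j i) fun g φ =>
      Rep.hom_comm_apply f.hom g (j i φ)) e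
  let S : indSpace ⊥ σ → Finset _ := fun Φ =>
    (finite_range_of_mem_indSpace_bot Φ).toFinset.biUnion fun u => (v.repr u).support
  have hS : ∀ Φ x, (v.repr (Φ.1 x)).support ⊆ S Φ := by
    intro Φ x
    refine Finset.subset_biUnion_of_mem (fun u => (v.repr u).support) ?_
    rw [Set.Finite.mem_toFinset]
    exact ⟨x, rfl⟩
  have hD0 : ∀ Φ, ∀ i ∉ S Φ, p i Φ = 0 := by
    intro Φ i hi
    refine Subtype.ext (funext fun x => ?_)
    exact Finsupp.notMem_support_iff.1 fun h => hi (hS Φ x h)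
  let D := fun i => F i ∘ₗ p i
  have hDs : ∀ Φ, (Function.support fun i => D i Φ) ⊆ S Φ := by
    intro Φ i hi
    by_contra h
    refine hi ?_
    change F i (p i Φ) = 0
    rw [hD0 Φ i h, map_zero]
  have hDfin := fun Φ => (S Φ).finite_toSet.subset (hDs Φ)
  obtain ⟨T, hT⟩ := exists_linearMap_finsum D hDfin
  refine ⟨T, fun g Φ => ?_, fun Φ => ?_⟩
  · refine (hT _).trans (Eq.trans ?_ ((congrArg (E.obj.ρ g) (hT Φ)).trans
      ((E.obj.ρ g).toAddMonoidHom.map_finsum (hDfin Φ))).symm)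
    exact finsum_congr fun i => hF i g (p i Φ)
  · have h1 : ∑ i ∈ S Φ, j i (p i Φ) = Φ := by
      refine Subtype.ext (funext fun x => ?_)
      rw [Submodule.coe_sum, Finset.sum_apply]
      change ∑ i ∈ S Φ, v.repr (Φ.1 x) i • v i = Φ.1 x
      conv_rhs => rw [← v.linearCombination_repr (Φ.1 x), Finsupp.linearCombination_apply]
      exact (Finsupp.sum_of_support_subset _ (hS Φ x) (fun i z => z • v i)
        fun i _ => zero_smul ℂ (v i)).symm
    rw [hT, finsum_eq_sum_of_support_subset _ (hDs Φ), map_sum]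
    conv_rhs => rw [← h1]
    refine Eq.trans ?_ (map_sum f.hom.hom.toLinearMap (fun i => j i (p i Φ)) (S Φ)).symm
    exact Finset.sum_congr rfl fun i _ => hFe i (p i Φ)

end TestProjective

/-! ### Tensoring and induction preserve projectives -/

section PreservesProjectives

variable {G : Type} [Group G] [TopologicalSpace G] [IsLGroup G]

variable (G) in
/-- The smooth representation of `G` on test functions by right translations. -/
abbrev SmoothRep.test : SmoothRep G := SmoothRep.ofRep (indRep (botRep G)) indRep_isSmoothVector

theorem isSmoothVector_of_bot {W : Type} [AddCommGroup W] [Module ℂ W]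
    (σ : Representation ℂ (⊥ : Subgroup G) W) (w : W) : σ.IsSmoothVector w :=
  ⟨⊤, fun h _ => by rw [Subsingleton.elim h 1, σ.map_one, Module.End.one_apply]⟩

/-- `W ⊗ S(G)` is induced from the trivial subgroup. -/
def SmoothRep.tensorTestIso (W : SmoothRep G) : W ⊗ SmoothRep.test G ≅
    SmoothRep.ofRep (indRep (Representation.tprod (W.obj.ρ.comp (⊥ : Subgroup G).subtype)
      (botRep G))) indRep_isSmoothVector :=
  SmoothRep.isoOf (X := W ⊗ SmoothRep.test G)
    (tensorIndEquiv (σ := botRep G) W.property (isSmoothVector_of_bot _))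
    fun g t => tensorInd_equivariant W.property g t

instance SmoothRep.projective_tensor_test (W : SmoothRep G) :
    Projective (W ⊗ SmoothRep.test G) :=
  have := SmoothRep.projective_ind_bot
    (Representation.tprod (W.obj.ρ.comp (⊥ : Subgroup G).subtype) (botRep G))
  Projective.of_iso (SmoothRep.tensorTestIso W).symm this

/-- A projective representation `W` is a direct summand of `W ⊗ S(G)`. -/
theorem SmoothRep.exists_retract_tensor_test (W : SmoothRep G) [Projective W] :
    ∃ (i : W ⟶ W ⊗ SmoothRep.test G) (r : W ⊗ SmoothRep.test G ⟶ W), i ≫ r = 𝟙 W := by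
  obtain ⟨I, hI, hI0⟩ := exists_invariant_functional G
  -- Integration `w ⊗ f ↦ I f • w` is an equivariant surjection, and it splits because `W` is
  -- projective.
  let r : TensorProduct ℂ W.obj (testSpace G) →ₗ[ℂ] W.obj :=
    (TensorProduct.rid ℂ W.obj).toLinearMap ∘ₗ I.lTensor W.obj
  have hr : ∀ w f, r (w ⊗ₜ f) = I f • w := fun w f => rfl
  let r' : W ⊗ SmoothRep.test G ⟶ W := SmoothRep.homOf (X := W ⊗ SmoothRep.test G) r fun g t => by
    change TensorProduct ℂ W.obj (testSpace G) at t
    change r ((W.obj.ρ.tprod (indRep (botRep G))) g t) = W.obj.ρ g (r t)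
    induction t using TensorProduct.induction_on with
    | zero => simp only [map_zero]
    | add a b ha hb => simp only [map_add, ha, hb]
    | tmul w f =>
      rw [Representation.tprod_apply, TensorProduct.map_tmul, hr, hr, hI, map_smul]
  have : Epi r' := SmoothRep.epi_of_surjective _ fun w => by
    obtain ⟨f, hf⟩ := LinearMap.surjective hI0 1
    exact ⟨w ⊗ₜ[ℂ] f, (hr w f).trans (by rw [hf, one_smul])⟩
  exact ⟨Projective.factorThru (𝟙 W) r', r', Projective.factorThru_comp _ _⟩

/-- `X ⊗ W` is a retract of `X ⊗ (W ⊗ S(G)) ≅ (X ⊗ W) ⊗ S(G)`, which is induced from the trivial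
subgroup. -/
instance SmoothRep.tensorLeft_preservesProjectiveObjects (X : SmoothRep G) :
    (tensorLeft X).PreservesProjectiveObjects where
  projective_obj {W} _ := by
    obtain ⟨i, r, h⟩ := SmoothRep.exists_retract_tensor_test W
    have : Projective (X ⊗ (W ⊗ SmoothRep.test G)) :=
      Projective.of_iso (α_ X W (SmoothRep.test G)) inferInstance
    exact projective_of_retract (X := X ⊗ W) (X ◁ i) (X ◁ r) (by
      rw [← MonoidalCategory.whiskerLeft_comp, h, MonoidalCategory.whiskerLeft_id])

variable {H : Subgroup G}

instance SmoothRep.twist_preservesProjectiveObjects (δ : smoothChar H) [IsClosed (H : Set G)]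
    (k : ℕ) : (SmoothRep.twist H δ k).PreservesProjectiveObjects where
  projective_obj {W} _ := by
    have h1 : Projective ((tensorLeft ((SmoothRep.res H).obj (SmoothRep.J G k))).obj W) :=
      Functor.PreservesProjectiveObjects.projective_obj inferInstance
    exact Functor.PreservesProjectiveObjects.projective_obj
      (F := tensorLeft (SmoothRep.ofChar δ)) h1

/-- `ind W` is a retract of `ind (W ⊗ S(H))`, which by transitivity is induced from the trivial
subgroup of `G`. -/
instance SmoothRep.ind_preservesProjectiveObjects [IsClosed (H : Set G)] :
    (SmoothRep.ind H).PreservesProjectiveObjects where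
  projective_obj {W} _ := by
    obtain ⟨i, r, h⟩ := SmoothRep.exists_retract_tensor_test W
    let τ := Representation.tprod (W.obj.ρ.comp (⊥ : Subgroup H).subtype) (botRep H)
    let σ : Representation ℂ (⊥ : Subgroup G) (TensorProduct ℂ W.obj ℂ) := 1
    have h1 := SmoothRep.projective_ind_bot σ
    have e : SmoothRep.ofRep (indRep σ) indRep_isSmoothVector ≅
        (SmoothRep.ind H).obj (SmoothRep.ofRep (indRep τ) indRep_isSmoothVector) :=
      SmoothRep.isoOf (indTrans σ τ) fun g f => indTrans_equivariant σ τ g f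
    have : Projective ((SmoothRep.ind H).obj (W ⊗ SmoothRep.test H)) :=
      Projective.of_iso (e ≪≫ (SmoothRep.ind H).mapIso (SmoothRep.tensorTestIso W).symm) h1
    exact projective_of_retract ((SmoothRep.ind H).map i) ((SmoothRep.ind H).map r) (by
      rw [← CategoryTheory.Functor.map_comp, h, CategoryTheory.Functor.map_id])

end PreservesProjectives

/-! ### Uniqueness of `δ` and one-dimensionality -/

section Uniqueness

variable {G : Type} [Group G] [TopologicalSpace G] [IsLGroup G] {H : Subgroup G}

theorem IndFunctional.exists_toFunctional_ne_zero {δ : smoothChar H}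
    (h : Nontrivial (IndFunctional H δ)) : ∃ Λ : IndFunctional H δ, Λ.toFunctional ≠ 0 := by
  obtain ⟨Λ, hΛ⟩ := exists_ne (0 : IndFunctional H δ)
  exact ⟨Λ, IndFunctional.toFunctional_ne_zero hΛ⟩

theorem IndFunctional.nontrivial_of_functional {δ : smoothChar H}
    {T : indSpace H (charRepresentation (δ⁻¹).1) →ₗ[ℂ] ℂ} (hT : IsInvariantFunctional T)
    (h0 : T ≠ 0) : Nontrivial (IndFunctional H δ) :=
  ⟨IndFunctional.ofFunctional T hT, 0, fun h => h0 (congrArg IndFunctional.toFunctional h)⟩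

theorem IndFunctional.exists_nontrivial (H : Subgroup G) [IsClosed (H : Set G)] :
    ∃ δ : smoothChar H, Nontrivial (IndFunctional H δ) := by
  obtain ⟨δ, Λ, hΛ, h0⟩ := exists_char_invariant_functional H
  exact ⟨δ, IndFunctional.nontrivial_of_functional hΛ h0⟩

/-- A nonzero invariant functional on `ind δ'⁻¹` comes from a nonzero `H`-map `δ'⁻¹ → δ⁻¹` of
one-dimensional representations, which forces the characters to agree. -/
theorem IndFunctional.char_unique {δ δ' : smoothChar H} (h : Nontrivial (IndFunctional H δ))
    (h' : Nontrivial (IndFunctional H δ')) : δ' = δ := by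
  obtain ⟨Λ, hΛ⟩ := IndFunctional.exists_toFunctional_ne_zero h
  obtain ⟨Λ', hΛ'⟩ := IndFunctional.exists_toFunctional_ne_zero h'
  obtain ⟨ℓ, hℓ, e⟩ := exists_liftFunctional_eq (charRepresentation_isSmoothVector δ'⁻¹)
    Λ.invariant hΛ _ Λ'.invariant
  have h1 : ℓ 1 ≠ 0 := by
    intro h1
    have h2 : ℓ = 0 := LinearMap.ext_ring h1
    refine hΛ' (e.symm.trans (LinearMap.ext fun φ => ?_))
    have : indSpaceMap ℓ hℓ φ = 0 := Subtype.ext (funext fun x => by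
      rw [indSpaceMap_apply, h2]
      rfl)
    change Λ.toFunctional (indSpaceMap ℓ hℓ φ) = 0
    rw [this, map_zero]
  refine Subtype.ext (MonoidHom.ext fun h => ?_)
  have h2 := hℓ h 1
  rw [charRepresentation_inv_apply, charRepresentation_inv_apply, ← smul_eq_mul, map_smul,
    smul_eq_mul] at h2
  exact Units.ext (inv_injective (mul_right_cancel₀ h1 h2))

theorem IndFunctional.finrank_eq_one {δ : smoothChar H} (h : Nontrivial (IndFunctional H δ)) :
    Module.finrank ℂ (IndFunctional H δ) = 1 := by
  obtain ⟨Λ, hΛ⟩ := exists_ne (0 : IndFunctional H δ)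
  rw [finrank_eq_one_iff_of_nonzero' Λ hΛ]
  intro T
  obtain ⟨c, hc⟩ := exists_eq_smul_of_invariant Λ.invariant
    (IndFunctional.toFunctional_ne_zero hΛ) T.invariant
  exact ⟨c, IndFunctional.toFunctional_injective hc.symm⟩

end Uniqueness

/-! ### Functions on `G / H` and admissibility -/

section HomogeneousSpace

variable {G : Type} [Group G] [TopologicalSpace G] [IsLGroup G] {H : Subgroup G}

/-- Images of translates of a compact open subgroup are open in `G / H`, and finitely many of them
cover `D`. -/
theorem exists_isCompact_image_mk_superset {D : Set (G ⧸ H)} (hD : IsCompact D) :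
    ∃ C : Set G, IsCompact C ∧ D ⊆ (QuotientGroup.mk : G → G ⧸ H) '' C := by
  obtain ⟨K, hK, -⟩ := IsLGroup.exists_compact_openSubgroup (G := G) Filter.univ_mem
  obtain ⟨F, -, hF⟩ := hD.elim_nhds_subcover
    (fun q => (QuotientGroup.mk : G → G ⧸ H) '' (q.out • (K : Set G))) fun q _ => by
      refine (QuotientGroup.isOpenMap_coe _ (K.isOpen.smul _)).mem_nhds
        ⟨q.out, ⟨1, one_mem K, mul_one _⟩, QuotientGroup.out_eq' q⟩
  refine ⟨⋃ q ∈ F, q.out • (K : Set G), F.isCompact_biUnion fun q _ => hK.smul _, ?_⟩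
  rw [Set.image_iUnion₂]
  exact hF

/-- The function `x H ↦ χ(x)⁻¹ φ(x⁻¹)` on `G / H`. -/
def schwartzOfInd {χ : smoothChar G}
    (φ : indSpace H (charRepresentation ((smoothChar.res H χ)⁻¹).1)) (q : G ⧸ H) : ℂ :=
  Quotient.liftOn' q (fun x => (χ.1 x : ℂ)⁻¹ * φ.1 x⁻¹) (by
    intro a b hab
    rw [QuotientGroup.leftRel_apply] at hab
    have h1 := φ.2.2.1 ⟨_, inv_mem hab⟩ a⁻¹
    rw [charRepresentation_inv_apply] at h1
    have h2 : ((a⁻¹ * b)⁻¹ * a⁻¹ : G) = b⁻¹ := by group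
    change φ.1 ((a⁻¹ * b)⁻¹ * a⁻¹) = (χ.1 (a⁻¹ * b)⁻¹ : ℂ)⁻¹ * φ.1 a⁻¹ at h1
    rw [h2] at h1
    rw [h1, map_inv, map_mul, map_inv]
    push_cast
    field_simp)

theorem schwartzOfInd_mk {χ : smoothChar G}
    (φ : indSpace H (charRepresentation ((smoothChar.res H χ)⁻¹).1)) (x : G) :
    schwartzOfInd φ (x : G ⧸ H) = (χ.1 x : ℂ)⁻¹ * φ.1 x⁻¹ := rfl

theorem schwartzOfInd_mem {χ : smoothChar G}
    (φ : indSpace H (charRepresentation ((smoothChar.res H χ)⁻¹).1)) :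
    schwartzOfInd φ ∈ schwartz (G ⧸ H) := by
  have hlc : IsLocallyConstant (schwartzOfInd φ) := by
    intro s
    refine (QuotientGroup.isQuotientMap_mk (N := H)).isOpen_preimage.1 ?_
    exact ((χ.2.comp (fun u : ℂˣ => (u : ℂ)⁻¹)).mul
      (φ.2.1.comp_continuous continuous_inv)) s
  refine ⟨hlc, ?_⟩
  obtain ⟨-, -, C, hC, hφC⟩ := φ.2
  have hcl : IsClosed (Function.support (schwartzOfInd φ)) :=
    (hlc.isClopen_fiber 0).2.isClosed_compl
  rw [HasCompactSupport, tsupport, hcl.closure_eq]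
  refine (hC.inv.image (QuotientGroup.continuous_mk (N := H))).of_isClosed_subset hcl
    fun q hq => ?_
  induction q using QuotientGroup.induction_on with
  | H x =>
    rw [Function.mem_support, schwartzOfInd_mk] at hq
    obtain ⟨h, hh, c, hc, e⟩ := hφC (right_ne_zero_of_mul hq)
    refine ⟨c⁻¹, Set.inv_mem_inv.2 hc, QuotientGroup.eq.2 ?_⟩
    have : (c⁻¹)⁻¹ * x = h⁻¹ := by
      rw [← inv_inv x, ← e]
      simp
    rw [this]
    exact inv_mem hh

/-- The identification of functions `f` on `G / H` with the functions `x ↦ χ(x)⁻¹ f(x⁻¹ H)`. -/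
def schwartzEquiv (H : Subgroup G) (χ : smoothChar G) : schwartz (G ⧸ H) ≃ₗ[ℂ]
    indSpace H (charRepresentation ((smoothChar.res H χ)⁻¹).1) where
  toFun f := ⟨fun x => (χ.1 x : ℂ)⁻¹ * f.1 (x⁻¹ : G), by
    have hc : Continuous fun x : G => ((x⁻¹ : G) : G ⧸ H) :=
      QuotientGroup.continuous_mk.comp continuous_inv
    obtain ⟨C, hC, hDC⟩ := exists_isCompact_image_mk_superset f.2.2
    refine ⟨(χ.2.comp (fun u : ℂˣ => (u : ℂ)⁻¹)).mul (f.2.1.comp_continuous hc), fun h x => ?_,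
      C⁻¹, hC.inv, fun x hx => ?_⟩
    · rw [charRepresentation_inv_apply]
      change (χ.1 (h * x) : ℂ)⁻¹ * f.1 ((h * x)⁻¹ : G) =
        (χ.1 h : ℂ)⁻¹ * ((χ.1 x : ℂ)⁻¹ * f.1 (x⁻¹ : G))
      rw [map_mul, mul_inv_rev]
      have : (((x⁻¹ * (h : G)⁻¹ : G)) : G ⧸ H) = (x⁻¹ : G) := QuotientGroup.eq.2 (by simp)
      rw [this]
      push_cast
      rw [mul_inv_rev]
      ring
    · have hx' : ((x⁻¹ : G) : G ⧸ H) ∈ tsupport f.1 := subset_tsupport _ (right_ne_zero_of_mul hx)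
      obtain ⟨c, hc, e⟩ := hDC hx'
      refine ⟨x * c, ?_, c⁻¹, Set.inv_mem_inv.2 hc, by simp⟩
      have := QuotientGroup.eq.1 e.symm
      rwa [inv_inv] at this⟩
  map_add' f f' := Subtype.ext (funext fun x => mul_add _ (f.1 (x⁻¹ : G)) (f'.1 (x⁻¹ : G)))
  map_smul' c f := Subtype.ext (funext fun x => mul_left_comm _ c (f.1 (x⁻¹ : G)))
  invFun φ := ⟨schwartzOfInd φ, schwartzOfInd_mem φ⟩
  left_inv f := Subtype.ext (funext fun q => by
    induction q using QuotientGroup.induction_on with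
    | H x =>
      change (χ.1 x : ℂ)⁻¹ * ((χ.1 x⁻¹ : ℂ)⁻¹ * f.1 (x⁻¹⁻¹ : G)) = f.1 x
      rw [inv_inv, map_inv]
      push_cast
      field_simp)
  right_inv φ := Subtype.ext (funext fun x => by
    change (χ.1 x : ℂ)⁻¹ * ((χ.1 x⁻¹ : ℂ)⁻¹ * φ.1 x⁻¹⁻¹) = φ.1 x
    rw [inv_inv, map_inv]
    push_cast
    field_simp)

variable (G) in
/-- The representation of `G` on `schwartz X`. -/
abbrev schwartzRep (X : Type) [TopologicalSpace X] [MulAction G X] [ContinuousSMul G X] :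
    Representation ℂ G (schwartz X) :=
  (translation G X).subrepresentation (schwartz X) (schwartz_le_comap G X)

/-- The factor `χ g` is what turns `χ`-equivariant functionals on `S(G/H)` into invariant
functionals on the representation induced from the inverse of `χ|_H`. For `χ = 1` it disappears and
the equivalence is an isomorphism of representations. -/
theorem schwartzEquiv_translation (χ : smoothChar G) (g : G) (f : schwartz (G ⧸ H)) :
    schwartzEquiv H χ (schwartzRep G (G ⧸ H) g f) =
      (χ.1 g : ℂ) • indRep _ g (schwartzEquiv H χ f) :=
  Subtype.ext (funext fun x => by
    change (χ.1 x : ℂ)⁻¹ * f.1 ((g⁻¹ * x⁻¹ : G) : G ⧸ H) =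
      (χ.1 g : ℂ) * ((χ.1 (x * g) : ℂ)⁻¹ * f.1 ((x * g)⁻¹ : G))
    rw [mul_inv_rev, map_mul]
    push_cast
    field_simp)

theorem isAdmissible_iff_nontrivial (χ : smoothChar G) :
    IsAdmissible H χ ↔ Nontrivial (IndFunctional H (smoothChar.res H χ)) := by
  have hχ : ∀ g, (χ.1 g : ℂ) ≠ 0 := fun g => Units.ne_zero _
  let e := schwartzEquiv H χ
  constructor
  · intro h
    change Nontrivial (SmoothRep.schwartz G (G ⧸ H) ⟶ SmoothRep.ofChar χ) at h
    obtain ⟨T, hT⟩ := exists_ne (0 : SmoothRep.schwartz G (G ⧸ H) ⟶ SmoothRep.ofChar χ)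
    let T' : schwartz (G ⧸ H) →ₗ[ℂ] ℂ := T.hom.hom.toLinearMap
    have hT' : ∀ g f, T' (schwartzRep G (G ⧸ H) g f) = (χ.1 g : ℂ) * T' f :=
      fun g f => Rep.hom_comm_apply T.hom g f
    refine IndFunctional.nontrivial_of_functional (T := T' ∘ₗ e.symm.toLinearMap) (fun g φ => ?_)
      fun h0 => hT (SmoothRep.hom_ext fun f => ?_)
    · obtain ⟨f, rfl⟩ := e.surjective φ
      have h1 : indRep _ g (e f) =
          (χ.1 g : ℂ)⁻¹ • e (schwartzRep G (G ⧸ H) g f) := by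
        rw [schwartzEquiv_translation, smul_smul, inv_mul_cancel₀ (hχ g), one_smul]
      rw [h1, map_smul]
      change (χ.1 g : ℂ)⁻¹ * T' (e.symm (e _)) = T' (e.symm (e f))
      rw [e.symm_apply_apply, e.symm_apply_apply, hT', inv_mul_cancel_left₀ (hχ g)]
    · have h1 := LinearMap.congr_fun h0 (e f)
      exact (congrArg T' (e.symm_apply_apply f)).symm.trans h1
  · intro h
    obtain ⟨Λ, hΛ⟩ := IndFunctional.exists_toFunctional_ne_zero h
    refine ⟨SmoothRep.homOf (X := SmoothRep.schwartz G (G ⧸ H)) (Y := SmoothRep.ofChar χ)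
      (Λ.toFunctional ∘ₗ e.toLinearMap) fun g f => ?_, 0, fun h0 => hΛ (LinearMap.ext fun φ => ?_)⟩
    · refine (congrArg Λ.toFunctional (schwartzEquiv_translation χ g f)).trans ?_
      rw [map_smul, Λ.invariant]
      rfl
    · obtain ⟨f, rfl⟩ := e.surjective φ
      exact congrArg (fun t => t.hom.hom f) h0

end HomogeneousSpace

/-! ### Extensions from `S(G/H)` to a character -/

section DualChar

variable {G : Type} [Group G] [TopologicalSpace G] [IsTopologicalGroup G]

/-- The contragredient of the inverse of a character is the character. -/
def SmoothRep.dualCharIso (χ : smoothChar G) : (SmoothRep.ofChar χ⁻¹).dual ≅ SmoothRep.ofChar χ :=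
  SmoothRep.isoOf (X := (SmoothRep.ofChar χ⁻¹).dual) (Y := SmoothRep.ofChar χ)
    { toFun := fun l : (charRepresentation (χ⁻¹).1).dual.smoothVectors => l.1 (1 : ℂ)
      map_add' := fun _ _ => rfl
      map_smul' := fun _ _ => rfl
      invFun := fun z : ℂ => (⟨LinearMap.lsmul ℂ ℂ z, by
        obtain ⟨U, hU⟩ := (SmoothRep.ofChar χ).property z
        refine ⟨U, fun g hg => LinearMap.ext_ring ?_⟩
        have h1 : (χ.1 g : ℂ) * z = z := hU g hg
        change z * ((((χ.1 g⁻¹)⁻¹ : ℂˣ) : ℂ) * 1) = z * 1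
        rw [map_inv, inv_inv, mul_one, mul_one, mul_comm]
        exact h1⟩ : (charRepresentation (χ⁻¹).1).dual.smoothVectors)
      left_inv := fun l : (charRepresentation (χ⁻¹).1).dual.smoothVectors =>
        Subtype.ext (LinearMap.ext_ring (mul_one (l.1 (1 : ℂ))))
      right_inv := fun z : ℂ => mul_one z }
    fun g l => by
      change l.1 ((((χ.1 g⁻¹)⁻¹ : ℂˣ) : ℂ) • (1 : ℂ)) = (χ.1 g : ℂ) • l.1 (1 : ℂ)
      rw [map_inv, inv_inv]
      exact map_smul l.1 _ _

end DualChar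

section SchwartzExt

variable {G : Type} [Group G] [TopologicalSpace G] [IsLGroup G] {H : Subgroup G}

/-- `S(G/H)` is induced from the trivial representation of `H`. -/
def SmoothRep.schwartzIsoInd (H : Subgroup G) :
    SmoothRep.schwartz G (G ⧸ H) ≅
      (SmoothRep.ind H).obj (SmoothRep.ofChar ((smoothChar.res H (1 : smoothChar G))⁻¹)) :=
  SmoothRep.isoOf (X := SmoothRep.schwartz G (G ⧸ H))
    (Y := (SmoothRep.ind H).obj (SmoothRep.ofChar ((smoothChar.res H (1 : smoothChar G))⁻¹)))
    (schwartzEquiv H 1) fun g f =>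
      (schwartzEquiv_translation 1 g f).trans (one_smul ℂ (indRep _ g (schwartzEquiv H 1 f)))

/-- The inverse of the restriction of the trivial character is the unit. -/
def SmoothRep.ofCharIsoUnit (H : Subgroup G) :
    SmoothRep.ofChar ((smoothChar.res H (1 : smoothChar G))⁻¹) ≅ 𝟙_ (SmoothRep H) :=
  SmoothRep.isoOf (X := SmoothRep.ofChar ((smoothChar.res H (1 : smoothChar G))⁻¹))
    (Y := 𝟙_ (SmoothRep H)) (LinearEquiv.refl ℂ ℂ) fun g (z : ℂ) => by
      change (((1 : ℂˣ)⁻¹ : ℂˣ) : ℂ) * z = z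
      rw [inv_one, Units.val_one, one_mul]

variable [IsClosed (H : Set G)]

attribute [local irreducible] Functor.leftDerived NatTrans.leftDerived

/-- Evaluation of the isomorphism of bifunctors of extensions at a pair of representations. -/
def shapiroIsoApp {δ : smoothChar H} {k : ℕ} (Θ : frobLeft H k ≅ frobRight H δ k) (i : ℕ)
    (V : SmoothRep G) (V₀ : SmoothRep H) :
    ((SmoothRep.genExt G k i).obj (op ((SmoothRep.ind H).obj V₀))).obj V.dual ≅
      ((Ext ℂ (SmoothRep H) i).obj (op ((SmoothRep.twist H δ k).obj V₀))).obj
        ((SmoothRep.res H).obj V).dual :=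
  ((shapiroIso Θ i).app (op V)).app (op V₀)

/-- The isomorphism `Ext_{G,k}^i(S(G/H), χ) ≅ Ext_H^i(δ ⊗ J_{G,k}, χ|_H)`. -/
def schwartzExtIso {δ : smoothChar H} {k : ℕ} (Θ : frobLeft H k ≅ frobRight H δ k) (i : ℕ)
    (χ : smoothChar G) :
    ((SmoothRep.genExt G k i).obj (op (SmoothRep.schwartz G (G ⧸ H)))).obj
        (SmoothRep.ofChar χ) ≅
      ((Ext ℂ (SmoothRep H) i).obj (op (SmoothRep.ofChar δ ⊗
        (SmoothRep.res H).obj (SmoothRep.J G k)))).obj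
        (SmoothRep.ofChar (smoothChar.res H χ)) :=
  -- The isomorphism for `V₀` trivial and `V = χ⁻¹`: the contragredient of `χ⁻¹` is `χ`, both on `G`
  -- and after restriction to `H`, and the tensor factor `V₀` is absorbed by the right unitor.
  ((SmoothRep.genExt G k i).mapIso (SmoothRep.schwartzIsoInd H).op.symm).app _ ≪≫
    ((SmoothRep.genExt G k i).obj _).mapIso (SmoothRep.dualCharIso χ).symm ≪≫
    shapiroIsoApp Θ i (SmoothRep.ofChar χ⁻¹) _ ≪≫
    ((Ext ℂ (SmoothRep H) i).obj _).mapIso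
      (SmoothRep.dualCharIso (smoothChar.res H χ)) ≪≫
    ((Ext ℂ (SmoothRep H) i).mapIso (whiskerLeftIso (SmoothRep.ofChar δ)
      (whiskerLeftIso ((SmoothRep.res H).obj (SmoothRep.J G k)) (SmoothRep.ofCharIsoUnit H) ≪≫
        ρ_ _)).op.symm).app _

end SchwartzExt

end

theorem mainTheorem12 (G : Type) [Group G] [TopologicalSpace G] [IsLGroup G]
    (H : Subgroup G) [IsClosed (H : Set G)] :
    (∃! δ : smoothChar H, Nontrivial (IndFunctional H δ)) ∧
    ∀ δ : smoothChar H, Nontrivial (IndFunctional H δ) →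
      Module.finrank ℂ (IndFunctional H δ) = 1 ∧
      (∀ Λ : IndFunctional H δ, Λ ≠ 0 → ∀ k : ℕ,
        ∃ Θ : frobLeft H k ≅ frobRight H δ k, IsFrobenius Λ Θ ∧
          ∀ i : ℕ, ∃ Φ : shapiroLeft H k i ≅ shapiroRight H δ k i, IsInducedBy Θ Φ) ∧
      (∀ (χ : smoothChar G) (k i : ℕ), Nonempty
        (((SmoothRep.genExt G k i).obj (op (SmoothRep.schwartz G (G ⧸ H)))).obj
            (SmoothRep.ofChar χ) ≅
          ((Ext ℂ (SmoothRep H) i).obj (op (SmoothRep.ofChar δ ⊗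
            (SmoothRep.res H).obj (SmoothRep.J G k)))).obj
            (SmoothRep.ofChar (smoothChar.res H χ)))) ∧
      ∀ χ : smoothChar G, IsAdmissible H χ ↔ smoothChar.res H χ = δ := by
  obtain ⟨δ₀, h₀⟩ := IndFunctional.exists_nontrivial H
  refine ⟨⟨δ₀, h₀, fun δ h => IndFunctional.char_unique h₀ h⟩, fun δ h =>
    ⟨IndFunctional.finrank_eq_one h, fun Λ hΛ k => ⟨frobIso hΛ k, isFrobenius_frobIso hΛ k,
      fun i => ⟨shapiroIso _ i, isInducedBy_shapiroIso _ i⟩⟩, fun χ k i => ?_, fun χ => ?_⟩⟩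
  · obtain ⟨Λ, hΛ⟩ := exists_ne (0 : IndFunctional H δ)
    exact ⟨schwartzExtIso (frobIso hΛ k) i χ⟩
  · rw [isAdmissible_iff_nontrivial]
    exact ⟨fun h' => IndFunctional.char_unique h h', fun e => by rwa [e]⟩
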